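/- Let $R$ be a commutative ring and $k\in\mathbb Z$. The Heisenberg category $\mathcal Heis_k$ of central charge $k$ over $R$ is the strict $R$-linear monoidal category generated by objects $\uparrow,\downarrow$ and morphisms $x:\uparrow\to\uparrow$, $s:\uparrow\otimes\uparrow\to\uparrow\otimes\uparrow$, $c:\mathbb 1\to\downarrow\otimes\uparrow$, $d:\uparrow\otimes\downarrow\to\mathbb 1$, subject to the following relations, where $1$ denotes identity morphisms (an object also denotes its identity) and $t:=(\downarrow\otimes\uparrow\otimes d)\circ(\downarrow\otimes s\otimes\downarrow)\circ(c\otimes\uparrow\otimes\downarrow):\uparrow\otimes\downarrow\to\downarrow\otimes\uparrow$: * degenerate Hecke relations: $s\circ s=1$, $(s\otimes\uparrow)\circ(\uparrow\otimes s)\circ(s\otimes\uparrow)=(\uparrow\otimes s)\circ(s\otimes\uparrow)\circ(\uparrow\otimes s)$, $(x\otimes\uparrow)\circ s-s\circ(\uparrow\otimes x)=1$; * right adjunction: $(d\otimes\uparrow)\circ(\uparrow\otimes c)=1_\uparrow$, $(\downarrow\otimes d)\circ(c\otimes\downarrow)=1_\downarrow$; * inversion: writing $c_n:=(\downarrow\otimes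 x^n)\circ c$ and $d_n:=d\circ(x^n\otimes\downarrow)$, if $k\ge 0$ then the column $[t,d_0,\dots,d_{k-1}]^T:\uparrow\otimes\downarrow\to(\downarrow\otimes\uparrow)\oplus\mathbb 1^{\oplus k}$ is invertible, and if $k<0$ then the row $[t,c_0,\dots,c_{-k-1}]:(\uparrow\otimes\downarrow)\oplus\mathbb 1^{\oplus(-k)}\to\downarrow\otimes\uparrow$ is invertible (that is, the matrix entries of a two-sided inverse are adjoined as further generators). Given morphisms $c':\mathbb 1\to\uparrow\otimes\downarrow$ and $d':\downarrow\otimes\uparrow\to\mathbb 1$, put $c'_n:=(x^n\otimes\downarrow)\circ c'$, $d'_n:=d'\circ(\downarrow\otimes x^n)$, and $t':=(d'\otimes\uparrow\otimes\downarrow)\circ(\downarrow\otimes s\otimes\downarrow)\circ(\downarrow\otimes\uparrow\otimes c')$. Define the clockwise and counterclockwise bubbles $\mathrm{cw}_n,\mathrm{ccw}_n\in\operatorname{End}(\mathbb 1)$ for $n\in\mathbb Z$ as follows. For $n\ge 0$, $\mathrm{cw}_n:=d_n\circ c'$ and $\mathrm{ccw}_n:=d'_n\circ c$. For negative subscripts,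 $\mathrm{ccw}_{r-k-1}:=\det(\mathrm{cw}_{i-j+k})_{1\le i,j\le r}$ for $r\le k$ and $\mathrm{cw}_{r+k-1}:=-\det(-\mathrm{ccw}_{i-j-k})_{1\le i,j\le r}$ for $r\le -k$, where the determinants are $1$ if $r=0$ and $0$ if $r<0$. For $n\ge0$ let $L_n:=(d'_n\otimes\uparrow)\circ(\downarrow\otimes s)\circ(c\otimes\uparrow)$ and $R_n:=(\uparrow\otimes d_n)\circ(s\otimes\downarrow)\circ(\uparrow\otimes c')$ be the left and right curls $\uparrow\to\uparrow$ with $n$ dots on the loop. Then there are unique $c',d'$ in $\mathcal Heis_k$ such that $$t'\circ t=1+\sum_{r,s\ge0}(c'_r\circ d_s)\otimes\mathrm{ccw}_{-r-s-2},\qquad t\circ t'=1+\sum_{r,s\ge0}\mathrm{cw}_{-r-s-2}\otimes(c_s\circ d'_r),$$ $R_0=\delta_{k,0}1_\uparrow$ if $k\ge0$, $\mathrm{cw}_r=-\delta_{r,k-1}1_{\mathbb 1}$ if $0\le r<k$, $L_0=\delta_{k,0}1_\uparrow$ if $k\le0$, and $\mathrm{ccw}_r=\delta_{r,-k-1}1_{\mathbb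 1}$ if $0\le r<-k$. For these $c',d'$ the following hold (all sums have only finitely many nonzero terms). (i) Infinite Grassmannian relations: $\mathrm{cw}_r=-\delta_{r,k-1}1_{\mathbb 1}$ for all integers $r<k$; $\mathrm{ccw}_r=\delta_{r,-k-1}1_{\mathbb 1}$ for all integers $r<-k$; and $\sum_{r,s\ge0,\,r+s=m}\mathrm{cw}_{r+k-1}\otimes\mathrm{ccw}_{s-k-1}=-\delta_{m,0}1_{\mathbb 1}$ for all $m\ge 0$. (ii) Left adjunction: $(\uparrow\otimes d')\circ(c'\otimes\uparrow)=1_\uparrow$ and $(d'\otimes\downarrow)\circ(\downarrow\otimes c')=1_\downarrow$. Hence $\mathcal Heis_k$ is rigid. (iii) Cyclicity: $(\downarrow\otimes d)\circ(\downarrow\otimes x\otimes\downarrow)\circ(c\otimes\downarrow)=(d'\otimes\downarrow)\circ(\downarrow\otimes x\otimes\downarrow)\circ(\downarrow\otimes c')$, and, with $e:=d\circ(\uparrow\otimes d\otimes\downarrow)$, $f:=(\downarrow\otimes c\otimes\uparrow)\circ c$, $e':=d'\circ(\downarrow\otimes d'\otimes\uparrow)$, $f':=(\uparrow\otimes c'\otimes\downarrow)\circ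 c'$ and $\Downarrow\;:=\;\downarrow\otimes\downarrow$, $$(\Downarrow\otimes e)\circ(\Downarrow\otimes s\otimes\Downarrow)\circ(f\otimes\Downarrow)=(e'\otimes\Downarrow)\circ(\Downarrow\otimes s\otimes\Downarrow)\circ(\Downarrow\otimes f').$$ Hence $\mathcal Heis_k$ is strictly pivotal: nested cups and caps make the word $X^*$, obtained from a word $X$ by reversing it and switching $\uparrow$ and $\downarrow$, both a right and a left dual of $X$, and the right and left mates $Y^*\to X^*$ of every morphism $X\to Y$ are equal. (iv) Curl relations: for all $r\ge0$, $L_r=\sum_{n\ge0}\mathrm{ccw}_{r-n-1}\otimes x^n$ and $R_r=-\sum_{n\ge0}x^n\otimes\mathrm{cw}_{r-n-1}$. (v) Bubble slides: for all $r\in\mathbb Z$, $\uparrow\otimes\,\mathrm{ccw}_r=\mathrm{ccw}_r\otimes\uparrow-\sum_{n\ge0}(n+1)\,\mathrm{ccw}_{r-n-2}\otimes x^n$ and $\mathrm{cw}_r\otimes\uparrow\;=\;\uparrow\otimes\,\mathrm{cw}_r-\sum_{n\ge0}(n+1)\,x^n\otimes\mathrm{cw}_{r-n-2}$. (vi) Alternating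 braid relation: the difference $$(t'\otimes\uparrow)\circ(\downarrow\otimes s)\circ(t\otimes\uparrow)-(\uparrow\otimes t)\circ(s\otimes\downarrow)\circ(\uparrow\otimes t'):\ \uparrow\otimes\downarrow\otimes\uparrow\;\to\;\uparrow\otimes\downarrow\otimes\uparrow$$ equals $\sum_{p,q,n\ge0}\mathrm{ccw}_{-p-q-n-3}\otimes(c'_p\circ d_q)\otimes x^n$ if $k\ge2$, equals $0$ if $-1\le k\le1$, and equals $\sum_{p,q,n\ge0}x^n\otimes(c_p\circ d'_q)\otimes\mathrm{cw}_{-p-q-n-3}$ if $k\le-2$. -/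

import Mathlib

open CategoryTheory MonoidalCategory

universe u

namespace Heisenberg

/-! ### The Heisenberg category of central charge `k` -/

/-- The two generating objects. -/
inductive Arrow : Type
  | up : Arrow
  | down : Arrow

/-- Reversal of orientation. -/
def Arrow.flip : Arrow → Arrow
  | Arrow.up => Arrow.down
  | Arrow.down => Arrow.up

/-- Objects are words in the generating objects; tensor product is concatenation. -/
abbrev Word : Type := List Arrow

/-- The word `↑`. -/
abbrev U : Word := [Arrow.up]

/-- The word `↓`. -/
abbrev D : Word := [Arrow.down]

/-- The generating morphisms.  Besides `x, s, c, d` they are the matrix entries of the two-sided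
inverse which the inversion relation adjoins: a morphism `↓ ⊗ ↑ ⟶ ↑ ⊗ ↓`, and moreover
`k` morphisms `𝟙 ⟶ ↑ ⊗ ↓` if `k > 0`, respectively `-k` morphisms `↓ ⊗ ↑ ⟶ 𝟙` if `k < 0`. -/
inductive Gen (k : ℤ) : Word → Word → Type
  | x : Gen k U U
  | s : Gen k (U ++ U) (U ++ U)
  | c : Gen k [] (D ++ U)
  | d : Gen k (U ++ D) []
  | tInv : Gen k (D ++ U) (U ++ D)
  | cupInv (r : Fin k.toNat) : Gen k [] (U ++ D)
  | capInv (r : Fin (-k).toNat) : Gen k (D ++ U) []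

/-- Formal `R`-linear combinations of horizontal and vertical composites of generators.
`comp f g` is `f` followed by `g`, that is, `g` drawn above `f`. -/
inductive Diag (R : Type u) (k : ℤ) : Word → Word → Type u
  | gen {a b : Word} (g : Gen k a b) : Diag R k a b
  | ident (a : Word) : Diag R k a a
  | comp {a b c : Word} (f : Diag R k a b) (g : Diag R k b c) : Diag R k a c
  | tensor {a b a' b' : Word} (f : Diag R k a b) (g : Diag R k a' b') :
      Diag R k (a ++ a') (b ++ b')
  | zero (a b : Word) : Diag R k a b
  | add {a b : Word} (f g : Diag R k a b) : Diag R k a b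
  | smul {a b : Word} (r : R) (f : Diag R k a b) : Diag R k a b

namespace Diag

variable {R : Type u} {k : ℤ}

/-- The identity, with an equality of words as a label. -/
def idOfEq {a b : Word} (h : a = b) : Diag R k a b := h ▸ Diag.ident a

/-- Vertical powers. -/
def npow {a : Word} (f : Diag R k a a) : ℕ → Diag R k a a
  | 0 => Diag.ident a
  | n + 1 => (npow f n).comp f

/-- Finite formal sums. -/
def sum {a b : Word} : {n : ℕ} → (Fin n → Diag R k a b) → Diag R k a b
  | 0, _ => Diag.zero a b
  | _ + 1, f => (f 0).add (sum fun i => f i.succ)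

/-- The dot `x`. -/
def x : Diag R k U U := gen Gen.x

/-- The upward crossing `s`. -/
def s : Diag R k (U ++ U) (U ++ U) := gen Gen.s

/-- The rightward cup `c`. -/
def c : Diag R k [] (D ++ U) := gen Gen.c

/-- The rightward cap `d`. -/
def d : Diag R k (U ++ D) [] := gen Gen.d

/-- The rightward crossing `t`: a rightward cup, an upward crossing, a rightward cap. -/
def t : Diag R k (U ++ D) (D ++ U) :=
  ((c.tensor (ident (U ++ D))).comp ((ident D).tensor (s.tensor (ident D)))).comp
    ((ident (D ++ U)).tensor d)

/-- The rightward cup with `r` dots on its upward strand. -/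
def cDot (r : ℕ) : Diag R k [] (D ++ U) := c.comp ((ident D).tensor (x.npow r))

/-- The rightward cap with `r` dots on its upward strand. -/
def dDot (r : ℕ) : Diag R k (U ++ D) [] := ((x.npow r).tensor (ident D)).comp d

/-- The adjoined morphism `↓ ⊗ ↑ ⟶ ↑ ⊗ ↓`. -/
def tInv : Diag R k (D ++ U) (U ++ D) := gen Gen.tInv

/-- The adjoined morphisms `𝟙 ⟶ ↑ ⊗ ↓`. -/
def cupInv (r : Fin k.toNat) : Diag R k [] (U ++ D) := gen (Gen.cupInv r)

/-- The adjoined morphisms `↓ ⊗ ↑ ⟶ 𝟙`. -/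
def capInv (r : Fin (-k).toNat) : Diag R k (D ++ U) [] := gen (Gen.capInv r)

end Diag

open Diag in
/-- Equality of diagrams in the Heisenberg category: the congruence generated by the axioms of a
strict `R`-linear monoidal category and the defining relations. -/
inductive Rel (R : Type u) [CommRing R] (k : ℤ) :
    {a b : Word} → Diag R k a b → Diag R k a b → Prop
  -- equivalence relation
  | refl {a b : Word} (f : Diag R k a b) : Rel R k f f
  | symm {a b : Word} {f g : Diag R k a b} : Rel R k f g → Rel R k g f
  | trans {a b : Word} {f g h : Diag R k a b} : Rel R k f g → Rel R k g h → Rel R k f h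
  -- compatibility with the operations
  | comp_congr {a b c : Word} {f f' : Diag R k a b} {g g' : Diag R k b c} :
      Rel R k f f' → Rel R k g g' → Rel R k (f.comp g) (f'.comp g')
  | tensor_congr {a b a' b' : Word} {f f' : Diag R k a b} {g g' : Diag R k a' b'} :
      Rel R k f f' → Rel R k g g' → Rel R k (f.tensor g) (f'.tensor g')
  | add_congr {a b : Word} {f f' g g' : Diag R k a b} :
      Rel R k f f' → Rel R k g g' → Rel R k (f.add g) (f'.add g')
  | smul_congr {a b : Word} (r : R) {f f' : Diag R k a b} :
      Rel R k f f' → Rel R k (f.smul r) (f'.smul r)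
  -- morphism spaces are `R`-modules
  | add_assoc {a b : Word} (f g h : Diag R k a b) :
      Rel R k ((f.add g).add h) (f.add (g.add h))
  | add_comm {a b : Word} (f g : Diag R k a b) : Rel R k (f.add g) (g.add f)
  | zero_add {a b : Word} (f : Diag R k a b) : Rel R k ((zero a b).add f) f
  | smul_add {a b : Word} (r : R) (f g : Diag R k a b) :
      Rel R k ((f.add g).smul r) ((f.smul r).add (g.smul r))
  | add_smul {a b : Word} (r r' : R) (f : Diag R k a b) :
      Rel R k (f.smul (r + r')) ((f.smul r).add (f.smul r'))
  | mul_smul {a b : Word} (r r' : R) (f : Diag R k a b) :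
      Rel R k (f.smul (r * r')) ((f.smul r').smul r)
  | one_smul {a b : Word} (f : Diag R k a b) : Rel R k (f.smul 1) f
  | zero_smul {a b : Word} (f : Diag R k a b) : Rel R k (f.smul 0) (zero a b)
  -- category axioms
  | id_comp {a b : Word} (f : Diag R k a b) : Rel R k ((ident a).comp f) f
  | comp_id {a b : Word} (f : Diag R k a b) : Rel R k (f.comp (ident b)) f
  | comp_assoc {a b c e : Word} (f : Diag R k a b) (g : Diag R k b c) (h : Diag R k c e) :
      Rel R k ((f.comp g).comp h) (f.comp (g.comp h))
  -- composition is bilinear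
  | add_comp {a b c : Word} (f f' : Diag R k a b) (g : Diag R k b c) :
      Rel R k ((f.add f').comp g) ((f.comp g).add (f'.comp g))
  | comp_add {a b c : Word} (f : Diag R k a b) (g g' : Diag R k b c) :
      Rel R k (f.comp (g.add g')) ((f.comp g).add (f.comp g'))
  | smul_comp {a b c : Word} (r : R) (f : Diag R k a b) (g : Diag R k b c) :
      Rel R k ((f.smul r).comp g) ((f.comp g).smul r)
  | comp_smul {a b c : Word} (r : R) (f : Diag R k a b) (g : Diag R k b c) :
      Rel R k (f.comp (g.smul r)) ((f.comp g).smul r)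
  -- the tensor product is a strictly associative and unital bifunctor
  | id_tensor_id (a b : Word) : Rel R k ((ident a).tensor (ident b)) (ident (a ++ b))
  | interchange {a b c a' b' c' : Word} (f : Diag R k a b) (g : Diag R k b c)
      (f' : Diag R k a' b') (g' : Diag R k b' c') :
      Rel R k ((f.comp g).tensor (f'.comp g')) ((f.tensor f').comp (g.tensor g'))
  | tensor_assoc {a₁ b₁ a₂ b₂ a₃ b₃ : Word}
      (f : Diag R k a₁ b₁) (g : Diag R k a₂ b₂) (h : Diag R k a₃ b₃) :
      Rel R k (((f.tensor g).tensor h).comp (idOfEq (List.append_assoc b₁ b₂ b₃)))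
        ((idOfEq (List.append_assoc a₁ a₂ a₃)).comp (f.tensor (g.tensor h)))
  | unit_tensor {a b : Word} (f : Diag R k a b) : Rel R k ((ident []).tensor f) f
  | tensor_unit {a b : Word} (f : Diag R k a b) :
      Rel R k ((f.tensor (ident [])).comp (idOfEq (List.append_nil b)))
        ((idOfEq (List.append_nil a)).comp f)
  -- the tensor product is bilinear
  | add_tensor {a b a' b' : Word} (f f' : Diag R k a b) (g : Diag R k a' b') :
      Rel R k ((f.add f').tensor g) ((f.tensor g).add (f'.tensor g))
  | tensor_add {a b a' b' : Word} (f : Diag R k a b) (g g' : Diag R k a' b') :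
      Rel R k (f.tensor (g.add g')) ((f.tensor g).add (f.tensor g'))
  | smul_tensor {a b a' b' : Word} (r : R) (f : Diag R k a b) (g : Diag R k a' b') :
      Rel R k ((f.smul r).tensor g) ((f.tensor g).smul r)
  | tensor_smul {a b a' b' : Word} (r : R) (f : Diag R k a b) (g : Diag R k a' b') :
      Rel R k (f.tensor (g.smul r)) ((f.tensor g).smul r)
  -- degenerate Hecke relations
  | cross_cross : Rel R k (s.comp s) (ident (U ++ U))
  | braid :
      Rel R k (((s.tensor (ident U)).comp ((ident U).tensor s)).comp (s.tensor (ident U)))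
        ((((ident U).tensor s).comp (s.tensor (ident U))).comp ((ident U).tensor s))
  | dot_cross :
      Rel R k (s.comp (x.tensor (ident U))) ((((ident U).tensor x).comp s).add (ident (U ++ U)))
  -- right adjunction relations
  | zigzag_up : Rel R k (((ident U).tensor c).comp (d.tensor (ident U))) (ident U)
  | zigzag_down : Rel R k ((c.tensor (ident D)).comp ((ident D).tensor d)) (ident D)
  -- inversion relation, first composite: the identity of `↑ ⊗ ↓` (plus `𝟙^(-k)` if `k < 0`)
  | t_tInv :
      Rel R k ((t.comp tInv).add (sum fun r : Fin k.toNat => (dDot r).comp (cupInv r)))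
        (ident (U ++ D))
  | t_capInv (r : Fin (-k).toNat) : Rel R k (t.comp (capInv r)) (zero _ _)
  | cDot_tInv (r : Fin (-k).toNat) : Rel R k ((cDot r).comp tInv) (zero _ _)
  | cDot_capInv (r r' : Fin (-k).toNat) :
      Rel R k ((cDot r).comp (capInv r')) (if r = r' then ident [] else zero _ _)
  -- inversion relation, second composite: the identity of `↓ ⊗ ↑` (plus `𝟙^k` if `k > 0`)
  | tInv_t :
      Rel R k ((tInv.comp t).add (sum fun r : Fin (-k).toNat => (capInv r).comp (cDot r)))
        (ident (D ++ U))
  | tInv_dDot (r : Fin k.toNat) : Rel R k (tInv.comp (dDot r)) (zero _ _)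
  | cupInv_t (r : Fin k.toNat) : Rel R k ((cupInv r).comp t) (zero _ _)
  | cupInv_dDot (r r' : Fin k.toNat) :
      Rel R k ((cupInv r).comp (dDot r')) (if r = r' then ident [] else zero _ _)

/-- The Heisenberg category of central charge `k` over the commutative ring `R`.  Its objects are
the words in `↑` and `↓`. -/
structure Heis (R : Type u) [CommRing R] (k : ℤ) : Type where
  /-- The underlying word. -/
  word : Word

namespace Heis

variable {R : Type u} [CommRing R] {k : ℤ}

/-- Morphisms are diagrams modulo relations; `f ≫ g` is `f` followed by `g`. -/
instance : Category.{u} (Heis R k) where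
  Hom a b := Quot (Rel R k (a := a.word) (b := b.word))
  id a := Quot.mk _ (Diag.ident a.word)
  comp f g := Quot.map₂ Diag.comp (fun f _ _ h => Rel.comp_congr (Rel.refl f) h)
    (fun _ _ g h => Rel.comp_congr h (Rel.refl g)) f g
  id_comp := by rintro a b ⟨f⟩; exact Quot.sound (Rel.id_comp f)
  comp_id := by rintro a b ⟨f⟩; exact Quot.sound (Rel.comp_id f)
  assoc := by rintro a b c e ⟨f⟩ ⟨g⟩ ⟨h⟩; exact Quot.sound (Rel.comp_assoc f g h)

/-- The morphism given by a diagram. -/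
def mk' {a b : Word} (f : Diag R k a b) : (⟨a⟩ : Heis R k) ⟶ ⟨b⟩ := Quot.mk _ f

/-- The sum of two morphisms. -/
def homAdd {a b : Heis R k} (f g : a ⟶ b) : a ⟶ b :=
  Quot.map₂ Diag.add (fun f _ _ h => Rel.add_congr (Rel.refl f) h)
    (fun _ _ g h => Rel.add_congr h (Rel.refl g)) f g

/-- Multiplication of a morphism by a scalar. -/
def homSMul {a b : Heis R k} (r : R) (f : a ⟶ b) : a ⟶ b :=
  Quot.map (Diag.smul r) (fun _ _ h => Rel.smul_congr r h) f

/-- The horizontal composite of two morphisms. -/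
def homTensor {a b a' b' : Heis R k} (f : a ⟶ b) (g : a' ⟶ b') :
    (⟨a.word ++ a'.word⟩ : Heis R k) ⟶ ⟨b.word ++ b'.word⟩ :=
  Quot.map₂ Diag.tensor (fun f _ _ h => Rel.tensor_congr (Rel.refl f) h)
    (fun _ _ g h => Rel.tensor_congr h (Rel.refl g)) f g

instance (a b : Heis R k) : Add (a ⟶ b) := ⟨homAdd⟩

instance (a b : Heis R k) : Zero (a ⟶ b) := ⟨Quot.mk _ (Diag.zero a.word b.word)⟩

instance (a b : Heis R k) : Neg (a ⟶ b) := ⟨homSMul (-1)⟩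

instance (a b : Heis R k) : AddCommGroup (a ⟶ b) where
  nsmul := nsmulRec
  zsmul := zsmulRec
  add_assoc := by rintro ⟨f⟩ ⟨g⟩ ⟨h⟩; exact Quot.sound (Rel.add_assoc f g h)
  zero_add := by rintro ⟨f⟩; exact Quot.sound (Rel.zero_add f)
  add_zero := by
    rintro ⟨f⟩; exact Quot.sound ((Rel.add_comm _ _).trans (Rel.zero_add f))
  add_comm := by rintro ⟨f⟩ ⟨g⟩; exact Quot.sound (Rel.add_comm f g)
  neg_add_cancel := by
    rintro ⟨f⟩
    refine Quot.sound (Rel.trans (Rel.add_congr (Rel.refl _) (Rel.one_smul f).symm) ?_)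
    refine (Rel.add_smul (-1) 1 f).symm.trans ?_
    rw [neg_add_cancel]
    exact Rel.zero_smul f

instance (a b : Heis R k) : Module R (a ⟶ b) where
  smul := homSMul
  one_smul := by rintro ⟨f⟩; exact Quot.sound (Rel.one_smul f)
  mul_smul := by rintro r r' ⟨f⟩; exact Quot.sound (Rel.mul_smul r r' f)
  smul_add := by rintro r ⟨f⟩ ⟨g⟩; exact Quot.sound (Rel.smul_add r f g)
  add_smul := by rintro r r' ⟨f⟩; exact Quot.sound (Rel.add_smul r r' f)
  zero_smul := by rintro ⟨f⟩; exact Quot.sound (Rel.zero_smul f)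
  smul_zero := by
    intro r
    refine Quot.sound (Rel.trans (Rel.smul_congr r (Rel.zero_smul (Diag.zero _ _)).symm) ?_)
    refine (Rel.mul_smul r 0 _).symm.trans ?_
    rw [mul_zero]
    exact Rel.zero_smul _

instance : Preadditive (Heis R k) where
  homGroup := inferInstance
  add_comp := by rintro _ _ _ ⟨f⟩ ⟨f'⟩ ⟨g⟩; exact Quot.sound (Rel.add_comp f f' g)
  comp_add := by rintro _ _ _ ⟨f⟩ ⟨g⟩ ⟨g'⟩; exact Quot.sound (Rel.comp_add f g g')

instance : Linear R (Heis R k) where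
  homModule := inferInstance
  smul_comp := by rintro _ _ _ r ⟨f⟩ ⟨g⟩; exact Quot.sound (Rel.smul_comp r f g)
  comp_smul := by rintro _ _ _ ⟨f⟩ r ⟨g⟩; exact Quot.sound (Rel.comp_smul r f g)

theorem mk_idOfEq {a b : Word} (h : a = b) :
    mk' (Diag.idOfEq h) = eqToHom (congrArg (Heis.mk (R := R) (k := k)) h) := by
  subst h; rfl

/-- The tensor product is concatenation of words; the structure isomorphisms are the identities
along the equalities of words. -/
instance : MonoidalCategoryStruct (Heis R k) where
  tensorObj a b := ⟨a.word ++ b.word⟩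
  whiskerLeft a _ _ f := homTensor (𝟙 a) f
  whiskerRight f b := homTensor f (𝟙 b)
  tensorHom f g := homTensor f g
  tensorUnit := ⟨[]⟩
  associator a b c := eqToIso (congrArg Heis.mk (List.append_assoc a.word b.word c.word))
  leftUnitor a := eqToIso (congrArg Heis.mk (List.nil_append a.word))
  rightUnitor a := eqToIso (congrArg Heis.mk (List.append_nil a.word))

theorem tensor_assoc_eq (a b c : Heis R k) : (a ⊗ b) ⊗ c = a ⊗ b ⊗ c :=
  congrArg Heis.mk (List.append_assoc a.word b.word c.word)

theorem unit_tensor_eq (a : Heis R k) : 𝟙_ (Heis R k) ⊗ a = a :=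
  congrArg Heis.mk (List.nil_append a.word)

theorem tensor_unit_eq (a : Heis R k) : a ⊗ 𝟙_ (Heis R k) = a :=
  congrArg Heis.mk (List.append_nil a.word)

theorem id_tensor_id (a b : Heis R k) : 𝟙 a ⊗ₘ 𝟙 b = 𝟙 (a ⊗ b) :=
  Quot.sound (Rel.id_tensor_id a.word b.word)

theorem eqToHom_tensor_id {a b : Heis R k} (h : a = b) (c : Heis R k) :
    eqToHom h ⊗ₘ 𝟙 c = eqToHom (congrArg (· ⊗ c) h) := by
  subst h; exact id_tensor_id _ _

theorem id_tensor_eqToHom {a b : Heis R k} (h : a = b) (c : Heis R k) :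
    𝟙 c ⊗ₘ eqToHom h = eqToHom (congrArg (c ⊗ ·) h) := by
  subst h; exact id_tensor_id _ _

instance : MonoidalCategory (Heis R k) :=
  MonoidalCategory.ofTensorHom
    (id_tensorHom_id := id_tensor_id)
    (id_tensorHom := fun _ _ _ _ => rfl)
    (tensorHom_id := fun _ _ => rfl)
    (tensorHom_comp_tensorHom := by
      rintro _ _ _ _ _ _ ⟨f⟩ ⟨f'⟩ ⟨g⟩ ⟨g'⟩
      exact Quot.sound (Rel.interchange f g f' g').symm)
    (associator_naturality := by
      rintro a₁ a₂ a₃ b₁ b₂ b₃ ⟨f⟩ ⟨g⟩ ⟨h⟩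
      have := Quot.sound (Rel.tensor_assoc f g h)
      change mk' _ ≫ mk' (Diag.idOfEq (List.append_assoc _ _ _)) =
        mk' (Diag.idOfEq (List.append_assoc _ _ _)) ≫ mk' _ at this
      simp only [mk_idOfEq] at this
      exact this)
    (leftUnitor_naturality := by
      rintro a b ⟨f⟩
      have := Quot.sound (Rel.unit_tensor f)
      exact (Category.comp_id (X := a) (Y := b) _).trans
        (this.trans (Category.id_comp (X := a) (Y := b) _).symm))
    (rightUnitor_naturality := by
      rintro a b ⟨f⟩
      have := Quot.sound (Rel.tensor_unit f)
      change mk' _ ≫ mk' (Diag.idOfEq (List.append_nil _)) =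
        mk' (Diag.idOfEq (List.append_nil _)) ≫ mk' _ at this
      simp only [mk_idOfEq] at this
      exact this)
    (pentagon := by
      intro a b c e
      change (eqToHom (tensor_assoc_eq a b c) ⊗ₘ 𝟙 e) ≫ eqToHom (tensor_assoc_eq a (b ⊗ c) e) ≫
          (𝟙 a ⊗ₘ eqToHom (tensor_assoc_eq b c e)) =
        eqToHom (tensor_assoc_eq (a ⊗ b) c e) ≫ eqToHom (tensor_assoc_eq a b (c ⊗ e))
      rw [eqToHom_tensor_id, id_tensor_eqToHom]
      simp only [eqToHom_trans])
    (triangle := by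
      intro a b
      change eqToHom (tensor_assoc_eq a (𝟙_ (Heis R k)) b) ≫ (𝟙 a ⊗ₘ eqToHom (unit_tensor_eq b)) =
        eqToHom (tensor_unit_eq a) ⊗ₘ 𝟙 b
      rw [eqToHom_tensor_id, id_tensor_eqToHom]
      simp only [eqToHom_trans])

instance : MonoidalPreadditive (Heis R k) where
  whiskerLeft_add := by
    rintro a _ _ ⟨f⟩ ⟨g⟩; exact Quot.sound (Rel.tensor_add (Diag.ident a.word) f g)
  add_whiskerRight := by
    rintro a _ _ ⟨f⟩ ⟨g⟩; exact Quot.sound (Rel.add_tensor f g (Diag.ident a.word))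
  whiskerLeft_zero := by
    intro a b c
    refine Quot.sound ?_
    refine (Rel.tensor_congr (Rel.refl _) (Rel.zero_smul (Diag.zero _ _)).symm).trans ?_
    exact (Rel.tensor_smul 0 _ _).trans (Rel.zero_smul _)
  zero_whiskerRight := by
    intro a b c
    refine Quot.sound ?_
    refine (Rel.tensor_congr (Rel.zero_smul (Diag.zero _ _)).symm (Rel.refl _)).trans ?_
    exact (Rel.smul_tensor 0 _ _).trans (Rel.zero_smul _)

instance : MonoidalLinear R (Heis R k) where
  whiskerLeft_smul := by
    rintro a _ _ r ⟨f⟩; exact Quot.sound (Rel.tensor_smul r (Diag.ident a.word) f)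
  smul_whiskerRight := by
    rintro r _ _ ⟨f⟩ a; exact Quot.sound (Rel.smul_tensor r f (Diag.ident a.word))

/-- Endomorphisms of the unit object commute, so that determinants over them make sense. -/
instance : CommRing (End (𝟙_ (Heis R k))) where
  mul_comm := by
    intro f g
    have hl : ∀ h : 𝟙_ (Heis R k) ⟶ 𝟙_ (Heis R k), 𝟙_ (Heis R k) ◁ h = h := by
      rintro ⟨h⟩; exact Quot.sound (Rel.unit_tensor h)
    have hr : ∀ h : 𝟙_ (Heis R k) ⟶ 𝟙_ (Heis R k), h ▷ 𝟙_ (Heis R k) = h := by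
      rintro ⟨h⟩
      have := Quot.sound (Rel.tensor_unit h)
      exact ((Category.comp_id _).symm.trans this).trans (Category.id_comp _)
    change g ≫ f = f ≫ g
    have := whisker_exchange (C := Heis R k) f g
    rw [hl, hr] at this
    exact this

/-! ### Generating morphisms and the diagrams built from them

The symbol `⊗≫` is composition with structure isomorphisms (here identities) inserted where
bracketings or unit objects do not match literally. -/

/-- The generating object `↑`. -/
def up : Heis R k := ⟨U⟩

/-- The generating object `↓`. -/
def down : Heis R k := ⟨D⟩

/-- The dot `x : ↑ ⟶ ↑`. -/
def x : (up : Heis R k) ⟶ up := mk' Diag.x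

/-- The upward crossing `s : ↑ ⊗ ↑ ⟶ ↑ ⊗ ↑`. -/
def s : (up ⊗ up : Heis R k) ⟶ up ⊗ up := mk' Diag.s

/-- The rightward cup `c : 𝟙 ⟶ ↓ ⊗ ↑`. -/
def c : 𝟙_ (Heis R k) ⟶ down ⊗ up := mk' Diag.c

/-- The rightward cap `d : ↑ ⊗ ↓ ⟶ 𝟙`. -/
def d : (up ⊗ down : Heis R k) ⟶ 𝟙_ (Heis R k) := mk' Diag.d

/-- The dot with multiplicity `n`. -/
def xPow (n : ℕ) : (up : Heis R k) ⟶ up := (show End (up : Heis R k) from x) ^ n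

/-- The rightward crossing `t`. -/
def t : (up ⊗ down : Heis R k) ⟶ down ⊗ up :=
  𝟙 _ ⊗≫ c ▷ (up ⊗ down) ⊗≫ down ◁ s ▷ down ⊗≫ (down ⊗ up) ◁ d ⊗≫ 𝟙 _

/-- The rightward cup with `n` dots on its upward strand. -/
def cDot (n : ℕ) : 𝟙_ (Heis R k) ⟶ down ⊗ up := c ≫ down ◁ xPow n

/-- The rightward cap with `n` dots on its upward strand. -/
def dDot (n : ℕ) : (up ⊗ down : Heis R k) ⟶ 𝟙_ (Heis R k) := xPow n ▷ down ≫ d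

/-- Given a leftward cup `c'`: the leftward cup with `n` dots on its upward strand. -/
def cDot' (c' : 𝟙_ (Heis R k) ⟶ up ⊗ down) (n : ℕ) : 𝟙_ (Heis R k) ⟶ up ⊗ down :=
  c' ≫ xPow n ▷ down

/-- Given a leftward cap `d'`: the leftward cap with `n` dots on its upward strand. -/
def dDot' (d' : (down ⊗ up : Heis R k) ⟶ 𝟙_ (Heis R k)) (n : ℕ) :
    (down ⊗ up : Heis R k) ⟶ 𝟙_ (Heis R k) :=
  down ◁ xPow n ≫ d'

/-- Given a leftward cup and cap: the leftward crossing `t'`. -/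
def t' (c' : 𝟙_ (Heis R k) ⟶ up ⊗ down) (d' : (down ⊗ up : Heis R k) ⟶ 𝟙_ (Heis R k)) :
    (down ⊗ up : Heis R k) ⟶ up ⊗ down :=
  𝟙 _ ⊗≫ (down ⊗ up) ◁ c' ⊗≫ down ◁ s ▷ down ⊗≫ d' ▷ (up ⊗ down) ⊗≫ 𝟙 _

/-- The clockwise bubble with `n ≥ 0` dots. -/
def cwNat (c' : 𝟙_ (Heis R k) ⟶ up ⊗ down) (n : ℕ) : End (𝟙_ (Heis R k)) :=
  c' ≫ dDot n

/-- The counterclockwise bubble with `n ≥ 0` dots. -/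
def ccwNat (d' : (down ⊗ up : Heis R k) ⟶ 𝟙_ (Heis R k)) (n : ℕ) : End (𝟙_ (Heis R k)) :=
  c ≫ dDot' d' n

/-- The clockwise bubble with `n ∈ ℤ` dots.  For `n = r + k - 1 < 0` it is minus the determinant
of the matrix with entries `-ccwNat d' (i - j - k)` for `i, j = 1, …, r`; the determinant is
understood to be `0` if `r < 0`. -/
noncomputable def cw (c' : 𝟙_ (Heis R k) ⟶ up ⊗ down)
    (d' : (down ⊗ up : Heis R k) ⟶ 𝟙_ (Heis R k)) (n : ℤ) : End (𝟙_ (Heis R k)) :=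
  if 0 ≤ n then cwNat c' n.toNat
  else if n - k + 1 < 0 then 0
  else -Matrix.det (Matrix.of fun i j : Fin (n - k + 1).toNat =>
    -ccwNat d' ((i : ℤ) - (j : ℤ) - k).toNat)

/-- The counterclockwise bubble with `n ∈ ℤ` dots.  For `n = r - k - 1 < 0` it is the determinant
of the matrix with entries `cwNat c' (i - j + k)` for `i, j = 1, …, r`; the determinant is
understood to be `0` if `r < 0`. -/
noncomputable def ccw (c' : 𝟙_ (Heis R k) ⟶ up ⊗ down)
    (d' : (down ⊗ up : Heis R k) ⟶ 𝟙_ (Heis R k)) (n : ℤ) : End (𝟙_ (Heis R k)) :=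
  if 0 ≤ n then ccwNat d' n.toNat
  else if n + k + 1 < 0 then 0
  else Matrix.det (Matrix.of fun i j : Fin (n + k + 1).toNat =>
    cwNat c' ((i : ℤ) - (j : ℤ) + k).toNat)

/-- The bubble `B` drawn to the left of `f`. -/
def bubbleLeft {a b : Heis R k} (B : End (𝟙_ (Heis R k))) (f : a ⟶ b) : a ⟶ b :=
  (λ_ a).inv ≫ (B ⊗ₘ f) ≫ (λ_ b).hom

/-- The bubble `B` drawn to the right of `f`. -/
def bubbleRight {a b : Heis R k} (f : a ⟶ b) (B : End (𝟙_ (Heis R k))) : a ⟶ b :=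
  (ρ_ a).inv ≫ (f ⊗ₘ B) ≫ (ρ_ b).hom

/-- The curl with its loop to the right of the strand, with `n` dots on the loop. -/
def curlRight (c' : 𝟙_ (Heis R k) ⟶ up ⊗ down) (n : ℕ) : (up : Heis R k) ⟶ up :=
  𝟙 _ ⊗≫ up ◁ c' ⊗≫ s ▷ down ⊗≫ up ◁ dDot n ⊗≫ 𝟙 _

/-- The curl with its loop to the left of the strand, with `n` dots on the loop. -/
def curlLeft (d' : (down ⊗ up : Heis R k) ⟶ 𝟙_ (Heis R k)) (n : ℕ) : (up : Heis R k) ⟶ up :=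
  𝟙 _ ⊗≫ c ▷ up ⊗≫ down ◁ s ⊗≫ dDot' d' n ▷ up ⊗≫ 𝟙 _

/-- The crossing of two upward strands, with a downward strand passing on its left. -/
def altLeft (c' : 𝟙_ (Heis R k) ⟶ up ⊗ down) (d' : (down ⊗ up : Heis R k) ⟶ 𝟙_ (Heis R k)) :
    (up ⊗ down ⊗ up : Heis R k) ⟶ up ⊗ down ⊗ up :=
  𝟙 _ ⊗≫ t ▷ up ⊗≫ down ◁ s ⊗≫ t' c' d' ▷ up ⊗≫ 𝟙 _

/-- The crossing of two upward strands, with a downward strand passing on its right. -/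
def altRight (c' : 𝟙_ (Heis R k) ⟶ up ⊗ down) (d' : (down ⊗ up : Heis R k) ⟶ 𝟙_ (Heis R k)) :
    (up ⊗ down ⊗ up : Heis R k) ⟶ up ⊗ down ⊗ up :=
  𝟙 _ ⊗≫ up ◁ t' c' d' ⊗≫ s ▷ down ⊗≫ up ◁ t ⊗≫ 𝟙 _

/-- The right mate of the dot. -/
def xRight : (down : Heis R k) ⟶ down :=
  𝟙 _ ⊗≫ c ▷ down ⊗≫ down ◁ x ▷ down ⊗≫ down ◁ d ⊗≫ 𝟙 _

/-- The left mate of the dot. -/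
def xLeft (c' : 𝟙_ (Heis R k) ⟶ up ⊗ down) (d' : (down ⊗ up : Heis R k) ⟶ 𝟙_ (Heis R k)) :
    (down : Heis R k) ⟶ down :=
  𝟙 _ ⊗≫ down ◁ c' ⊗≫ down ◁ x ▷ down ⊗≫ d' ▷ down ⊗≫ 𝟙 _

/-- The right mate of the upward crossing. -/
def sRight : (down ⊗ down : Heis R k) ⟶ down ⊗ down :=
  𝟙 _ ⊗≫ (c ⊗≫ down ◁ c ▷ up) ▷ (down ⊗ down) ⊗≫ (down ⊗ down) ◁ s ▷ (down ⊗ down) ⊗≫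
    (down ⊗ down) ◁ (up ◁ d ▷ down ⊗≫ d) ⊗≫ 𝟙 _

/-- The left mate of the upward crossing. -/
def sLeft (c' : 𝟙_ (Heis R k) ⟶ up ⊗ down) (d' : (down ⊗ up : Heis R k) ⟶ 𝟙_ (Heis R k)) :
    (down ⊗ down : Heis R k) ⟶ down ⊗ down :=
  𝟙 _ ⊗≫ (down ⊗ down) ◁ (c' ⊗≫ up ◁ c' ▷ down) ⊗≫ (down ⊗ down) ◁ s ▷ (down ⊗ down) ⊗≫
    (down ◁ d' ▷ up ⊗≫ d') ▷ (down ⊗ down) ⊗≫ 𝟙 _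

/-- The relations characterizing the leftward cup `c'` and the leftward cap `d'`.  Only finitely
many terms of each sum are nonzero, since a bubble with sufficiently negative number of dots
vanishes by definition. -/
structure IsLeftwardCupCap (c' : 𝟙_ (Heis R k) ⟶ up ⊗ down)
    (d' : (down ⊗ up : Heis R k) ⟶ 𝟙_ (Heis R k)) : Prop where
  t_comp_t' : t ≫ t' c' d' = 𝟙 (up ⊗ down) +
    ∑ᶠ p : ℕ × ℕ, bubbleRight (dDot p.2 ≫ cDot' c' p.1) (ccw c' d' (-p.1 - p.2 - 2))
  t'_comp_t : t' c' d' ≫ t = 𝟙 (down ⊗ up) +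
    ∑ᶠ p : ℕ × ℕ, bubbleLeft (cw c' d' (-p.1 - p.2 - 2)) (dDot' d' p.1 ≫ cDot p.2)
  curlRight_zero : 0 ≤ k → curlRight c' 0 = if k = 0 then 𝟙 (up : Heis R k) else 0
  cw_eq : ∀ r : ℤ, 0 ≤ r → r < k → cw c' d' r = if r = k - 1 then -1 else 0
  curlLeft_zero : k ≤ 0 → curlLeft d' 0 = if k = 0 then 𝟙 (up : Heis R k) else 0
  ccw_eq : ∀ r : ℤ, 0 ≤ r → r < -k → ccw c' d' r = if r = -k - 1 then 1 else 0

/-! ### Duality -/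

/-- The word `X` rotated through `180°`: its canonical dual, on the left and on the right. -/
def rot (X : Heis R k) : Heis R k := ⟨(X.word.map Arrow.flip).reverse⟩

/-- The generating object with a given orientation. -/
def single (a : Arrow) : Heis R k := ⟨[a]⟩

theorem nest_eq (a : Arrow) (w : Word) :
    (single a ⊗ (⟨w⟩ ⊗ rot ⟨w⟩) ⊗ single a.flip : Heis R k) = ⟨a :: w⟩ ⊗ rot ⟨a :: w⟩ :=
  congrArg Heis.mk (by simp [single, rot, tensorObj])

theorem nest_rot_eq (a : Arrow) (w : Word) :
    (rot ⟨w⟩ ⊗ (single a.flip ⊗ single a) ⊗ ⟨w⟩ : Heis R k) = rot ⟨a :: w⟩ ⊗ ⟨a :: w⟩ :=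
  congrArg Heis.mk (by simp [single, rot, tensorObj])

/-- The cup `𝟙 ⟶ a ⊗ a*` for a generating object `a`. -/
def cupGen (c' : 𝟙_ (Heis R k) ⟶ up ⊗ down) :
    (a : Arrow) → (𝟙_ (Heis R k) ⟶ single a ⊗ single a.flip)
  | Arrow.up => c'
  | Arrow.down => c

/-- The cap `a ⊗ a* ⟶ 𝟙` for a generating object `a`. -/
def capGen (d' : (down ⊗ up : Heis R k) ⟶ 𝟙_ (Heis R k)) :
    (a : Arrow) → (single a ⊗ single a.flip ⟶ 𝟙_ (Heis R k))
  | Arrow.up => d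
  | Arrow.down => d'

/-- The cup `𝟙 ⟶ a* ⊗ a` for a generating object `a`. -/
def cupGenRot (c' : 𝟙_ (Heis R k) ⟶ up ⊗ down) :
    (a : Arrow) → (𝟙_ (Heis R k) ⟶ single a.flip ⊗ single a)
  | Arrow.up => c
  | Arrow.down => c'

/-- The cap `a* ⊗ a ⟶ 𝟙` for a generating object `a`. -/
def capGenRot (d' : (down ⊗ up : Heis R k) ⟶ 𝟙_ (Heis R k)) :
    (a : Arrow) → (single a.flip ⊗ single a ⟶ 𝟙_ (Heis R k))
  | Arrow.up => d'
  | Arrow.down => d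

/-- Nested cups `𝟙 ⟶ X ⊗ X*`. -/
def cups (c' : 𝟙_ (Heis R k) ⟶ up ⊗ down) :
    (w : Word) → (𝟙_ (Heis R k) ⟶ ⟨w⟩ ⊗ rot ⟨w⟩)
  | [] => 𝟙 (𝟙_ (Heis R k))
  | a :: w => cupGen c' a ⊗≫ single a ◁ cups c' w ▷ single a.flip ≫ eqToHom (nest_eq a w)

/-- Nested caps `X ⊗ X* ⟶ 𝟙`. -/
def caps (d' : (down ⊗ up : Heis R k) ⟶ 𝟙_ (Heis R k)) :
    (w : Word) → (⟨w⟩ ⊗ rot ⟨w⟩ ⟶ 𝟙_ (Heis R k))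
  | [] => 𝟙 (𝟙_ (Heis R k))
  | a :: w => eqToHom (nest_eq a w).symm ≫ single a ◁ caps d' w ▷ single a.flip ⊗≫ capGen d' a

/-- Nested cups `𝟙 ⟶ X* ⊗ X`. -/
def cupsRot (c' : 𝟙_ (Heis R k) ⟶ up ⊗ down) :
    (w : Word) → (𝟙_ (Heis R k) ⟶ rot ⟨w⟩ ⊗ ⟨w⟩)
  | [] => 𝟙 (𝟙_ (Heis R k))
  | a :: w => cupsRot c' w ⊗≫ rot ⟨w⟩ ◁ cupGenRot c' a ▷ ⟨w⟩ ≫ eqToHom (nest_rot_eq a w)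

/-- Nested caps `X* ⊗ X ⟶ 𝟙`. -/
def capsRot (d' : (down ⊗ up : Heis R k) ⟶ 𝟙_ (Heis R k)) :
    (w : Word) → (rot ⟨w⟩ ⊗ ⟨w⟩ ⟶ 𝟙_ (Heis R k))
  | [] => 𝟙 (𝟙_ (Heis R k))
  | a :: w => eqToHom (nest_rot_eq a w).symm ≫ rot ⟨w⟩ ◁ capGenRot d' a ▷ ⟨w⟩ ⊗≫ capsRot d' w

/-- Nested cups and caps make `rot X` a dual of `X` on either side, and for these dualities the
two mates `rot Y ⟶ rot X` of each morphism `X ⟶ Y` coincide: the category is strictly pivotal. -/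
def IsStrictlyPivotal (c' : 𝟙_ (Heis R k) ⟶ up ⊗ down)
    (d' : (down ⊗ up : Heis R k) ⟶ 𝟙_ (Heis R k)) : Prop :=
  ∃ (P : ∀ X : Heis R k, ExactPairing X (rot X)) (Q : ∀ X : Heis R k, ExactPairing (rot X) X),
    (∀ X, (P X).coevaluation' = cups c' X.word ∧ (P X).evaluation' = capsRot d' X.word) ∧
    (∀ X, (Q X).coevaluation' = cupsRot c' X.word ∧ (Q X).evaluation' = caps d' X.word) ∧
    ∀ (X Y : Heis R k) (f : X ⟶ Y),
      @rightAdjointMate _ _ _ X Y (@HasRightDual.mk _ _ _ X (rot X) (P X))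
          (@HasRightDual.mk _ _ _ Y (rot Y) (P Y)) f =
        @leftAdjointMate _ _ _ X Y (@HasLeftDual.mk _ _ _ X (rot X) (Q X))
          (@HasLeftDual.mk _ _ _ Y (rot Y) (Q Y)) f

end Heis

end Heisenberg

/-! ### Actions of the Heisenberg category on a preadditive category -/

namespace Heisenberg

universe v w

/-! Diagrams are replaced by functors, and the two signs of the charge are treated at once.
Tensoring on the left with `↑` and `↓` turns the generators into natural transformations between
endofunctors `U` and `D`, that is, a `HeckeAction`. Tensoring on the right, on the opposite
category, gives another one: `c` and `d` trade places, `s` becomes `-s`, and the invertible row for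
`k ≤ 0` becomes an invertible column of length `-k`. Every relation is therefore proved once, for an
action with a two-sided inverse (`T`, `E r`) of the column `[t, d₀, …, d_{k-1}]`, with `k` a natural
number. Evaluation at the unit object gives back equalities of morphisms.

The main tool is `Inversion.hom_ext`: a morphism into `U D` is determined by its composites with `t`
and with `d_r` for `r < k`. It pins down the leftward cup `p` by `p ≫ t = δ_{k,0} c` and `p ≫ d_r =
-δ_{r,k-1}`, while the leftward cap is `T ≫ d_k` (`IsLeftward`). Expanding `t ≫ T` gives `t ≫ q = ∑
d_r ≫ al r`, where `al r` plays the role of the counterclockwise bubble with `-r-1` dots. The rest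
comes from pushing dots through crossings, since `p` kills almost all error terms: the zigzag
identities, the formulas for `t ≫ t'` and `t' ≫ t`, hence `T = t'`, cyclicity and the alternating
braid relation. Composing the dotted form `t_dq` with the two kinds of cup gives the left curls and
the Grassmannian relation. Clockwise bubbles slide because a leftward cup can be pulled across a
strand. Counterclockwise slides follow because the generating series of the bubbles are inverse to
each other up to sign (`slide_of_slide`).

Conversely, the characterizing relations force `t' = T`, and hence the cup and cap
(`isLeftward_of_relations`); this is uniqueness. The determinants defining negatively dotted bubbles
are the entries of an inverse unitriangular Toeplitz matrix, so the Grassmannian relation identifies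
them with `al` (`eq_det_of_conv`).

For pivotality, the morphisms whose two mates coincide are closed under all operations. The adjoined
generators are polynomials in the other generators, `c'` and `d'` (`tInv_eq`, `cupInv_eq`,
`capInv_eq`), so it suffices to treat `x`, `s`, the cups and the caps. -/

/-- Two endofunctors with a dot, a crossing and a right adjunction, subject to the degenerate
Hecke relations.  Natural transformations are given by their components: a whiskering on the left
is the application of a functor, a whiskering on the right is the choice of a component. -/
structure HeckeAction (𝒞 : Type w) [Category.{v} 𝒞] [Preadditive 𝒞] where
  U : 𝒞 ⥤ 𝒞
  D : 𝒞 ⥤ 𝒞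
  [addU : U.Additive]
  [addD : D.Additive]
  x (Z : 𝒞) : U.obj Z ⟶ U.obj Z
  s (Z : 𝒞) : U.obj (U.obj Z) ⟶ U.obj (U.obj Z)
  c (Z : 𝒞) : Z ⟶ D.obj (U.obj Z)
  d (Z : 𝒞) : U.obj (D.obj Z) ⟶ Z
  x_nat {Z W : 𝒞} (f : Z ⟶ W) : U.map f ≫ x W = x Z ≫ U.map f
  s_nat {Z W : 𝒞} (f : Z ⟶ W) : U.map (U.map f) ≫ s W = s Z ≫ U.map (U.map f)
  c_nat {Z W : 𝒞} (f : Z ⟶ W) : f ≫ c W = c Z ≫ D.map (U.map f)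
  d_nat {Z W : 𝒞} (f : Z ⟶ W) : U.map (D.map f) ≫ d W = d Z ≫ f
  s_s (Z : 𝒞) : s Z ≫ s Z = 𝟙 _
  braid (Z : 𝒞) : s (U.obj Z) ≫ U.map (s Z) ≫ s (U.obj Z) =
    U.map (s Z) ≫ s (U.obj Z) ≫ U.map (s Z)
  s_x (Z : 𝒞) : s Z ≫ x (U.obj Z) = U.map (x Z) ≫ s Z + 𝟙 _
  zigzag_up (Z : 𝒞) : U.map (c Z) ≫ d (U.obj Z) = 𝟙 _
  zigzag_down (Z : 𝒞) : c (D.obj Z) ≫ D.map (d Z) = 𝟙 _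

namespace HeckeAction

attribute [instance] HeckeAction.addU HeckeAction.addD

variable {𝒞 : Type w} [Category.{v} 𝒞] [Preadditive 𝒞] (A : HeckeAction 𝒞)

/-- Powers of the dot. -/
def xp : ℕ → ∀ Z : 𝒞, A.U.obj Z ⟶ A.U.obj Z
  | 0, _ => 𝟙 _
  | n + 1, Z => xp n Z ≫ A.x Z

@[simp] theorem xp_zero (Z : 𝒞) : A.xp 0 Z = 𝟙 _ := rfl

theorem xp_succ (n : ℕ) (Z : 𝒞) : A.xp (n + 1) Z = A.xp n Z ≫ A.x Z := rfl

theorem xp_add (m n : ℕ) (Z : 𝒞) : A.xp (m + n) Z = A.xp m Z ≫ A.xp n Z := by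
  induction n with
  | zero => simp
  | succ n ih => rw [← Nat.add_assoc, xp_succ, ih, xp_succ, Category.assoc]

theorem xp_comm (m n : ℕ) (Z : 𝒞) : A.xp m Z ≫ A.xp n Z = A.xp n Z ≫ A.xp m Z := by
  rw [← xp_add, Nat.add_comm, xp_add]

theorem xp_nat (n : ℕ) {Z W : 𝒞} (f : Z ⟶ W) :
    A.U.map f ≫ A.xp n W = A.xp n Z ≫ A.U.map f := by
  induction n with
  | zero => simp
  | succ n ih => rw [xp_succ, xp_succ, ← Category.assoc, ih, Category.assoc, A.x_nat,
      Category.assoc]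

/-- The cup with dots. -/
def cn (n : ℕ) (Z : 𝒞) : Z ⟶ A.D.obj (A.U.obj Z) := A.c Z ≫ A.D.map (A.xp n Z)

/-- The cap with dots. -/
def dn (n : ℕ) (Z : 𝒞) : A.U.obj (A.D.obj Z) ⟶ Z := A.xp n (A.D.obj Z) ≫ A.d Z

theorem dn_zero (Z : 𝒞) : A.dn 0 Z = A.d Z := by simp [dn]

theorem dn_nat (n : ℕ) {Z W : 𝒞} (f : Z ⟶ W) :
    A.U.map (A.D.map f) ≫ A.dn n W = A.dn n Z ≫ f := by
  rw [dn, dn, reassoc_of% xp_nat, A.d_nat, Category.assoc]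

theorem xp_dn (m n : ℕ) (Z : 𝒞) : A.xp m (A.D.obj Z) ≫ A.dn n Z = A.dn (m + n) Z := by
  rw [dn, dn, xp_add, Category.assoc]

/-- The rightward crossing. -/
def t (Z : 𝒞) : A.U.obj (A.D.obj Z) ⟶ A.D.obj (A.U.obj Z) :=
  A.c _ ≫ A.D.map (A.s _ ≫ A.U.map (A.d Z))

theorem t_nat {Z W : 𝒞} (f : Z ⟶ W) :
    A.U.map (A.D.map f) ≫ A.t W = A.t Z ≫ A.D.map (A.U.map f) := by
  simp only [t, reassoc_of% A.c_nat, Category.assoc, ← Functor.map_comp, reassoc_of% A.s_nat, A.d_nat]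

/-- Each dot that passes the crossing leaves one term without crossing; the sum is the divided
difference of `xⁿ`. -/
theorem xp_s (n : ℕ) (Z : 𝒞) : A.xp n (A.U.obj Z) ≫ A.s Z = A.s Z ≫ A.U.map (A.xp n Z) +
    ∑ i ∈ Finset.range n, A.xp i (A.U.obj Z) ≫ A.U.map (A.xp (n - 1 - i) Z) := by
  -- This is the dot relation conjugated by the involution `s`.
  have h1 : A.x (A.U.obj Z) ≫ A.s Z = A.s Z ≫ A.U.map (A.x Z) + 𝟙 _ := by
    have := congrArg (fun f => A.s Z ≫ f ≫ A.s Z) (A.s_x Z)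
    simpa [A.s_s, reassoc_of% A.s_s] using this
  induction n with
  | zero => simp
  | succ n ih =>
    rw [xp_succ, Category.assoc, h1, Preadditive.comp_add, ← Category.assoc, ih,
      Preadditive.add_comp, Category.assoc, ← Functor.map_comp, ← xp_succ, Preadditive.sum_comp,
      Finset.sum_range_succ]
    simp only [Category.comp_id, Nat.add_sub_cancel, Nat.sub_self, xp_zero,
      add_assoc]
    rw [A.U.map_id, Category.comp_id]
    congr 2
    refine Finset.sum_congr rfl fun i hi => ?_
    rw [Category.assoc, ← Functor.map_comp, ← xp_succ]
    congr 4
    have := Finset.mem_range.1 hi; omega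

theorem s_U_xp (n : ℕ) (Z : 𝒞) : A.s Z ≫ A.U.map (A.xp n Z) = A.xp n (A.U.obj Z) ≫ A.s Z -
    ∑ i ∈ Finset.range n, A.xp i (A.U.obj Z) ≫ A.U.map (A.xp (n - 1 - i) Z) := by
  rw [xp_s, add_sub_cancel_right]

theorem s_xp (n : ℕ) (Z : 𝒞) : A.s Z ≫ A.xp n (A.U.obj Z) = A.U.map (A.xp n Z) ≫ A.s Z +
    ∑ i ∈ Finset.range n, A.xp i (A.U.obj Z) ≫ A.U.map (A.xp (n - 1 - i) Z) := by
  induction n with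
  | zero => simp
  | succ n ih =>
    rw [xp_succ, ← Category.assoc, ih, Preadditive.add_comp, Category.assoc, A.s_x,
      Preadditive.comp_add, Finset.sum_range_succ', ← Functor.map_comp_assoc, ← xp_succ,
      Preadditive.sum_comp, Category.comp_id, add_assoc]
    congr 1
    rw [add_comm]
    simp only [Nat.add_sub_cancel, xp_zero, Category.id_comp, Nat.sub_zero, add_left_inj]
    refine Finset.sum_congr rfl fun i hi => ?_
    rw [Category.assoc, A.x_nat, ← Category.assoc, ← xp_succ, Nat.sub_sub, Nat.add_comm 1 i]

/-- `t` is `s` with one strand bent; the cup straightens that strand again. `U_t_d` is the same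
argument with a cap. -/
theorem U_c_t (Z : 𝒞) : A.U.map (A.c Z) ≫ A.t (A.U.obj Z) =
    A.c (A.U.obj Z) ≫ A.D.map (A.s Z) := by
  rw [t, reassoc_of% A.c_nat, ← Functor.map_comp, reassoc_of% A.s_nat, ← Functor.map_comp, A.zigzag_up,
    A.U.map_id, Category.comp_id]

theorem U_t_d (Z : 𝒞) : A.U.map (A.t Z) ≫ A.d (A.U.obj Z) =
    A.s (A.D.obj Z) ≫ A.U.map (A.d Z) := by
  simp only [t, Functor.map_comp, Category.assoc, A.d_nat, reassoc_of% A.d_nat, reassoc_of% A.zigzag_up]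

/-- The error terms of `s_xp` have no crossing, so bending the strand of `t` splits each of them
into a cap followed by a cup. -/
theorem t_D_xp (n : ℕ) (Z : 𝒞) : A.t Z ≫ A.D.map (A.xp n Z) = A.xp n (A.D.obj Z) ≫ A.t Z +
    ∑ i ∈ Finset.range n, A.dn (n - 1 - i) Z ≫ A.cn i Z := by
  have h : ∀ i : ℕ, A.c _ ≫ A.D.map ((A.xp i (A.U.obj (A.D.obj Z)) ≫
      A.U.map (A.xp (n - 1 - i) (A.D.obj Z))) ≫ A.U.map (A.d Z)) =
      A.dn (n - 1 - i) Z ≫ A.cn i Z := fun i => by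
    rw [Category.assoc, ← Functor.map_comp, ← A.xp_nat, Functor.map_comp, ← reassoc_of% A.c_nat]; rfl
  simp only [t, Category.assoc, ← Functor.map_comp]
  rw [A.xp_nat, ← Category.assoc (A.s _), s_xp, Preadditive.add_comp, Functor.map_add,
    Preadditive.comp_add, Preadditive.sum_comp, Functor.map_sum, Preadditive.comp_sum,
    Finset.sum_congr rfl fun i _ => h i, Category.assoc, Functor.map_comp, ← reassoc_of% A.c_nat]

/-- The right mate of the dot. -/
def y (Z : 𝒞) : A.D.obj Z ⟶ A.D.obj Z :=
  A.c _ ≫ A.D.map (A.x _ ≫ A.d Z)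

theorem c_y (Z : 𝒞) : A.c Z ≫ A.y (A.U.obj Z) = A.c Z ≫ A.D.map (A.x Z) := by
  rw [y, reassoc_of% A.c_nat, ← Functor.map_comp, reassoc_of% A.x_nat, A.zigzag_up, Category.comp_id]

theorem U_y_d (Z : 𝒞) : A.U.map (A.y Z) ≫ A.d Z = A.x _ ≫ A.d Z := by
  simp only [y, Functor.map_comp, Category.assoc, A.d_nat, reassoc_of% A.d_nat, reassoc_of% A.zigzag_up]

theorem y_nat {Z W : 𝒞} (f : Z ⟶ W) : A.D.map f ≫ A.y W = A.y Z ≫ A.D.map f := by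
  simp only [y, Category.assoc, reassoc_of% A.c_nat, ← Functor.map_comp, reassoc_of% A.x_nat, A.d_nat]

theorem t_y (Z : 𝒞) : A.t Z ≫ A.y (A.U.obj Z) = A.U.map (A.y Z) ≫ A.t Z + A.d Z ≫ A.c Z := by
  have h : A.x (A.U.obj (A.D.obj Z)) ≫ A.s (A.D.obj Z) =
      A.s _ ≫ A.U.map (A.x _) + 𝟙 _ := by
    simpa [xp_succ] using A.xp_s 1 (A.D.obj Z)
  have h2 : A.t Z ≫ A.y (A.U.obj Z) =
      A.c (A.U.obj (A.D.obj Z)) ≫ A.D.map ((A.x _ ≫ A.s _) ≫ A.U.map (A.d Z)) := by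
    rw [t, Category.assoc, y_nat, reassoc_of% c_y, ← Functor.map_comp, Category.assoc]
  rw [h2, h, Preadditive.add_comp, Functor.map_add, Preadditive.comp_add, Category.id_comp,
    ← A.c_nat, Category.assoc, ← Functor.map_comp, ← A.U_y_d, t, reassoc_of% A.c_nat,
    ← Functor.map_comp, reassoc_of% A.s_nat, ← Functor.map_comp]

/-- The right mate of the crossing. -/
def sR (Z : 𝒞) : A.D.obj (A.D.obj Z) ⟶ A.D.obj (A.D.obj Z) :=
  A.c _ ≫ A.D.map (A.t _ ≫ A.D.map (A.d Z))

theorem U_sR_d (Z : 𝒞) : A.U.map (A.sR Z) ≫ A.d (A.D.obj Z) = A.t _ ≫ A.D.map (A.d Z) := by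
  simp only [sR, Functor.map_comp, Category.assoc, A.d_nat, reassoc_of% A.d_nat, reassoc_of% A.zigzag_up]

theorem c_D_t (Z : 𝒞) : A.c (A.D.obj Z) ≫ A.D.map (A.t Z) =
    A.D.map (A.c Z) ≫ A.sR (A.U.obj Z) := by
  rw [sR, reassoc_of% A.c_nat, ← Functor.map_comp, reassoc_of% A.t_nat, ← Functor.map_comp, A.zigzag_up,
    A.D.map_id, Category.comp_id]

/-- Morphisms into `D` are determined by their mates. -/
theorem eq_of_U_comp_d {W Z : 𝒞} {f g : W ⟶ A.D.obj Z}
    (h : A.U.map f ≫ A.d Z = A.U.map g ≫ A.d Z) : f = g := by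
  have key : ∀ f : W ⟶ A.D.obj Z, A.c W ≫ A.D.map (A.U.map f ≫ A.d Z) = f := fun f => by
    rw [Functor.map_comp, ← reassoc_of% A.c_nat, A.zigzag_down, Category.comp_id]
  rw [← key f, h, key g]

/-- Passing to mates in both `D` strands turns `sR` into `s`, so this is the mate of `s_s`. -/
theorem sR_sR (Z : 𝒞) : A.sR Z ≫ A.sR Z = 𝟙 _ := by
  have h : A.U.map (A.U.map (A.sR Z) ≫ A.d _) ≫ A.d Z =
      A.s _ ≫ A.U.map (A.d (A.D.obj Z)) ≫ A.d Z := by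
    rw [U_sR_d, Functor.map_comp, Category.assoc, A.d_nat, reassoc_of% U_t_d]
  refine A.eq_of_U_comp_d (A.eq_of_U_comp_d ?_)
  rw [A.U.map_comp (A.sR Z), Category.assoc, A.U.map_comp (A.U.map _), Category.assoc, h,
    reassoc_of% A.s_nat, ← Functor.map_comp_assoc, h, reassoc_of% A.s_s, A.U.map_id, Category.id_comp]

theorem U_t_t (Z : 𝒞) : A.U.map (A.t Z) ≫ A.t (A.U.obj Z) = A.c _ ≫ A.D.map (A.s _ ≫
    A.U.map (A.s _ ≫ A.U.map (A.d Z))) := by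
  rw [t.eq_def _ (A.U.obj Z), reassoc_of% A.c_nat, ← Functor.map_comp, reassoc_of% A.s_nat,
    ← Functor.map_comp, A.U_t_d]

/-- The braid relation with one of the three strands bent downwards. -/
theorem U_t_t_D_s (Z : 𝒞) : A.U.map (A.t Z) ≫ A.t (A.U.obj Z) ≫ A.D.map (A.s Z) =
    A.s (A.D.obj Z) ≫ A.U.map (A.t Z) ≫ A.t (A.U.obj Z) := by
  rw [reassoc_of% U_t_t, U_t_t, ← Functor.map_comp, reassoc_of% A.c_nat, ← Functor.map_comp, Category.assoc,
    A.U.map_comp, Category.assoc, A.s_nat, reassoc_of% A.braid]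

/-- The braid relation with two strands bent downwards: `U_t_t_D_s` after one more passage to mates.
-/
theorem U_sR_t_D_t (Z : 𝒞) : A.U.map (A.sR Z) ≫ A.t (A.D.obj Z) ≫ A.D.map (A.t Z) =
    A.t (A.D.obj Z) ≫ A.D.map (A.t Z) ≫ A.sR (A.U.obj Z) := by
  have h : A.U.map (A.t (A.D.obj Z) ≫ A.D.map (A.t Z)) ≫ A.t _ ≫ A.D.map (A.d (A.U.obj Z)) =
      A.U.map (A.U.map (A.sR Z) ≫ A.t (A.D.obj Z) ≫ A.D.map (A.t Z)) ≫ A.d _ := by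
    rw [A.U.map_comp, Category.assoc, reassoc_of% A.t_nat, ← Functor.map_comp, U_t_d,
      Functor.map_comp, reassoc_of% U_t_t_D_s, ← A.t_nat, ← Functor.map_comp_assoc, ← U_sR_d,
      Functor.map_comp_assoc, ← reassoc_of% A.s_nat, ← reassoc_of% U_t_d, ← A.d_nat]
    simp only [Functor.map_comp, Category.assoc]
  refine A.eq_of_U_comp_d ?_
  rw [← h, sR, ← Category.assoc (A.t _), reassoc_of% A.c_nat, ← Functor.map_comp, A.U.map_comp (A.c _),
    Category.assoc, A.d_nat, reassoc_of% A.zigzag_up]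

end HeckeAction
end Heisenberg

/-! ### Inverting the column: leftward cups and caps, and their uniqueness. -/

namespace Heisenberg

universe v w

namespace HeckeAction

variable {𝒞 : Type w} [Category.{v} 𝒞] [Preadditive 𝒞]

/-- A two-sided inverse of the column `[t, d₀, …, d_{k-1}]`. -/
structure Inversion (A : HeckeAction 𝒞) (k : ℕ) where
  T (Z : 𝒞) : A.D.obj (A.U.obj Z) ⟶ A.U.obj (A.D.obj Z)
  E (r : ℕ) (Z : 𝒞) : Z ⟶ A.U.obj (A.D.obj Z)
  T_nat {Z W : 𝒞} (f : Z ⟶ W) : A.D.map (A.U.map f) ≫ T W = T Z ≫ A.U.map (A.D.map f)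
  E_nat (r : ℕ) {Z W : 𝒞} (f : Z ⟶ W) : f ≫ E r W = E r Z ≫ A.U.map (A.D.map f)
  t_T (Z : 𝒞) : A.t Z ≫ T Z + ∑ r ∈ Finset.range k, A.dn r Z ≫ E r Z = 𝟙 _
  T_t (Z : 𝒞) : T Z ≫ A.t Z = 𝟙 _
  T_dn (r : ℕ) (hr : r < k) (Z : 𝒞) : T Z ≫ A.dn r Z = 0
  E_t (r : ℕ) (hr : r < k) (Z : 𝒞) : E r Z ≫ A.t Z = 0
  E_dn (r r' : ℕ) (hr : r < k) (hr' : r' < k) (Z : 𝒞) :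
    E r Z ≫ A.dn r' Z = if r = r' then 𝟙 Z else 0

/-- A candidate for the leftward cup and cap. -/
structure CupCap (A : HeckeAction 𝒞) where
  p (Z : 𝒞) : Z ⟶ A.U.obj (A.D.obj Z)
  q (Z : 𝒞) : A.D.obj (A.U.obj Z) ⟶ Z
  p_nat {Z W : 𝒞} (f : Z ⟶ W) : f ≫ p W = p Z ≫ A.U.map (A.D.map f)
  q_nat {Z W : 𝒞} (f : Z ⟶ W) : A.D.map (A.U.map f) ≫ q W = q Z ≫ f

namespace CupCap

variable {A : HeckeAction 𝒞} (P : A.CupCap)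

/-- The leftward cup with dots. -/
def cp (n : ℕ) (Z : 𝒞) : Z ⟶ A.U.obj (A.D.obj Z) := P.p Z ≫ A.xp n _

/-- The leftward cap with dots. -/
def dq (n : ℕ) (Z : 𝒞) : A.D.obj (A.U.obj Z) ⟶ Z := A.D.map (A.xp n Z) ≫ P.q Z

/-- The clockwise bubble. -/
def cw (n : ℕ) (Z : 𝒞) : Z ⟶ Z := P.p Z ≫ A.dn n Z

/-- The counterclockwise bubble. -/
def ccw (n : ℕ) (Z : 𝒞) : Z ⟶ Z := A.c Z ≫ P.dq n Z

/-- The leftward crossing. -/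
def tp (Z : 𝒞) : A.D.obj (A.U.obj Z) ⟶ A.U.obj (A.D.obj Z) :=
  A.D.map (A.U.map (P.p Z)) ≫ A.D.map (A.s _) ≫ P.q _

/-- The right curl. -/
def curlR (n : ℕ) (Z : 𝒞) : A.U.obj Z ⟶ A.U.obj Z :=
  A.U.map (P.p Z) ≫ A.s _ ≫ A.U.map (A.dn n Z)

/-- The left curl. -/
def curlL (n : ℕ) (Z : 𝒞) : A.U.obj Z ⟶ A.U.obj Z :=
  A.c _ ≫ A.D.map (A.s Z) ≫ P.dq n _

/-- The left mate of the crossing. -/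
def sL (Z : 𝒞) : A.D.obj (A.D.obj Z) ⟶ A.D.obj (A.D.obj Z) :=
  A.D.map (A.D.map (P.p Z ≫ A.U.map (P.p _))) ≫ A.D.map (A.D.map (A.s _)) ≫
    A.D.map (P.q _) ≫ P.q _

/-- The left mate of the dot. -/
def yL (Z : 𝒞) : A.D.obj Z ⟶ A.D.obj Z :=
  A.D.map (P.p Z) ≫ A.D.map (A.x _) ≫ P.q _

/-- The crossing of two upward strands with a downward strand on its left. -/
def altL (Z : 𝒞) : A.U.obj (A.D.obj (A.U.obj Z)) ⟶ A.U.obj (A.D.obj (A.U.obj Z)) :=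
  A.t _ ≫ A.D.map (A.s Z) ≫ P.tp _

/-- The crossing of two upward strands with a downward strand on its right. -/
def altR (Z : 𝒞) : A.U.obj (A.D.obj (A.U.obj Z)) ⟶ A.U.obj (A.D.obj (A.U.obj Z)) :=
  A.U.map (P.tp Z) ≫ A.s _ ≫ A.U.map (A.t Z)

theorem cw_nat (n : ℕ) {Z W : 𝒞} (f : Z ⟶ W) : f ≫ P.cw n W = P.cw n Z ≫ f := by
  rw [cw, cw, reassoc_of% P.p_nat, A.dn_nat, Category.assoc]

theorem dq_nat (n : ℕ) {Z W : 𝒞} (f : Z ⟶ W) :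
    A.D.map (A.U.map f) ≫ P.dq n W = P.dq n Z ≫ f := by
  rw [dq, dq, ← Functor.map_comp_assoc, A.xp_nat, Functor.map_comp_assoc, P.q_nat, Category.assoc]

theorem ccw_nat (n : ℕ) {Z W : 𝒞} (f : Z ⟶ W) : f ≫ P.ccw n W = P.ccw n Z ≫ f := by
  rw [ccw, ccw, reassoc_of% A.c_nat, P.dq_nat, Category.assoc]

/-- The undotted curl is the mate of `p ≫ t`. Prescribing one is prescribing the other, which is how
the curl condition enters the uniqueness proof. -/
theorem curlR_zero_eq (Z : 𝒞) : P.curlR 0 Z = A.U.map (P.p Z ≫ A.t Z) ≫ A.d _ := by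
  rw [curlR, A.dn_zero, ← A.U_t_d, Functor.map_comp_assoc]

/-- The dots leave the loop through the crossing; where the crossing is resolved, the loop closes up
to a bubble. -/
theorem curlR_eq_sub (n : ℕ) (Z : 𝒞) : P.curlR n Z = A.xp n Z ≫ P.curlR 0 Z -
    ∑ i ∈ Finset.range n, A.xp i Z ≫ A.U.map (P.cw (n - 1 - i) Z) := by
  rw [curlR, dn, Functor.map_comp, ← Category.assoc (A.s _), A.s_U_xp, Preadditive.sub_comp,
    Preadditive.comp_sub, curlR, A.dn_zero, Category.assoc, reassoc_of% A.xp_nat,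
    Preadditive.sum_comp, Preadditive.comp_sum]
  congr 1
  refine Finset.sum_congr rfl fun i _ => ?_
  rw [Category.assoc, reassoc_of% A.xp_nat, cw, ← Functor.map_comp, ← Functor.map_comp, dn]

theorem tp_dn (n : ℕ) (Z : 𝒞) : P.tp Z ≫ A.dn n Z = A.D.map (P.curlR n Z) ≫ P.q Z := by
  rw [tp, Category.assoc, Category.assoc, ← P.q_nat, curlR]
  simp only [Functor.map_comp, Category.assoc]

end CupCap

namespace Inversion

variable {A : HeckeAction 𝒞} {k : ℕ}

/-- The column has a left inverse by `t_T`, so it is a monomorphism. -/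
theorem hom_ext (I : A.Inversion k) {W Z : 𝒞} {f g : W ⟶ A.U.obj (A.D.obj Z)} (ht : f ≫ A.t Z = g ≫ A.t Z)
    (hd : ∀ r < k, f ≫ A.dn r Z = g ≫ A.dn r Z) : f = g := by
  rw [← Category.comp_id f, ← Category.comp_id g, ← I.t_T, Preadditive.comp_add,
    Preadditive.comp_add, ← Category.assoc, ht, Category.assoc, Preadditive.comp_sum,
    Preadditive.comp_sum]
  congr 1
  refine Finset.sum_congr rfl fun r hr => ?_
  rw [← Category.assoc, hd r (Finset.mem_range.1 hr), Category.assoc]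

variable (I : A.Inversion k)

/-- The counterclockwise bubble with `-r-1` dots. -/
def al (r : ℕ) (Z : 𝒞) : Z ⟶ Z :=
  if r < k then -(I.E r Z ≫ A.dn k Z) else if r = k then 𝟙 Z else 0

theorem al_self (Z : 𝒞) : I.al k Z = 𝟙 Z := by simp [al]

theorem al_of_lt {r : ℕ} (hr : k < r) (Z : 𝒞) : I.al r Z = 0 := by
  rw [al, if_neg (by omega), if_neg (by omega)]

theorem al_nat (r : ℕ) {Z W : 𝒞} (f : Z ⟶ W) : f ≫ I.al r W = I.al r Z ≫ f := by
  unfold al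
  split_ifs with h1 h2
  · rw [Preadditive.comp_neg, reassoc_of% I.E_nat, A.dn_nat, Preadditive.neg_comp, Category.assoc]
  · simp
  · simp

/-- The leftward cup and cap obtained from the inverse. -/
def cupCap : A.CupCap where
  -- The `E r` are dual to the `d_r` and killed by `t`, so `-E (k - 1)` has the prescribed
  -- composites; the sign gives the clockwise bubble with `k - 1` dots the value `-1`. For `k = 0`
  -- there is no `E`, and only the composite with `t` has to be prescribed.
  p Z := if k = 0 then A.c Z ≫ I.T Z else -I.E (k - 1) Z
  q Z := I.T Z ≫ A.dn k Z
  p_nat f := by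
    split_ifs
    · rw [reassoc_of% A.c_nat, I.T_nat, Category.assoc]
    · rw [Preadditive.comp_neg, I.E_nat, Preadditive.neg_comp]
  q_nat f := by rw [reassoc_of% I.T_nat, A.dn_nat, Category.assoc]

/-- The properties of the leftward cup and cap that determine them. -/
structure IsLeftward (P : A.CupCap) : Prop where
  p_t (Z : 𝒞) : P.p Z ≫ A.t Z = if k = 0 then A.c Z else 0
  p_dn (r : ℕ) (hr : r < k) (Z : 𝒞) : P.p Z ≫ A.dn r Z = if r + 1 = k then -𝟙 Z else 0
  q_eq (Z : 𝒞) : P.q Z = I.T Z ≫ A.dn k Z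

theorem isLeftward_cupCap : I.IsLeftward I.cupCap where
  p_t Z := by
    simp only [cupCap]
    split_ifs with h
    · rw [Category.assoc, I.T_t, Category.comp_id]
    · rw [Preadditive.neg_comp, I.E_t _ (by omega), neg_zero]
  p_dn r hr Z := by
    simp only [cupCap]
    rw [if_neg (by omega), Preadditive.neg_comp, I.E_dn _ _ (by omega) hr]
    by_cases h : r + 1 = k
    · rw [if_pos h, if_pos (by omega)]
    · rw [if_neg h, if_neg (by omega), neg_zero]
  q_eq Z := rfl

variable {I}

theorem IsLeftward.p_eq {P : A.CupCap} (h : I.IsLeftward P) (Z : 𝒞) : P.p Z = I.cupCap.p Z :=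
  I.hom_ext (by rw [h.p_t, I.isLeftward_cupCap.p_t])
    fun r hr => by rw [h.p_dn r hr, I.isLeftward_cupCap.p_dn r hr]

variable (I)

/-- The curls with at most `k` dots are known, and they are what `tp ≫ d_r` produces. Since also `tp
≫ t = 1`, comparison with `T` gives `tp = T`; the case `r = k` then reads `q = T ≫ d_k`, and the
undotted curl gives `p ≫ t`. -/
theorem isLeftward_of_relations (P : A.CupCap) (htp : ∀ Z, P.tp Z ≫ A.t Z = 𝟙 _)
    (hR : ∀ Z, P.curlR 0 Z = if k = 0 then 𝟙 _ else 0)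
    (hcw : ∀ r < k, ∀ Z, P.cw r Z = if r + 1 = k then -𝟙 Z else 0) : I.IsLeftward P := by
  -- In `curlR_eq_sub` the bubbles carry `r - 1 - i < k` dots, so only `r = k` and `i = 0` can
  -- contribute, with value `-1`.
  have hRk : ∀ r ≤ k, ∀ Z, P.curlR r Z = if r = k then 𝟙 _ else 0 := fun r hr Z => by
    rw [P.curlR_eq_sub, hR, Finset.sum_congr rfl (g := fun i =>
      if i = 0 then if r = k then -𝟙 _ else 0 else 0)]
    · rcases Nat.eq_zero_or_pos r with rfl | h0
      · by_cases hk : k = 0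
        · simp [hk]
        · simp [hk, Ne.symm hk]
      · rw [if_neg (by omega), Finset.sum_ite_eq' (Finset.range r) 0,
          if_pos (Finset.mem_range.2 h0)]
        split_ifs <;> simp
    · intro i hi
      have := Finset.mem_range.1 hi
      rw [hcw _ (by omega)]
      by_cases h : i = 0
      · subst h
        by_cases h2 : r = k
        · rw [if_pos (by omega), if_pos rfl, if_pos h2, Functor.map_neg]; simp
        · rw [if_neg (by omega), if_pos rfl, if_neg h2]; simp
      · rw [if_neg (by omega), if_neg h]; simp
  have hdn : ∀ r ≤ k, ∀ Z, P.tp Z ≫ A.dn r Z = if r = k then P.q Z else 0 := fun r hr Z => by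
    rw [P.tp_dn, hRk r hr]; split_ifs <;> simp
  have hT : ∀ Z, P.tp Z = I.T Z := fun Z => I.hom_ext (by rw [htp, I.T_t]) fun r hr => by
    rw [hdn r hr.le, if_neg (by omega), I.T_dn r hr]
  refine ⟨fun Z => ?_, fun r hr Z => hcw r hr Z, fun Z => ?_⟩
  · have h := hR Z
    rw [P.curlR_zero_eq] at h
    refine A.eq_of_U_comp_d (h.trans ?_)
    split_ifs
    · rw [A.zigzag_up]
    · simp
  · rw [← hT, hdn k le_rfl, if_pos rfl]

end Inversion

end HeckeAction
end Heisenberg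

/-! ### Left adjunction, and the inverse expressed through leftward cups and caps. -/

namespace Heisenberg

universe v w

namespace HeckeAction

variable {𝒞 : Type w} [Category.{v} 𝒞] [Preadditive 𝒞]

theorem U_sR_dn (A : HeckeAction 𝒞) (n : ℕ) (Z : 𝒞) :
    A.U.map (A.sR Z) ≫ A.dn n _ = A.t _ ≫ A.D.map (A.dn n Z) -
      ∑ i ∈ Finset.range n, A.dn (n - 1 - i) _ ≫ A.cn i _ ≫ A.D.map (A.d Z) := by
  have h := A.t_D_xp n (A.D.obj Z)
  rw [dn, reassoc_of% A.xp_nat, A.U_sR_d, dn, Functor.map_comp, reassoc_of% h, Preadditive.add_comp,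
    Preadditive.sum_comp]
  simp only [Category.assoc, add_sub_cancel_right]

theorem s_U_dn (A : HeckeAction 𝒞) (n : ℕ) (Z : 𝒞) :
    A.s _ ≫ A.U.map (A.dn n Z) = A.U.map (A.t Z) ≫ A.dn n _ -
      ∑ i ∈ Finset.range n, A.xp i _ ≫ A.U.map (A.dn (n - 1 - i) Z) := by
  rw [dn, Functor.map_comp, ← Category.assoc, A.s_U_xp, Preadditive.sub_comp, Category.assoc,
    ← A.U_t_d, ← reassoc_of% A.xp_nat, ← dn, Preadditive.sum_comp]
  simp only [Category.assoc, ← Functor.map_comp]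
  rfl

theorem s_U_t_dn (A : HeckeAction 𝒞) (n : ℕ) (Z : 𝒞) :
    A.s _ ≫ A.U.map (A.t Z) ≫ A.dn n _ = A.U.map (A.dn n Z) +
      ∑ i ∈ Finset.range n, A.s _ ≫ A.U.map (A.dn (n - 1 - i) Z) ≫ A.xp i Z := by
  rw [dn, reassoc_of% A.xp_nat, A.U_t_d, ← Category.assoc (A.xp n _), A.xp_s, Preadditive.add_comp,
    Preadditive.comp_add, Category.assoc, reassoc_of% A.s_s, Preadditive.sum_comp,
    Preadditive.comp_sum, ← Functor.map_comp, ← dn]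
  congr 1
  refine Finset.sum_congr rfl fun i _ => ?_
  rw [Category.assoc, ← Functor.map_comp, ← dn, A.xp_nat]

namespace Inversion

variable {A : HeckeAction 𝒞} {k : ℕ} {I : A.Inversion k} {P : A.CupCap}

/-- An additive functor preserves the left inverse of the column. This is needed for the column
whiskered by `D`. -/
theorem hom_ext_map (I : A.Inversion k) (F : 𝒞 ⥤ 𝒞) [F.Additive] {W Z : 𝒞}
    {f g : W ⟶ F.obj (A.U.obj (A.D.obj Z))}
    (ht : f ≫ F.map (A.t Z) = g ≫ F.map (A.t Z))
    (hd : ∀ r < k, f ≫ F.map (A.dn r Z) = g ≫ F.map (A.dn r Z)) : f = g := by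
  rw [← Category.comp_id f, ← Category.comp_id g, ← F.map_id, ← I.t_T, Functor.map_add,
    Preadditive.comp_add, Preadditive.comp_add, Functor.map_comp, ← Category.assoc, ht,
    Category.assoc, Functor.map_sum, Preadditive.comp_sum, Preadditive.comp_sum]
  congr 1
  refine Finset.sum_congr rfl fun r hr => ?_
  rw [Functor.map_comp, ← Category.assoc, hd r (Finset.mem_range.1 hr), Category.assoc]

namespace IsLeftward

theorem cw_eq (h : I.IsLeftward P) (r : ℕ) (hr : r < k) (Z : 𝒞) :
    P.cw r Z = if r + 1 = k then -𝟙 Z else 0 := h.p_dn r hr Z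

theorem curlR_zero (h : I.IsLeftward P) (Z : 𝒞) : P.curlR 0 Z = if k = 0 then 𝟙 _ else 0 := by
  rw [P.curlR_zero_eq, h.p_t]
  split_ifs
  · rw [A.zigzag_up]
  · simp

theorem curlR_eq (h : I.IsLeftward P) (n : ℕ) (Z : 𝒞) :
    P.curlR n Z = (if k = 0 then A.xp n Z else 0) -
      ∑ i ∈ Finset.range n, A.xp i Z ≫ A.U.map (P.cw (n - 1 - i) Z) := by
  rw [P.curlR_eq_sub, h.curlR_zero]
  split_ifs <;> simp

/-- A leftward cup is pulled through the inverse crossing, which becomes a crossing of downward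
strands. Both sides are tested against the column, and after composing with `t` once more against
the column under `D`. There the bent braid relation, `c_D_t` and `sR_sR` decide. -/
theorem D_p_T (h : I.IsLeftward P) (Z : 𝒞) :
    A.D.map (P.p Z) ≫ I.T _ = P.p _ ≫ A.U.map (A.sR Z) := by
  -- Here `k > 0`, so `p ≫ t = 0`, and the error terms contain `p ≫ d_l` with `l < k - 1`.
  have hlt : ∀ j < k, P.p (A.D.obj Z) ≫ A.U.map (A.sR Z) ≫ A.dn j _ = 0 := fun j hj => by
    rw [A.U_sR_dn, Preadditive.comp_sub, ← Category.assoc, h.p_t, if_neg (by omega),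
      Limits.zero_comp, Preadditive.comp_sum, Finset.sum_eq_zero, sub_zero]
    intro i hi
    have := Finset.mem_range.1 hi
    rw [← Category.assoc, h.p_dn _ (by omega), if_neg (by omega), Limits.zero_comp]
  refine I.hom_ext ?_ fun r hr => ?_
  · rw [Category.assoc, I.T_t, Category.comp_id, Category.assoc]
    refine I.hom_ext_map A.D ?_ fun r hr => ?_
    · rw [Category.assoc, Category.assoc, A.U_sR_t_D_t, ← Functor.map_comp, h.p_t,
        ← Category.assoc, h.p_t]
      split_ifs
      · rw [← Category.assoc, A.c_D_t, Category.assoc, A.sR_sR, Category.comp_id]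
      · simp
    · have h1 := A.U_sR_dn r Z
      rw [Category.assoc, Category.assoc, ← eq_sub_iff_add_eq.1 h1, Preadditive.comp_add,
        Preadditive.comp_add, ← Functor.map_comp_assoc, A.sR_sR, A.U.map_id, Category.id_comp,
        h.p_dn r hr, Preadditive.comp_sum, Preadditive.comp_sum, Finset.sum_eq_zero, add_zero,
        ← Functor.map_comp, h.p_dn r hr]
      · split_ifs <;> simp
      · intro i hi
        have := Finset.mem_range.1 hi
        have h2 := hlt (r - 1 - i) (by omega)
        rw [← Category.assoc, ← Category.assoc, Category.assoc (P.p _), h2, Limits.zero_comp]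
  · rw [Category.assoc, I.T_dn _ hr, Limits.comp_zero, Category.assoc, hlt r hr]

/-- With exactly `k` dots one term survives: the main term if `k = 0`, otherwise the error term with
`p ≫ d_{k-1} = -1`. In both cases it is a right zigzag. -/
theorem p_U_sR_dn (h : I.IsLeftward P) (Z : 𝒞) :
    P.p _ ≫ A.U.map (A.sR Z) ≫ A.dn k _ = 𝟙 _ := by
  rw [A.U_sR_dn, Preadditive.comp_sub, ← Category.assoc, h.p_t, Preadditive.comp_sum]
  rcases Nat.eq_zero_or_pos k with rfl | hk
  · simp [A.dn_zero, A.zigzag_down]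
  · rw [if_neg (by omega), Limits.zero_comp, Finset.sum_eq_single 0, ← Category.assoc,
      h.p_dn _ (by omega), if_pos (by omega)]
    · simp [cn, A.zigzag_down]
    · intro i hi h0
      have := Finset.mem_range.1 hi
      rw [← Category.assoc, h.p_dn _ (by omega), if_neg (by omega), Limits.zero_comp]
    · simp [hk.ne']

theorem zigzag_down (h : I.IsLeftward P) (Z : 𝒞) : A.D.map (P.p Z) ≫ P.q _ = 𝟙 _ := by
  rw [h.q_eq, ← Category.assoc, h.D_p_T, Category.assoc, h.p_U_sR_dn]

/-- A leftward cap after a rightward crossing. -/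
theorem t_q (h : I.IsLeftward P) (Z : 𝒞) :
    A.t Z ≫ P.q Z = ∑ r ∈ Finset.range (k + 1), A.dn r Z ≫ I.al r Z := by
  have h1 := I.t_T Z
  rw [h.q_eq, ← Category.assoc, eq_sub_of_add_eq h1, Preadditive.sub_comp, Category.id_comp,
    Finset.sum_range_succ, I.al_self, Category.comp_id, Preadditive.sum_comp, sub_eq_neg_add,
    ← Finset.sum_neg_distrib]
  congr 1
  refine Finset.sum_congr rfl fun r hr => ?_
  rw [al, if_pos (Finset.mem_range.1 hr), Preadditive.comp_neg, Category.assoc]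

/-- `T` kills `d_j` for `j < k`, so dots pushed through the crossings survive only where `T` cancels
against `t`, or, for `n = k`, where `T ≫ d_k` is the leftward cap. -/
theorem U_T_s_U_t_dn (h : I.IsLeftward P) (n : ℕ) (hn : n ≤ k) (Z : 𝒞) :
    A.U.map (I.T Z) ≫ A.s _ ≫ A.U.map (A.t Z) ≫ A.dn n _ =
      (if n = k then A.U.map (P.q Z) else 0) +
        ∑ i ∈ Finset.range n, A.dn (n - 1 - i) _ ≫ A.xp i Z := by
  rw [A.s_U_t_dn, Preadditive.comp_add, ← Functor.map_comp, Preadditive.comp_sum]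
  congr 1
  · split_ifs with h1
    · rw [h1, h.q_eq]
    · rw [I.T_dn _ (by omega), Functor.map_zero]
  · refine Finset.sum_congr rfl fun i hi => ?_
    have := Finset.mem_range.1 hi
    rw [← Category.assoc (A.s _), A.s_U_dn, Preadditive.sub_comp, Preadditive.comp_sub,
      Category.assoc, ← Functor.map_comp_assoc, I.T_t, A.U.map_id, Category.id_comp,
      Preadditive.sum_comp, Preadditive.comp_sum, Finset.sum_eq_zero, sub_zero]
    intro j hj
    rw [← Category.assoc, ← Category.assoc, A.xp_nat, Category.assoc (A.xp j _),
      ← Functor.map_comp, I.T_dn _ (by omega)]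
    simp

/-- The leftward cap passes below an upward strand. -/
theorem t_D_s_q (h : I.IsLeftward P) (Z : 𝒞) :
    A.t _ ≫ A.D.map (A.s Z) ≫ P.q _ = A.U.map (P.q Z) +
      ∑ r ∈ Finset.range (k + 1), ∑ i ∈ Finset.range r,
        A.dn (r - 1 - i) _ ≫ A.xp i Z ≫ I.al r _ := by
  -- Inserting `T ≫ t = 1` on the inner strand makes the bent braid relation applicable. It moves
  -- the crossing away from the cap, which then meets `t`, so that `t_q` applies.
  have h1 : A.t _ ≫ A.D.map (A.s Z) ≫ P.q _ =
      A.U.map (I.T Z) ≫ A.U.map (A.t Z) ≫ A.t _ ≫ A.D.map (A.s Z) ≫ P.q _ := by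
    rw [← Functor.map_comp_assoc, I.T_t, A.U.map_id, Category.id_comp]
  have h2 : ∀ r ∈ Finset.range (k + 1),
      A.U.map (I.T Z) ≫ A.s _ ≫ A.U.map (A.t Z) ≫ A.dn r _ ≫ I.al r _ =
      (if r = k then A.U.map (P.q Z) else 0) + ∑ i ∈ Finset.range r,
        A.dn (r - 1 - i) _ ≫ A.xp i Z ≫ I.al r _ := fun r hr => by
    have h3 := h.U_T_s_U_t_dn r (Nat.lt_succ_iff.1 (Finset.mem_range.1 hr)) Z
    have h4 := congrArg (fun f => f ≫ I.al r _) h3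
    simp only [Category.assoc, Preadditive.add_comp, Preadditive.sum_comp] at h4
    rw [h4]
    congr 1
    split_ifs with h5
    · rw [h5, I.al_self, Category.comp_id]
    · simp
  rw [h1, reassoc_of% A.U_t_t_D_s, h.t_q, Preadditive.comp_sum, Preadditive.comp_sum,
    Preadditive.comp_sum, Finset.sum_congr rfl h2, Finset.sum_add_distrib, Finset.sum_ite_eq',
    if_pos (Finset.self_mem_range_succ k)]

theorem t_q_of_eq_zero (h : I.IsLeftward P) (hk : k = 0) (Z : 𝒞) : A.t Z ≫ P.q Z = A.d Z := by
  subst hk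
  rw [h.t_q]
  simp [A.dn_zero, I.al_self]

/-- Put a leftward cup below `t_D_s_q`. If `k > 0`, the left side vanishes and the only surviving
correction is `r = k`, `i = 0`, equal to `-1`. If `k = 0`, there is no correction and the left side
is a right zigzag. -/
theorem zigzag_up (h : I.IsLeftward P) (Z : 𝒞) : P.p _ ≫ A.U.map (P.q Z) = 𝟙 _ := by
  have h1 := congrArg (fun f => P.p _ ≫ f) (h.t_D_s_q Z)
  simp only [Preadditive.comp_add, Preadditive.comp_sum] at h1
  rw [← Category.assoc, h.p_t] at h1
  rcases Nat.eq_zero_or_pos k with hk | hk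
  · rw [if_pos hk, ← reassoc_of% A.U_c_t, h.t_q_of_eq_zero hk, A.zigzag_up] at h1
    subst hk
    simpa using h1.symm
  · rw [if_neg hk.ne', Limits.zero_comp, Finset.sum_eq_single k, Finset.sum_eq_single 0,
      ← Category.assoc, h.p_dn _ (by omega), if_pos (by omega), I.al_self] at h1
    · simpa [add_neg_eq_zero] using h1.symm
    · intro i hi h0
      have := Finset.mem_range.1 hi
      rw [← Category.assoc, h.p_dn _ (by omega), if_neg (by omega), Limits.zero_comp]
    · simp [hk.ne']
    · intro r hr hrk
      have := Finset.mem_range.1 hr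
      refine Finset.sum_eq_zero fun i hi => ?_
      have := Finset.mem_range.1 hi
      rw [← Category.assoc, h.p_dn _ (by omega), if_neg (by omega), Limits.zero_comp]
    · simp

/-- By naturality of `t` the cup inside `tp` moves below it; then `t_D_s_q` applies, and its main
term is closed by `zigzag_down`. -/
theorem t_tp (h : I.IsLeftward P) (Z : 𝒞) : A.t Z ≫ P.tp Z = 𝟙 _ +
      ∑ r ∈ Finset.range (k + 1), ∑ i ∈ Finset.range r,
        A.dn (r - 1 - i) _ ≫ I.al r _ ≫ P.cp i Z := by
  rw [CupCap.tp, ← reassoc_of% A.t_nat, h.t_D_s_q, Preadditive.comp_add, ← Functor.map_comp,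
    h.zigzag_down, A.U.map_id]
  congr 1
  simp only [Preadditive.comp_sum]
  refine Finset.sum_congr rfl fun r _ => Finset.sum_congr rfl fun i _ => ?_
  rw [reassoc_of% A.dn_nat, CupCap.cp, ← I.al_nat, Category.assoc]

theorem cp_t (h : I.IsLeftward P) (n : ℕ) (hn : n < k) (Z : 𝒞) : P.cp n Z ≫ A.t Z = 0 := by
  rw [CupCap.cp, Category.assoc, eq_sub_of_add_eq (A.t_D_xp n Z).symm, Preadditive.comp_sub,
    ← Category.assoc, h.p_t, if_neg (by omega), Limits.zero_comp, Preadditive.comp_sum,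
    Finset.sum_eq_zero, sub_zero]
  intro i hi
  have := Finset.mem_range.1 hi
  rw [← Category.assoc, h.p_dn _ (by omega), if_neg (by omega), Limits.zero_comp]

theorem tp_t (h : I.IsLeftward P) (Z : 𝒞) : P.tp Z ≫ A.t Z = 𝟙 _ := by
  -- All corrections in `t_tp` end in a cup with fewer than `k` dots, which `t` kills. Then `t` can
  -- be cancelled on the left because `T ≫ t = 1`.
  have h1 : A.t Z ≫ P.tp Z ≫ A.t Z = A.t Z := by
    rw [← Category.assoc, h.t_tp, Preadditive.add_comp, Category.id_comp, Preadditive.sum_comp,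
      Finset.sum_eq_zero, add_zero]
    intro r hr
    have := Finset.mem_range.1 hr
    rw [Preadditive.sum_comp, Finset.sum_eq_zero]
    intro i hi
    have := Finset.mem_range.1 hi
    rw [Category.assoc, Category.assoc, h.cp_t i (by omega)]
    simp
  rw [← I.T_t, ← h1, reassoc_of% I.T_t, h1]

theorem curlR_of_le (h : I.IsLeftward P) (n : ℕ) (hn : n ≤ k) (Z : 𝒞) :
    P.curlR n Z = if n = k then 𝟙 _ else 0 := by
  rw [h.curlR_eq]
  rcases Nat.eq_zero_or_pos n with rfl | h0
  · by_cases hk : k = 0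
    · simp [hk]
    · simp [hk, Ne.symm hk]
  · rw [if_neg (by omega), Finset.sum_eq_single 0, h.cw_eq _ (by omega)]
    · by_cases h1 : n = k
      · rw [if_pos (by omega), if_pos h1, Functor.map_neg]; simp
      · rw [if_neg (by omega), if_neg h1]; simp
    · intro i hi hi0
      have := Finset.mem_range.1 hi
      rw [h.cw_eq _ (by omega), if_neg (by omega)]
      simp
    · simp [h0.ne']

/-- Both have composite `1` with `t`; the composites of `tp` with `d_r` for `r < k` are curls with
too few dots, hence zero, as are those of `T`. -/
theorem T_eq (h : I.IsLeftward P) (Z : 𝒞) : I.T Z = P.tp Z := by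
  refine I.hom_ext ?_ fun r hr => ?_
  · rw [I.T_t, h.tp_t]
  · rw [I.T_dn _ hr, P.tp_dn, h.curlR_of_le r hr.le, if_neg hr.ne]
    simp

/-- `E n` kills `t`, so composing it with `t_tp` solves for `E n`; duality with the `d_r` selects
the terms with `r - 1 - i = n`. -/
theorem E_eq (h : I.IsLeftward P) (n : ℕ) (hn : n < k) (Z : 𝒞) :
    I.E n Z = -∑ i ∈ Finset.range (k - n), I.al (n + 1 + i) Z ≫ P.cp i Z := by
  have h1 := congrArg (fun f => I.E n Z ≫ f) (h.t_tp Z)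
  simp only [← Category.assoc, I.E_t n hn, Limits.zero_comp, Preadditive.comp_add,
    Category.comp_id, Preadditive.comp_sum] at h1
  rw [eq_neg_iff_add_eq_zero, h1]
  congr 1
  have h2 : ∀ r ∈ Finset.range (k + 1), ∑ i ∈ Finset.range r,
      ((I.E n Z ≫ A.dn (r - 1 - i) Z) ≫ I.al r Z) ≫ P.cp i Z =
      if n < r then I.al r Z ≫ P.cp (r - 1 - n) Z else 0 := fun r hr => by
    have := Finset.mem_range.1 hr
    split_ifs with h3
    · rw [Finset.sum_eq_single (r - 1 - n), I.E_dn _ _ hn (by omega), if_pos (by omega),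
        Category.id_comp]
      · intro i hi hin
        have := Finset.mem_range.1 hi
        rw [I.E_dn _ _ hn (by omega), if_neg (by omega)]; simp
      · intro h4; exact absurd (Finset.mem_range.2 (by omega)) h4
    · refine Finset.sum_eq_zero fun i hi => ?_
      have := Finset.mem_range.1 hi
      rw [I.E_dn _ _ hn (by omega), if_neg (by omega)]; simp
  rw [Finset.sum_congr rfl h2, ← Finset.sum_filter]
  refine Finset.sum_bij (fun i _ => n + 1 + i) ?_ ?_ ?_ ?_
  · intro i hi
    simp only [Finset.mem_filter, Finset.mem_range] at hi ⊢
    omega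
  · intro i _ j _ h4; simpa using h4
  · intro r hr
    simp only [Finset.mem_filter, Finset.mem_range] at hr
    exact ⟨r - 1 - n, Finset.mem_range.2 (by omega), by omega⟩
  · intro i _
    rw [show n + 1 + i - 1 - n = i by omega]

end IsLeftward

end Inversion

end HeckeAction
end Heisenberg

/-! ### Curls, Grassmannian relation, bubble slides, cyclicity and the alternating braid relation.
-/

namespace Heisenberg

universe v w

namespace HeckeAction

variable {𝒞 : Type w} [Category.{v} 𝒞] [Preadditive 𝒞]

theorem U_c_dn (A : HeckeAction 𝒞) (n : ℕ) (Z : 𝒞) :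
    A.U.map (A.c Z) ≫ A.dn n _ = A.xp n Z := by
  rw [dn, reassoc_of% A.xp_nat, A.zigzag_up, Category.comp_id]

namespace Inversion.IsLeftward

variable {A : HeckeAction 𝒞} {k : ℕ} {I : A.Inversion k} {P : A.CupCap}

theorem t_dq (h : I.IsLeftward P) (n : ℕ) (Z : 𝒞) :
    A.t Z ≫ P.dq n Z = ∑ r ∈ Finset.range (k + 1), A.dn (n + r) Z ≫ I.al r Z +
      ∑ i ∈ Finset.range n, A.dn (n - 1 - i) Z ≫ P.ccw i Z := by
  rw [CupCap.dq, ← Category.assoc, A.t_D_xp, Preadditive.add_comp, Category.assoc, h.t_q,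
    Preadditive.comp_sum, Preadditive.sum_comp]
  congr 1
  · exact Finset.sum_congr rfl fun r _ => by rw [reassoc_of% A.xp_dn]
  · exact Finset.sum_congr rfl fun i _ => by rw [Category.assoc, cn, Category.assoc]; rfl

/-- By `U_c_t` the curl is `t ≫ q_n` closed by a rightward cup, and a dotted zigzag is a dotted
strand. -/
theorem curlL_eq (h : I.IsLeftward P) (n : ℕ) (Z : 𝒞) :
    P.curlL n Z = ∑ r ∈ Finset.range (k + 1), A.xp (n + r) Z ≫ I.al r _ +
      ∑ i ∈ Finset.range n, A.xp (n - 1 - i) Z ≫ P.ccw i _ := by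
  rw [CupCap.curlL, ← reassoc_of% A.U_c_t, h.t_dq, Preadditive.comp_add, Preadditive.comp_sum,
    Preadditive.comp_sum]
  simp only [reassoc_of% A.U_c_dn]

/-- Close `t_dq` by a leftward cup instead: the caps become clockwise bubbles, and `p ≫ t` is known.
-/
theorem grassmannian (h : I.IsLeftward P) (n : ℕ) (Z : 𝒞) :
    (if k = 0 then P.ccw n Z else 0) =
      ∑ r ∈ Finset.range (k + 1), P.cw (n + r) Z ≫ I.al r Z +
      ∑ i ∈ Finset.range n, P.cw (n - 1 - i) Z ≫ P.ccw i Z := by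
  have h1 := congrArg (fun f => P.p Z ≫ f) (h.t_dq n Z)
  simp only [Preadditive.comp_add, Preadditive.comp_sum, ← Category.assoc, h.p_t] at h1
  refine Eq.trans ?_ h1
  split_ifs
  · rfl
  · simp

/-- The leftward cup can be pulled across an upward strand. Tested against the column, the error
terms are curls with fewer than `k` dots. -/
theorem p_U_eq (h : I.IsLeftward P) (Z : 𝒞) :
    P.p (A.U.obj Z) = A.U.map (P.p Z) ≫ A.s _ ≫ A.U.map (A.t Z) := by
  refine I.hom_ext ?_ fun r hr => ?_
  · rw [Category.assoc, Category.assoc, ← A.U_t_t_D_s, ← Functor.map_comp_assoc, h.p_t, h.p_t]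
    split_ifs
    · rw [reassoc_of% A.U_c_t, ← Functor.map_comp, A.s_s]; simp
    · simp
  · rw [Category.assoc, Category.assoc, A.s_U_t_dn, h.p_dn r hr, Preadditive.comp_add,
      ← Functor.map_comp, h.p_dn r hr, Preadditive.comp_sum, Finset.sum_eq_zero, add_zero]
    · split_ifs <;> simp
    · intro i hi
      have := Finset.mem_range.1 hi
      have h1 := h.curlR_of_le (r - 1 - i) (by omega) Z
      rw [CupCap.curlR, if_neg (by omega)] at h1
      rw [← Category.assoc, ← Category.assoc, Category.assoc (A.U.map _), h1, Limits.zero_comp]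

/-- Close the pulled cup of `p_U_eq` by a dotted cap; each dot crossing the strand leaves a curl. -/
theorem cw_slide (h : I.IsLeftward P) (n : ℕ) (Z : 𝒞) :
    P.cw n (A.U.obj Z) = A.U.map (P.cw n Z) +
      ∑ i ∈ Finset.range n, P.curlR (n - 1 - i) Z ≫ A.xp i Z := by
  rw [CupCap.cw, h.p_U_eq, Category.assoc, Category.assoc, A.s_U_t_dn, Preadditive.comp_add,
    ← Functor.map_comp, Preadditive.comp_sum]
  congr 1
  exact Finset.sum_congr rfl fun i _ => by rw [CupCap.curlR, Category.assoc, Category.assoc]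

/-- `t` can be cancelled on the left because `T ≫ t = 1`. After `t`, a dot passes on either leg with
the same error `d ≫ c ≫ q`, and the rest reduces by `t_q` to dots moving around rightward caps. -/
theorem q_dot (h : I.IsLeftward P) (Z : 𝒞) :
    A.D.map (A.x Z) ≫ P.q Z = A.y _ ≫ P.q Z := by
  have h1 : A.t Z ≫ A.D.map (A.x Z) ≫ P.q Z = A.t Z ≫ A.y _ ≫ P.q Z := by
    have h2 := A.t_D_xp 1 Z
    simp only [xp_succ, xp_zero, Category.id_comp, Finset.range_one, Finset.sum_singleton,
      Nat.sub_self, A.dn_zero, cn, A.D.map_id, Category.comp_id] at h2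
    rw [reassoc_of% h2, reassoc_of% A.t_y Z, Preadditive.add_comp, Preadditive.add_comp]
    congr 1
    rw [Category.assoc, Category.assoc, h.t_q, Preadditive.comp_sum, Preadditive.comp_sum]
    refine Finset.sum_congr rfl fun r _ => ?_
    rw [dn, Category.assoc, reassoc_of% A.xp_nat, reassoc_of% A.U_y_d]
    have h3 : A.x (A.D.obj Z) ≫ A.xp r _ = A.xp r _ ≫ A.x _ := by
      simpa [xp_succ] using A.xp_comm 1 r (A.D.obj Z)
    rw [← Category.assoc, h3]
    simp only [Category.assoc]
  have h2 := congrArg (fun f => I.T Z ≫ f) h1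
  simpa [reassoc_of% I.T_t] using h2

theorem y_eq (h : I.IsLeftward P) (Z : 𝒞) : P.yL Z = A.y Z := by
  rw [CupCap.yL, h.q_dot, ← Category.assoc, A.y_nat, Category.assoc, h.zigzag_down,
    Category.comp_id]

/-- One half of the left mate is a leftward cup followed by `tp = T`. `D_p_T` turns this into `sR`,
and a zigzag is left over. -/
theorem sL_eq (h : I.IsLeftward P) (Z : 𝒞) : P.sL Z = A.sR Z := by
  have h1 : P.sL Z = A.D.map (A.D.map (P.p Z) ≫ P.tp _) ≫ P.q _ := by
    simp only [CupCap.sL, CupCap.tp, Functor.map_comp, Category.assoc]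
  rw [h1, ← h.T_eq, h.D_p_T, Functor.map_comp, Category.assoc, P.q_nat, reassoc_of% h.zigzag_down]

/-- The leftward crossing is a two-sided inverse up to a correction term; compare a vertical
strand passing on its two sides. -/
theorem altL_sub_altR (h : I.IsLeftward P) (Z : 𝒞) : P.altL Z - P.altR Z =
    ∑ r ∈ Finset.range (k + 1), ∑ i ∈ Finset.range r, ∑ j ∈ Finset.range (r - 1 - i),
      A.dn (r - 1 - i - 1 - j) _ ≫ A.xp j Z ≫ I.al r _ ≫ P.cp i _ := by
  have hU : A.U.map (P.tp Z) ≫ A.U.map (A.t Z) = 𝟙 _ := by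
    rw [← Functor.map_comp, h.tp_t, A.U.map_id]
  -- With `tp ≫ t = 1` inserted on the inner strands, the bent braid relation makes `altL` equal to
  -- `altR` with an extra factor `t ≫ tp`. The corrections in `t_tp` are then the whole difference.
  have h1 : P.altL Z = A.U.map (P.tp Z) ≫ A.s _ ≫ A.U.map (A.t Z) ≫ A.t _ ≫ P.tp _ := by
    rw [← reassoc_of% A.U_t_t_D_s, ← Category.assoc, hU, Category.id_comp, CupCap.altL]
  rw [h1, h.t_tp, CupCap.altR]
  simp only [Preadditive.comp_add, Category.comp_id, add_sub_cancel_left, Preadditive.comp_sum]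
  refine Finset.sum_congr rfl fun r hr => Finset.sum_congr rfl fun i hi => ?_
  have := Finset.mem_range.1 hr
  have := Finset.mem_range.1 hi
  have h2 := h.U_T_s_U_t_dn (r - 1 - i) (by omega) Z
  rw [if_neg (by omega), zero_add, h.T_eq] at h2
  have h3 := congrArg (fun f => f ≫ I.al r _ ≫ P.cp i _) h2
  simpa only [Category.assoc, Preadditive.sum_comp] using h3

end Inversion.IsLeftward

end HeckeAction
end Heisenberg

/-! ### Integer dot numbers, generating series, and sums with uniform bounds. -/

namespace Heisenberg

universe v w

section Sums

variable {M : Type*} [AddCommMonoid M]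

theorem sum_range_eq_of_le {f : ℕ → M} {m n : ℕ} (hmn : m ≤ n) (hf : ∀ i, m ≤ i → f i = 0) :
    ∑ i ∈ Finset.range n, f i = ∑ i ∈ Finset.range m, f i := by
  refine (Finset.sum_subset (fun i hi => ?_) fun i _ hi => hf i ?_).symm
  · exact Finset.mem_range.2 (lt_of_lt_of_le (Finset.mem_range.1 hi) hmn)
  · simpa using hi

/-- A sum over a square, supported below a diagonal, as a sum over diagonals. -/
theorem sum_square_eq_sum_diag {f : ℕ → ℕ → M} {k N : ℕ} (hN : k ≤ N)
    (hf : ∀ i j, k ≤ i + j → f i j = 0) :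
    ∑ i ∈ Finset.range N, ∑ j ∈ Finset.range N, f i j =
      ∑ r ∈ Finset.range (k + 1), ∑ i ∈ Finset.range r, f i (r - 1 - i) := by
  rw [Finset.sum_range_succ']
  simp only [Finset.range_zero, Finset.sum_empty, add_zero, Nat.add_sub_cancel]
  rw [Finset.sum_range_diag_flip k f, sum_range_eq_of_le hN]
  · refine Finset.sum_congr rfl fun i hi => ?_
    have := Finset.mem_range.1 hi
    exact sum_range_eq_of_le (by omega) fun j hj => hf i j (by omega)
  · intro i hi
    exact Finset.sum_eq_zero fun j _ => hf i j (by omega)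

end Sums

section Series

open PowerSeries

/-- If two pairs of mutually inverse power series satisfy a slide relation in one component, then
they satisfy it in the other one. -/
theorem slide_of_slide {S : Type*} [Ring S] (la lb ra rb : ℕ → S) (x : S)
    (hl : ∀ m, ∑ p ∈ Finset.HasAntidiagonal.antidiagonal m, la p.1 * lb p.2 =
      if m = 0 then -1 else 0)
    (hr : ∀ m, ∑ p ∈ Finset.HasAntidiagonal.antidiagonal m, rb p.1 * ra p.2 =
      if m = 0 then -1 else 0)
    (ha : ∀ m, la m = ra m - ∑ i ∈ Finset.range (m - 1), (i + 1) • (ra (m - 2 - i) * x ^ i))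
    (m : ℕ) :
    rb m = lb m - ∑ i ∈ Finset.range (m - 1), (i + 1) • (x ^ i * lb (m - 2 - i)) := by
  -- This is `1 - X² / (1 - xX)²`. The hypothesis reads `la = ra * G`; multiplying `la * lb = -1` on
  -- the left by `rb` and using `rb * ra = -1` gives `rb = G * lb`.
  let G : S⟦X⟧ := 1 - X ^ 2 * PowerSeries.mk fun i => (i + 1) • x ^ i
  have hmul : ∀ a b : ℕ → S, ∀ m, coeff m (PowerSeries.mk a * PowerSeries.mk b) =
      ∑ p ∈ Finset.HasAntidiagonal.antidiagonal m, a p.1 * b p.2 := fun a b m => by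
    simp [coeff_mul]
  have hsucc : ∀ m, 2 ≤ m → (m - 2).succ = m - 1 := fun m hm => by omega
  have keyr : ∀ f : ℕ → S, ∀ m, coeff m (PowerSeries.mk f * G) =
      f m - ∑ i ∈ Finset.range (m - 1), (i + 1) • (f (m - 2 - i) * x ^ i) := fun f m => by
    rw [mul_sub, mul_one, map_sub, coeff_mk, ← mul_assoc, (commute_X_pow (PowerSeries.mk f) 2).eq,
      mul_assoc, coeff_X_pow_mul']
    congr 1
    split_ifs with h
    · rw [hmul, ← Finset.Nat.sum_antidiagonal_swap,
        Finset.Nat.sum_antidiagonal_eq_sum_range_succ_mk, hsucc m h]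
      exact Finset.sum_congr rfl fun i _ => by simp only [Prod.swap, mul_smul_comm]
    · rw [show m - 1 = 0 by omega]; simp
  have keyl : ∀ f : ℕ → S, ∀ m, coeff m (G * PowerSeries.mk f) =
      f m - ∑ i ∈ Finset.range (m - 1), (i + 1) • (x ^ i * f (m - 2 - i)) := fun f m => by
    rw [sub_mul, one_mul, map_sub, coeff_mk, mul_assoc, coeff_X_pow_mul']
    congr 1
    split_ifs with h
    · rw [hmul, Finset.Nat.sum_antidiagonal_eq_sum_range_succ_mk, hsucc m h]
      exact Finset.sum_congr rfl fun i _ => by rw [smul_mul_assoc]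
    · rw [show m - 1 = 0 by omega]; simp
  have hl' : PowerSeries.mk la * PowerSeries.mk lb = -1 := by
    ext m
    rw [hmul, hl, map_neg, coeff_one]; split_ifs <;> simp
  have hr' : PowerSeries.mk rb * PowerSeries.mk ra = -1 := by
    ext m
    rw [hmul, hr, map_neg, coeff_one]; split_ifs <;> simp
  have ha' : PowerSeries.mk la = PowerSeries.mk ra * G := by
    ext m
    rw [keyr, coeff_mk, ha]
  have hb : PowerSeries.mk rb = G * PowerSeries.mk lb := by
    have h := congrArg (PowerSeries.mk rb * ·) hl'
    simp only [ha', ← mul_assoc, hr'] at h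
    simpa using h.symm
  rw [← keyl, ← hb, coeff_mk]

end Series

namespace HeckeAction.Inversion

variable {𝒞 : Type w} [Category.{v} 𝒞] [Preadditive 𝒞]
variable {A : HeckeAction 𝒞} {k : ℕ}

/-- The clockwise bubble with an arbitrary integer number of dots. -/
def cwZ (_ : A.Inversion k) (P : A.CupCap) (n : ℤ) (Z : 𝒞) : Z ⟶ Z :=
  if 0 ≤ n then P.cw n.toNat Z else if n = k - 1 then -𝟙 Z else 0

/-- The counterclockwise bubble with an arbitrary integer number of dots. -/
def ccwZ (I : A.Inversion k) (P : A.CupCap) (n : ℤ) (Z : 𝒞) : Z ⟶ Z :=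
  if 0 ≤ n then P.ccw n.toNat Z else I.al (-n - 1).toNat Z

theorem cwZ_nat (I : A.Inversion k) (P : A.CupCap) (n : ℤ) {Z W : 𝒞} (f : Z ⟶ W) :
    f ≫ I.cwZ P n W = I.cwZ P n Z ≫ f := by
  unfold cwZ; split_ifs
  · exact P.cw_nat _ f
  · simp
  · simp

theorem ccwZ_nat (I : A.Inversion k) (P : A.CupCap) (n : ℤ) {Z W : 𝒞} (f : Z ⟶ W) :
    f ≫ I.ccwZ P n W = I.ccwZ P n Z ≫ f := by
  unfold ccwZ; split_ifs
  · exact P.ccw_nat _ f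
  · exact I.al_nat _ f

theorem cwZ_natCast (I : A.Inversion k) (P : A.CupCap) (n : ℕ) (Z : 𝒞) :
    I.cwZ P n Z = P.cw n Z := by
  simp [cwZ]

theorem ccwZ_natCast (I : A.Inversion k) (P : A.CupCap) (n : ℕ) (Z : 𝒞) :
    I.ccwZ P n Z = P.ccw n Z := by
  simp [ccwZ]

theorem ccwZ_neg (I : A.Inversion k) (P : A.CupCap) {n : ℤ} {r : ℕ} (h : n = -r - 1) (Z : 𝒞) :
    I.ccwZ P n Z = I.al r Z := by
  rw [ccwZ, if_neg (by omega)]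
  congr 1
  omega

theorem ccwZ_of_lt (I : A.Inversion k) (P : A.CupCap) {n : ℤ} (h : n < -k) (Z : 𝒞) :
    I.ccwZ P n Z = if n = -k - 1 then 𝟙 Z else 0 := by
  rw [I.ccwZ_neg P (r := (-n - 1).toNat) (by omega)]
  split_ifs with h1
  · rw [show (-n - 1).toNat = k by omega, al_self]
  · rw [al_of_lt]; omega

namespace IsLeftward

variable {I : A.Inversion k} {P : A.CupCap}

theorem cwZ_of_lt (h : I.IsLeftward P) {n : ℤ} (hn : n < k) (Z : 𝒞) :
    I.cwZ P n Z = if n = k - 1 then -𝟙 Z else 0 := by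
  rw [cwZ]
  split_ifs with h1 h2 h2
  · rw [h.cw_eq _ (by omega), if_pos (by omega)]
  · rw [h.cw_eq _ (by omega), if_neg (by omega)]
  · rfl
  · rfl

/-- The bubble with `-i - j - 2` dots is `al (i + j + 1)`, zero once `i + j ≥ k`. The sum over
diagonals thus becomes one over any square of side at least `k`, in the shape of the stated
relation. -/
theorem t_tp_eq (h : I.IsLeftward P) {N : ℕ} (hN : k ≤ N) (Z : 𝒞) : A.t Z ≫ P.tp Z = 𝟙 _ +
    ∑ i ∈ Finset.range N, ∑ j ∈ Finset.range N,
      A.dn j Z ≫ I.ccwZ P (-i - j - 2) Z ≫ P.cp i Z := by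
  rw [h.t_tp, sum_square_eq_sum_diag hN]
  · congr 1
    refine Finset.sum_congr rfl fun r _ => Finset.sum_congr rfl fun i hi => ?_
    have := Finset.mem_range.1 hi
    rw [I.ccwZ_neg P (r := r) (by omega)]
  · intro i j hij
    rw [I.ccwZ_of_lt P (by omega), if_neg (by omega)]
    simp

theorem altL_sub_altR_eq (h : I.IsLeftward P) {N : ℕ} (hN : k ≤ N) (Z : 𝒞) :
    P.altL Z - P.altR Z =
      ∑ i ∈ Finset.range N, ∑ j ∈ Finset.range N, ∑ n ∈ Finset.range N,
        A.dn j _ ≫ A.xp n Z ≫ I.ccwZ P (-i - j - n - 3) _ ≫ P.cp i _ := by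
  rw [h.altL_sub_altR]
  have h1 := sum_square_eq_sum_diag (k := k) (f := fun i b => ∑ j ∈ Finset.range b,
    A.dn (b - 1 - j) _ ≫ A.xp j Z ≫ I.al (i + b + 1) _ ≫ P.cp i (A.U.obj Z)) hN
    fun i b hib => by
      refine Finset.sum_eq_zero fun j _ => ?_
      rw [I.al_of_lt (by omega)]; simp
  refine (Finset.sum_congr rfl fun r hr => Finset.sum_congr rfl fun i hi =>
    Finset.sum_congr rfl fun j _ => ?_).trans (h1.symm.trans ?_)
  · have := Finset.mem_range.1 hi
    rw [show i + (r - 1 - i) + 1 = r by omega]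
  refine Finset.sum_congr rfl fun i _ => ?_
  rcases Nat.eq_zero_or_pos N with rfl | hN0
  · simp
  have h3 := sum_square_eq_sum_diag (k := N - 1) (N := N) (f := fun n j =>
    A.dn j _ ≫ A.xp n Z ≫ I.ccwZ P (-i - j - n - 3) (A.U.obj Z) ≫
      P.cp i (A.U.obj Z)) (by omega)
    fun n j hnj => by rw [I.ccwZ_of_lt P (by omega), if_neg (by omega)]; simp
  rw [Finset.sum_comm, h3, Nat.sub_add_cancel hN0]
  refine Finset.sum_congr rfl fun b _ => Finset.sum_congr rfl fun j hj => ?_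
  have := Finset.mem_range.1 hj
  rw [I.ccwZ_neg P (r := i + b + 1) (by omega)]

theorem curlL_eq_sum (h : I.IsLeftward P) (n : ℕ) {N : ℕ} (hN : n + k < N) (Z : 𝒞) :
    P.curlL n Z = ∑ m ∈ Finset.range N, A.xp m Z ≫ I.ccwZ P (n - m - 1) _ := by
  have h0 : ∑ m ∈ Finset.range N, A.xp m Z ≫ I.ccwZ P (n - m - 1) (A.U.obj Z) =
      ∑ m ∈ Finset.range (n + (k + 1)), A.xp m Z ≫ I.ccwZ P (n - m - 1) (A.U.obj Z) :=
    by
      refine sum_range_eq_of_le (by omega) fun i hi => ?_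
      rw [I.ccwZ_of_lt P (by omega), if_neg (by omega), Limits.comp_zero]
  rw [h.curlL_eq, h0, Finset.sum_range_add _ n, add_comm]
  congr 1
  · refine (Finset.sum_range_reflect (fun i => A.xp (n - 1 - i) Z ≫ P.ccw i (A.U.obj Z)) n).symm.trans
      (Finset.sum_congr rfl fun i hi => ?_)
    have := Finset.mem_range.1 hi
    rw [show n - 1 - (n - 1 - i) = i by omega, ← I.ccwZ_natCast P,
      show ((n - 1 - i : ℕ) : ℤ) = n - i - 1 by omega]
  · refine Finset.sum_congr rfl fun i hi => ?_
    rw [I.ccwZ_neg P (r := i) (by push_cast; ring)]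

theorem curlR_eq_sum (h : I.IsLeftward P) (n : ℕ) {N : ℕ} (hN : n < N) (Z : 𝒞) :
    P.curlR n Z = -∑ m ∈ Finset.range N, A.xp m Z ≫ A.U.map (I.cwZ P (n - m - 1) Z) := by
  have h0 : ∑ m ∈ Finset.range N, A.xp m Z ≫ A.U.map (I.cwZ P (n - m - 1) Z) =
      ∑ m ∈ Finset.range (n + 1), A.xp m Z ≫ A.U.map (I.cwZ P (n - m - 1) Z) :=
    by
      refine sum_range_eq_of_le (by omega) fun i hi => ?_
      rw [h.cwZ_of_lt (by omega), if_neg (by omega), Functor.map_zero, Limits.comp_zero]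
  -- The term `m = n` carries the clockwise bubble with `-1` dots, which is `-1` exactly when `k =
  -- 0`. It accounts for the separate power of the dot in `curlR_eq`.
  rw [h.curlR_eq, h0, Finset.sum_range_succ, h.cwZ_of_lt (n := (n : ℤ) - n - 1) (by omega),
    neg_add, ← sub_eq_neg_add]
  congr 1
  · by_cases hk : k = 0
    · rw [if_pos hk, if_pos (by omega), Functor.map_neg]; simp
    · rw [if_neg hk, if_neg (by omega)]; simp
  · refine Finset.sum_congr rfl fun i hi => ?_
    have := Finset.mem_range.1 hi
    rw [← I.cwZ_natCast P]
    congr 3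
    omega

theorem grassmannian_eq (h : I.IsLeftward P) (m : ℕ) (Z : 𝒞) :
    ∑ p ∈ Finset.HasAntidiagonal.antidiagonal m,
      I.cwZ P (p.1 + k - 1) Z ≫ I.ccwZ P (p.2 - k - 1) Z = if m = 0 then -𝟙 Z else 0 := by
  rcases m with _ | n
  · simp [h.cwZ_of_lt, I.ccwZ_of_lt]
  · rw [if_neg (by omega), Finset.Nat.sum_antidiagonal_eq_sum_range_succ_mk,
      ← Finset.sum_range_reflect]
    -- The sum is indexed by the counterclockwise factor and lengthened by vanishing terms. Its
    -- first `k + 1` terms have negative dot number there; the last one pairs the bubble with `n`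
    -- dots with the clockwise bubble of `-1` dots, which yields the case distinction in
    -- `grassmannian`.
    have h1 : ∑ j ∈ Finset.range (n + 1 + 1), I.cwZ P (((n + 1 + 1 - 1 - j : ℕ) : ℤ) + k - 1) Z ≫
        I.ccwZ P (((n + 1 - (n + 1 + 1 - 1 - j) : ℕ) : ℤ) - k - 1) Z =
        ∑ j ∈ Finset.range (k + 1 + (n + 1)), I.cwZ P ((n : ℤ) + k - j) Z ≫
          I.ccwZ P ((j : ℤ) - k - 1) Z := by
      rw [sum_range_eq_of_le (m := n + 1 + 1) (n := k + 1 + (n + 1)) (by omega)]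
      · refine Finset.sum_congr rfl fun j hj => ?_
        have := Finset.mem_range.1 hj
        congr 2 <;> omega
      · intro i hi
        rw [h.cwZ_of_lt (by omega), if_neg (by omega)]
        simp
    refine Eq.trans h1 ?_
    rw [Finset.sum_range_add, ← Finset.sum_range_reflect, Finset.sum_range_succ _ n,
      h.cwZ_of_lt (n := (n : ℤ) + k - (k + 1 + n : ℕ)) (by omega)]
    have h2 := h.grassmannian n Z
    have h3 : ∀ j ∈ Finset.range (k + 1), I.cwZ P ((n : ℤ) + k - (k + 1 - 1 - j : ℕ)) Z ≫
        I.ccwZ P (((k + 1 - 1 - j : ℕ) : ℤ) - k - 1) Z = P.cw (n + j) Z ≫ I.al j Z := by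
      intro j hj
      have := Finset.mem_range.1 hj
      rw [I.ccwZ_neg P (r := j) (by omega), ← I.cwZ_natCast P]
      congr 2
      omega
    have h4 : ∀ j ∈ Finset.range n, I.cwZ P ((n : ℤ) + k - (k + 1 + j : ℕ)) Z ≫
        I.ccwZ P (((k + 1 + j : ℕ) : ℤ) - k - 1) Z = P.cw (n - 1 - j) Z ≫ P.ccw j Z := by
      intro j hj
      have := Finset.mem_range.1 hj
      rw [← I.ccwZ_natCast P, ← I.cwZ_natCast P]
      congr 2 <;> omega
    rw [Finset.sum_congr rfl h3, Finset.sum_congr rfl h4, ← add_assoc, ← h2]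
    have h5 : (((k + 1 + n : ℕ) : ℤ) - k - 1) = n := by omega
    rw [h5, I.ccwZ_natCast]
    by_cases hk : k = 0
    · rw [if_pos hk, if_pos (by omega)]; simp
    · rw [if_neg hk, if_neg (by omega)]; simp

theorem cwZ_slide (h : I.IsLeftward P) (n : ℤ) {N : ℕ} (hN : n ≤ N) (Z : 𝒞) :
    I.cwZ P n (A.U.obj Z) = A.U.map (I.cwZ P n Z) -
      ∑ m ∈ Finset.range N, (m + 1) • (A.xp m Z ≫ A.U.map (I.cwZ P (n - m - 2) Z)) := by
  have hz : ∀ m : ℕ, n ≤ m → (m + 1) • (A.xp m Z ≫ A.U.map (I.cwZ P (n - m - 2) Z)) = 0 :=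
    fun m hm => by
      rw [h.cwZ_of_lt (by omega), if_neg (by omega), Functor.map_zero, Limits.comp_zero,
        smul_zero]
  rcases lt_or_ge n 0 with h0 | h0
  · rw [Finset.sum_eq_zero fun m _ => hz m (by omega), sub_zero, h.cwZ_of_lt (by omega),
      h.cwZ_of_lt (by omega)]
    split_ifs
    · simp
    · simp
  · lift n to ℕ using h0
    -- Once the curls are expanded, the term with `m` dots on the strand occurs for every
    -- decomposition `m = i + l`; this is the coefficient `m + 1`.
    have hR : ∀ i ∈ Finset.range n, P.curlR (n - 1 - i) Z ≫ A.xp i Z =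
        -∑ l ∈ Finset.range (n - i), A.xp (i + l) Z ≫ A.U.map (I.cwZ P (n - (i + l : ℕ) - 2) Z) :=
      fun i hi => by
        have := Finset.mem_range.1 hi
        rw [h.curlR_eq_sum _ (N := n - i) (by omega), Preadditive.neg_comp, Preadditive.sum_comp]
        congr 1
        refine Finset.sum_congr rfl fun l _ => ?_
        rw [Category.assoc, A.xp_nat, ← Category.assoc, ← A.xp_add, Nat.add_comm l i,
          show ((n - 1 - i : ℕ) : ℤ) - l - 1 = n - (i + l : ℕ) - 2 by omega]
    rw [sum_range_eq_of_le (m := n) (by omega) fun i hi => hz i (by omega), I.cwZ_natCast,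
      I.cwZ_natCast, h.cw_slide, Finset.sum_congr rfl hR, Finset.sum_neg_distrib,
      ← Finset.sum_range_diag_flip n fun i l =>
        A.xp (i + l) Z ≫ A.U.map (I.cwZ P (n - (i + l : ℕ) - 2) Z), sub_eq_add_neg]
    congr 2
    refine Finset.sum_congr rfl fun m _ => ?_
    rw [Finset.sum_congr rfl (g := fun _ => A.xp m Z ≫ A.U.map (I.cwZ P (n - m - 2) Z)),
      Finset.sum_const, Finset.card_range]
    intro i hi
    have := Finset.mem_range.1 hi
    rw [show i + (m - i) = m by omega]

theorem xp_eq_pow (A : HeckeAction 𝒞) (n : ℕ) (Z : 𝒞) :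
    A.xp n Z = (show End (A.U.obj Z) from A.x Z) ^ n := by
  induction n with
  | zero => rfl
  | succ n ih => rw [pow_succ', xp_succ, ih]; rfl

/-- The Grassmannian relation holds for the bubbles on either side of the strand, so the slide of
one series determines that of its inverse. -/
theorem ccwZ_slide (h : I.IsLeftward P) (n : ℤ) {N : ℕ} (hN : n + k < N) (Z : 𝒞) :
    A.U.map (I.ccwZ P n Z) = I.ccwZ P n (A.U.obj Z) -
      ∑ m ∈ Finset.range N, (m + 1) • (A.xp m Z ≫ I.ccwZ P (n - m - 2) (A.U.obj Z)) := by
  have hz : ∀ m : ℕ, n + k ≤ m →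
      (m + 1) • (A.xp m Z ≫ I.ccwZ P (n - m - 2) (A.U.obj Z)) = 0 := fun m hm => by
    rw [I.ccwZ_of_lt P (by omega), if_neg (by omega), Limits.comp_zero, smul_zero]
  rcases lt_or_ge n (-k - 1) with h0 | h0
  · rw [Finset.sum_eq_zero fun m _ => hz m (by omega), sub_zero, I.ccwZ_of_lt P (by omega),
      I.ccwZ_of_lt P (by omega), if_neg (by omega), if_neg (by omega), Functor.map_zero]
  obtain ⟨m, rfl⟩ : ∃ m : ℕ, n = m - k - 1 := ⟨(n + k + 1).toNat, by omega⟩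
  have hs := slide_of_slide (S := End (A.U.obj Z))
    (fun m => I.cwZ P (m + k - 1) (A.U.obj Z)) (fun m => I.ccwZ P (m - k - 1) (A.U.obj Z))
    (fun m => A.U.map (I.cwZ P (m + k - 1) Z)) (fun m => A.U.map (I.ccwZ P (m - k - 1) Z))
    (A.x Z) (fun m => ?_) (fun m => ?_) (fun m => ?_) m
  · refine hs.trans ?_
    rw [sum_range_eq_of_le (m := m - 1) (n := N) (by omega) fun i hi => hz i (by omega)]
    congr 1
    refine Finset.sum_congr rfl fun i hi => ?_
    have := Finset.mem_range.1 hi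
    rw [I.ccwZ_nat, show ((m : ℤ) - k - 1 - i - 2) = ((m - 2 - i : ℕ) : ℤ) - k - 1 by omega,
      xp_eq_pow]
    rfl
  · refine Eq.trans ?_ (h.grassmannian_eq m (A.U.obj Z))
    exact Finset.sum_congr rfl fun p _ => I.cwZ_nat P _ _
  · have h1 := congrArg A.U.map (h.grassmannian_eq m Z)
    rw [Functor.map_sum, ← Finset.Nat.sum_antidiagonal_swap] at h1
    refine Eq.trans ?_ (h1.trans ?_)
    · exact Finset.sum_congr rfl fun p _ => (A.U.map_comp _ _).symm
    · split_ifs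
      · rw [Functor.map_neg, A.U.map_id]; rfl
      · exact A.U.map_zero _ _
  · refine (h.cwZ_slide (m + k - 1) (N := m + k) (by omega) Z).trans ?_
    rw [sum_range_eq_of_le (m := m - 1) (by omega)]
    · congr 1
      refine Finset.sum_congr rfl fun i hi => ?_
      have := Finset.mem_range.1 hi
      rw [show ((m : ℤ) + k - 1 - i - 2) = ((m - 2 - i : ℕ) : ℤ) + k - 1 by omega, xp_eq_pow]
      rfl
    · intro i hi
      rw [h.cwZ_of_lt (by omega), if_neg (by omega), Functor.map_zero, Limits.comp_zero,
        smul_zero]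

end IsLeftward

end HeckeAction.Inversion
end Heisenberg

/-! ### The defining relations as equations of morphisms. -/

namespace Heisenberg

namespace Heis

variable {R : Type u} [CommRing R] {k : ℤ}

theorem mk'_sum {a b : Word} {n : ℕ} (f : Fin n → Diag R k a b) :
    mk' (Diag.sum f) = ∑ i, mk' (f i) := by
  induction n with
  | zero => rfl
  | succ n ih =>
    rw [Fin.sum_univ_succ, ← ih]; rfl

theorem xPow_zero : (xPow 0 : (up : Heis R k) ⟶ up) = 𝟙 _ := rfl

theorem xPow_succ (n : ℕ) : (xPow (n + 1) : (up : Heis R k) ⟶ up) = xPow n ≫ x :=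
  pow_succ' (show End (up : Heis R k) from x) n

theorem mk'_npow (n : ℕ) : mk' (Diag.x.npow n) = (xPow n : (up : Heis R k) ⟶ up) := by
  induction n with
  | zero => rfl
  | succ n ih =>
    rw [xPow_succ, ← ih]; rfl

theorem cDot_eq_mk' (n : ℕ) :
    (cDot n : 𝟙_ (Heis R k) ⟶ down ⊗ up) = mk' (Diag.cDot n) := by
  rw [cDot, ← mk'_npow]; rfl

theorem dDot_eq_mk' (n : ℕ) :
    (dDot n : (up ⊗ down : Heis R k) ⟶ 𝟙_ (Heis R k)) = mk' (Diag.dDot n) := by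
  rw [dDot, ← mk'_npow]; rfl

/-- The structure isomorphisms inserted by `⊗≫` are identities, so only unit laws and associativity
separate the two composites. -/
theorem t_eq_mk' : (t : (up ⊗ down : Heis R k) ⟶ down ⊗ up) = mk' Diag.t := by
  have h : (t : (up ⊗ down : Heis R k) ⟶ down ⊗ up) =
      (λ_ (up ⊗ down)).inv ≫ c ▷ (up ⊗ down) ≫ (α_ down up (up ⊗ down)).hom ≫
        down ◁ (α_ up up down).inv ≫
        down ◁ s ▷ down ≫ down ◁ (α_ up up down).hom ≫ (α_ down up (up ⊗ down)).inv ≫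
        (down ⊗ up) ◁ d ≫ (ρ_ (down ⊗ up)).hom := by
    rw [t]; monoidal
  have h1 : (down ◁ (α_ up up down).inv : (down ⊗ up ⊗ up ⊗ down : Heis R k) ⟶ _) = 𝟙 _ := by
    change down ◁ 𝟙 _ = _
    exact whiskerLeft_id ..
  have h2 : (down ◁ (α_ up up down).hom : (down ⊗ (up ⊗ up) ⊗ down : Heis R k) ⟶ _) = 𝟙 _ := by
    change down ◁ 𝟙 _ = _
    exact whiskerLeft_id ..
  rw [h, h1, h2]
  refine Quot.sound ?_
  exact Rel.trans (Rel.id_comp _) <| Rel.trans (Rel.comp_congr (Rel.refl _) <|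
    Rel.trans (Rel.id_comp _) <| Rel.trans (Rel.id_comp _) <| Rel.comp_congr (Rel.refl _) <|
    Rel.trans (Rel.id_comp _) <| Rel.trans (Rel.id_comp _) <| Rel.comp_id _)
    (Rel.comp_assoc _ _ _).symm

theorem s_s : (s : (up ⊗ up : Heis R k) ⟶ up ⊗ up) ≫ s = 𝟙 _ := Quot.sound Rel.cross_cross

theorem s_x : (s : (up ⊗ up : Heis R k) ⟶ up ⊗ up) ≫ x ▷ up = up ◁ x ≫ s + 𝟙 _ :=
  Quot.sound Rel.dot_cross

theorem braid : (s ▷ up ≫ (α_ _ _ _).hom ≫ up ◁ s ≫ (α_ _ _ _).inv ≫ s ▷ up :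
      ((up ⊗ up) ⊗ up : Heis R k) ⟶ _) = (α_ _ _ _).hom ≫ up ◁ s ≫ (α_ _ _ _).inv ≫ s ▷ up ≫
        (α_ _ _ _).hom ≫ up ◁ s ≫ (α_ _ _ _).inv := by
  refine Quot.sound ?_
  refine Rel.trans (Rel.comp_congr (Rel.refl _) <| Rel.trans (Rel.id_comp _) <|
    Rel.comp_congr (Rel.refl _) (Rel.id_comp _)) ?_
  refine Rel.trans (Rel.comp_assoc _ _ _).symm (Rel.trans Rel.braid ?_)
  refine Rel.trans (Rel.comp_assoc _ _ _) (Rel.trans ?_ (Rel.id_comp _).symm)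
  refine Rel.comp_congr (Rel.refl _) (Rel.trans ?_ (Rel.id_comp _).symm)
  exact Rel.comp_congr (Rel.refl _) (Rel.trans (Rel.comp_id _).symm (Rel.id_comp _).symm)

theorem zigzag_up : (up ◁ c ≫ (α_ _ _ _).inv ≫ d ▷ up : (up ⊗ 𝟙_ (Heis R k)) ⟶ _) =
    (ρ_ _).hom ≫ (λ_ _).inv := by
  refine Quot.sound ?_
  refine Rel.trans (Rel.comp_congr (Rel.refl _) (Rel.id_comp _)) ?_
  exact Rel.trans Rel.zigzag_up (Rel.id_comp _).symm

theorem zigzag_down : (c ▷ down ≫ (α_ _ _ _).hom ≫ down ◁ d : (𝟙_ (Heis R k) ⊗ down) ⟶ _) =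
    (λ_ _).hom ≫ (ρ_ _).inv := by
  refine Quot.sound ?_
  refine Rel.trans (Rel.comp_congr (Rel.refl _) (Rel.id_comp _)) ?_
  exact Rel.trans Rel.zigzag_down (Rel.id_comp _).symm

/-- The adjoined morphism `↓ ⊗ ↑ ⟶ ↑ ⊗ ↓`. -/
def tInv : (down ⊗ up : Heis R k) ⟶ up ⊗ down := mk' Diag.tInv

/-- The adjoined cups. -/
def cupInv (r : ℕ) : 𝟙_ (Heis R k) ⟶ up ⊗ down :=
  if h : r < k.toNat then mk' (Diag.cupInv ⟨r, h⟩) else 0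

/-- The adjoined caps. -/
def capInv (r : ℕ) : (down ⊗ up : Heis R k) ⟶ 𝟙_ (Heis R k) :=
  if h : r < (-k).toNat then mk' (Diag.capInv ⟨r, h⟩) else 0

theorem t_tInv : (t : (up ⊗ down : Heis R k) ⟶ _) ≫ tInv +
    ∑ r ∈ Finset.range k.toNat, dDot r ≫ cupInv r = 𝟙 _ := by
  have h := Quot.sound (Rel.t_tInv (R := R) (k := k))
  change mk' Diag.t ≫ mk' Diag.tInv + mk' (Diag.sum _) = 𝟙 _ at h
  rw [mk'_sum] at h
  rw [Finset.sum_range, t_eq_mk']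
  refine Eq.trans ?_ h
  congr 1
  refine Finset.sum_congr rfl fun i _ => ?_
  rw [cupInv, dif_pos i.2, dDot_eq_mk']
  rfl

theorem tInv_t : tInv ≫ (t : (up ⊗ down : Heis R k) ⟶ _) +
    ∑ r ∈ Finset.range (-k).toNat, capInv r ≫ cDot r = 𝟙 _ := by
  have h := Quot.sound (Rel.tInv_t (R := R) (k := k))
  change mk' Diag.tInv ≫ mk' Diag.t + mk' (Diag.sum _) = 𝟙 _ at h
  rw [mk'_sum] at h
  rw [Finset.sum_range, t_eq_mk']
  refine Eq.trans ?_ h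
  congr 1
  refine Finset.sum_congr rfl fun i _ => ?_
  rw [capInv, dif_pos i.2, cDot_eq_mk']
  rfl

theorem t_capInv {r : ℕ} (hr : r < (-k).toNat) :
    (t : (up ⊗ down : Heis R k) ⟶ _) ≫ capInv r = 0 := by
  rw [t_eq_mk', capInv, dif_pos hr]
  exact Quot.sound (Rel.t_capInv _)

theorem cDot_tInv {r : ℕ} (hr : r < (-k).toNat) :
    (cDot r : 𝟙_ (Heis R k) ⟶ _) ≫ tInv = 0 := by
  rw [cDot_eq_mk']
  exact Quot.sound (Rel.cDot_tInv ⟨r, hr⟩)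

theorem cDot_capInv {r r' : ℕ} (hr : r < (-k).toNat) (hr' : r' < (-k).toNat) :
    (cDot r : 𝟙_ (Heis R k) ⟶ _) ≫ capInv r' = if r = r' then 𝟙 _ else 0 := by
  rw [cDot_eq_mk', capInv, dif_pos hr']
  refine (Quot.sound (Rel.cDot_capInv ⟨r, hr⟩ ⟨r', hr'⟩)).trans ?_
  simp only [Fin.mk.injEq]
  split_ifs <;> rfl

theorem tInv_dDot {r : ℕ} (hr : r < k.toNat) :
    tInv ≫ (dDot r : _ ⟶ 𝟙_ (Heis R k)) = 0 := by
  rw [dDot_eq_mk']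
  exact Quot.sound (Rel.tInv_dDot ⟨r, hr⟩)

theorem cupInv_t {r : ℕ} (hr : r < k.toNat) :
    cupInv r ≫ (t : (up ⊗ down : Heis R k) ⟶ _) = 0 := by
  rw [t_eq_mk', cupInv, dif_pos hr]
  exact Quot.sound (Rel.cupInv_t _)

theorem cupInv_dDot {r r' : ℕ} (hr : r < k.toNat) (hr' : r' < k.toNat) :
    cupInv r ≫ (dDot r' : _ ⟶ 𝟙_ (Heis R k)) = if r = r' then 𝟙 _ else 0 := by
  rw [dDot_eq_mk', cupInv, dif_pos hr]
  refine (Quot.sound (Rel.cupInv_dDot ⟨r, hr⟩ ⟨r', hr'⟩)).trans ?_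
  simp only [Fin.mk.injEq]
  split_ifs <;> rfl

end Heis
end Heisenberg

/-! ### The action by tensoring on the left, and its dictionary with diagrams. -/

namespace Heisenberg

namespace Heis

variable {R : Type u} [CommRing R] {k : ℤ}

/-- The Heisenberg category acts on itself by tensoring on the left. -/
noncomputable def leftAction (R : Type u) [CommRing R] (k : ℤ) : HeckeAction (Heis R k) where
  U := tensorLeft up
  D := tensorLeft down
  x Z := x ▷ Z
  s Z := (α_ _ _ _).inv ≫ s ▷ Z ≫ (α_ _ _ _).hom
  c Z := (λ_ Z).inv ≫ c ▷ Z ≫ (α_ _ _ _).hom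
  d Z := (α_ _ _ _).inv ≫ d ▷ Z ≫ (λ_ Z).hom
  x_nat f := whisker_exchange _ _
  s_nat f := by
    dsimp [tensorLeft]
    have h := congrArg (fun f => (α_ up up _).inv ≫ f ≫ (α_ up up _).hom) (whisker_exchange s f)
    refine Eq.trans ?_ (h.trans ?_)
    · monoidal
    · monoidal
  c_nat f := by
    dsimp [tensorLeft]
    have h := congrArg (fun f => (λ_ _).inv ≫ f ≫ (α_ down up _).hom) (whisker_exchange c f)
    refine Eq.trans ?_ (h.trans ?_)
    · monoidal
    · monoidal
  d_nat f := by
    dsimp [tensorLeft]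
    have h := congrArg (fun f => (α_ up down _).inv ≫ f ≫ (λ_ _).hom) (whisker_exchange d f)
    refine Eq.trans ?_ (h.trans ?_)
    · monoidal
    · monoidal
  s_s Z := by
    dsimp [tensorLeft]
    simp [← comp_whiskerRight_assoc, s_s]
  braid Z := by
    dsimp [tensorLeft]
    have h := congrArg (fun f => (α_ up up (up ⊗ Z)).inv ≫ (α_ (up ⊗ up) up Z).inv ≫ f ▷ Z ≫
      (α_ (up ⊗ up) up Z).hom ≫ (α_ up up (up ⊗ Z)).hom) (braid (R := R) (k := k))
    refine Eq.trans ?_ (h.trans ?_)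
    · monoidal
    · monoidal
  s_x Z := by
    dsimp [tensorLeft]
    have h := congrArg (fun f => (α_ up up Z).inv ≫ f ▷ Z ≫
      (α_ up up Z).hom) (s_x (R := R) (k := k))
    simp only [MonoidalPreadditive.add_whiskerRight, Preadditive.comp_add,
      Preadditive.add_comp] at h
    refine Eq.trans ?_ (h.trans ?_)
    · monoidal
    · congr 1 <;> monoidal
  zigzag_up Z := by
    dsimp [tensorLeft]
    have h := congrArg (fun f => (up ◁ (λ_ Z).inv) ≫ (α_ up (𝟙_ _) Z).inv ≫ f ▷ Z ≫
      (α_ _ up Z).hom ≫ (λ_ _).hom) (zigzag_up (R := R) (k := k))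
    refine Eq.trans ?_ (h.trans ?_)
    · monoidal
    · monoidal
  zigzag_down Z := by
    dsimp [tensorLeft]
    have h := congrArg (fun f => (λ_ _).inv ≫ (α_ (𝟙_ _) down Z).inv ≫ f ▷ Z ≫
      (α_ _ _ Z).hom ≫ down ◁ (λ_ _).hom) (zigzag_down (R := R) (k := k))
    refine Eq.trans ?_ (h.trans ?_)
    · monoidal
    · monoidal

/-- A leftward cup and cap act on the left. -/
noncomputable def leftPair (c' : 𝟙_ (Heis R k) ⟶ up ⊗ down)
    (d' : (down ⊗ up : Heis R k) ⟶ 𝟙_ (Heis R k)) : (leftAction R k).CupCap where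
  p Z := (λ_ Z).inv ≫ c' ▷ Z ≫ (α_ _ _ _).hom
  q Z := (α_ _ _ _).inv ≫ d' ▷ Z ≫ (λ_ Z).hom
  p_nat f := by
    dsimp [leftAction, tensorLeft]
    have h := congrArg (fun f => (λ_ _).inv ≫ f ≫ (α_ up down _).hom) (whisker_exchange c' f)
    refine Eq.trans ?_ (h.trans ?_)
    · monoidal
    · monoidal
  q_nat f := by
    dsimp [leftAction, tensorLeft]
    have h := congrArg (fun f => (α_ down up _).inv ≫ f ≫ (λ_ _).hom) (whisker_exchange d' f)
    refine Eq.trans ?_ (h.trans ?_)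
    · monoidal
    · monoidal

theorem left_xp (n : ℕ) (Z : Heis R k) : (leftAction R k).xp n Z = xPow n ▷ Z := by
  induction n with
  | zero => exact (id_whiskerRight _ _).symm
  | succ n ih => rw [HeckeAction.xp_succ, ih, xPow_succ, comp_whiskerRight]; rfl

/-- This and the following lemmas are a dictionary: each natural transformation built from the
action is the diagram of the same name, whiskered by `Z`. -/
theorem left_dn (n : ℕ) (Z : Heis R k) :
    (leftAction R k).dn n Z = (α_ _ _ _).inv ≫ dDot n ▷ Z ≫ (λ_ Z).hom := by
  rw [HeckeAction.dn, left_xp, dDot]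
  dsimp [leftAction, tensorLeft]
  monoidal

theorem left_t (Z : Heis R k) :
    (leftAction R k).t Z = (α_ _ _ _).inv ≫ t ▷ Z ≫ (α_ _ _ _).hom := by
  rw [HeckeAction.t, t]
  dsimp [leftAction, tensorLeft]
  monoidal

theorem left_y (Z : Heis R k) : (leftAction R k).y Z = xRight ▷ Z := by
  rw [HeckeAction.y, xRight]
  dsimp [leftAction, tensorLeft]
  monoidal

theorem left_sR (Z : Heis R k) :
    (leftAction R k).sR Z = (α_ _ _ _).inv ≫ sRight ▷ Z ≫ (α_ _ _ _).hom := by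
  rw [HeckeAction.sR, HeckeAction.t, sRight]
  dsimp [leftAction, tensorLeft]
  monoidal

section

variable (c' : 𝟙_ (Heis R k) ⟶ up ⊗ down) (d' : (down ⊗ up : Heis R k) ⟶ 𝟙_ (Heis R k))

theorem left_cp (n : ℕ) (Z : Heis R k) :
    (leftPair c' d').cp n Z = (λ_ Z).inv ≫ cDot' c' n ▷ Z ≫ (α_ _ _ _).hom := by
  rw [HeckeAction.CupCap.cp, left_xp, cDot']
  dsimp [leftAction, leftPair, tensorLeft]
  monoidal

theorem left_dq (n : ℕ) (Z : Heis R k) :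
    (leftPair c' d').dq n Z = (α_ _ _ _).inv ≫ dDot' d' n ▷ Z ≫ (λ_ Z).hom := by
  rw [HeckeAction.CupCap.dq, left_xp, dDot']
  dsimp [leftAction, leftPair, tensorLeft]
  monoidal

theorem left_cw (n : ℕ) (Z : Heis R k) :
    (leftPair c' d').cw n Z = (λ_ Z).inv ≫ (c' ≫ dDot n) ▷ Z ≫ (λ_ Z).hom := by
  rw [HeckeAction.CupCap.cw, left_dn]
  dsimp [leftAction, leftPair, tensorLeft]
  monoidal

theorem left_ccw (n : ℕ) (Z : Heis R k) :
    (leftPair c' d').ccw n Z = (λ_ Z).inv ≫ (c ≫ dDot' d' n) ▷ Z ≫ (λ_ Z).hom := by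
  rw [HeckeAction.CupCap.ccw, left_dq]
  dsimp [leftAction, leftPair, tensorLeft]
  monoidal

theorem left_tp (Z : Heis R k) :
    (leftPair c' d').tp Z = (α_ _ _ _).inv ≫ t' c' d' ▷ Z ≫ (α_ _ _ _).hom := by
  rw [HeckeAction.CupCap.tp, t']
  dsimp [leftAction, leftPair, tensorLeft]
  monoidal

theorem left_curlR (n : ℕ) (Z : Heis R k) :
    (leftPair c' d').curlR n Z = curlRight c' n ▷ Z := by
  rw [HeckeAction.CupCap.curlR, left_dn, curlRight]
  dsimp [leftAction, leftPair, tensorLeft]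
  monoidal

theorem left_curlL (n : ℕ) (Z : Heis R k) :
    (leftPair c' d').curlL n Z = curlLeft d' n ▷ Z := by
  rw [HeckeAction.CupCap.curlL, left_dq, curlLeft]
  dsimp [leftAction, leftPair, tensorLeft]
  monoidal

theorem left_sL (Z : Heis R k) :
    (leftPair c' d').sL Z = (α_ _ _ _).inv ≫ sLeft c' d' ▷ Z ≫ (α_ _ _ _).hom := by
  rw [HeckeAction.CupCap.sL, sLeft]
  dsimp [leftAction, leftPair, tensorLeft]
  monoidal

theorem left_yL (Z : Heis R k) : (leftPair c' d').yL Z = xLeft c' d' ▷ Z := by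
  rw [HeckeAction.CupCap.yL, xLeft]
  dsimp [leftAction, leftPair, tensorLeft]
  monoidal

theorem left_altL (Z : Heis R k) : (leftPair c' d').altL Z =
    up ◁ (α_ _ _ _).inv ≫ (α_ _ _ _).inv ≫ altLeft c' d' ▷ Z ≫ (α_ _ _ _).hom ≫
      up ◁ (α_ _ _ _).hom := by
  rw [HeckeAction.CupCap.altL, left_tp, left_t, altLeft]
  dsimp [leftAction, leftPair, tensorLeft]
  monoidal

theorem left_altR (Z : Heis R k) : (leftPair c' d').altR Z =
    up ◁ (α_ _ _ _).inv ≫ (α_ _ _ _).inv ≫ altRight c' d' ▷ Z ≫ (α_ _ _ _).hom ≫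
      up ◁ (α_ _ _ _).hom := by
  rw [HeckeAction.CupCap.altR, left_tp, left_t, altRight]
  dsimp [leftAction, leftPair, tensorLeft]
  monoidal

end

end Heis
end Heisenberg

/-! ### All relations for nonnegative charge. -/

namespace Heisenberg

namespace Heis

variable {R : Type u} [CommRing R] {k : ℤ}

/-- The relations between a leftward cup and cap and sequences of clockwise bubbles `a` and
counterclockwise bubbles `b`. -/
structure Relations (c' : 𝟙_ (Heis R k) ⟶ up ⊗ down) (d' : (down ⊗ up : Heis R k) ⟶ 𝟙_ (Heis R k))
    (a b : ℤ → (𝟙_ (Heis R k) ⟶ 𝟙_ (Heis R k))) : Prop where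
  a_natCast (n : ℕ) : a n = c' ≫ dDot n
  b_natCast (n : ℕ) : b n = c ≫ dDot' d' n
  a_of_lt (n : ℤ) (hn : n < k) : a n = if n = k - 1 then -𝟙 _ else 0
  b_of_lt (n : ℤ) (hn : n < -k) : b n = if n = -k - 1 then 𝟙 _ else 0
  grassmannian (m : ℕ) : ∑ p ∈ Finset.HasAntidiagonal.antidiagonal m,
    a (p.1 + k - 1) ≫ b (p.2 - k - 1) = if m = 0 then -𝟙 _ else 0
  t_t' (N : ℕ) (hN : k.natAbs ≤ N) : t ≫ t' c' d' = 𝟙 _ +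
    ∑ i ∈ Finset.range N, ∑ j ∈ Finset.range N, dDot j ≫ b (-i - j - 2) ≫ cDot' c' i
  t'_t (N : ℕ) (hN : k.natAbs ≤ N) : t' c' d' ≫ t = 𝟙 _ +
    ∑ i ∈ Finset.range N, ∑ j ∈ Finset.range N, dDot' d' i ≫ a (-i - j - 2) ≫ cDot j
  zigzag_up' : c' ▷ up ≫ (α_ _ _ _).hom ≫ up ◁ d' = (λ_ _).hom ≫ (ρ_ _).inv
  zigzag_down' : down ◁ c' ≫ (α_ _ _ _).inv ≫ d' ▷ down = (ρ_ _).hom ≫ (λ_ _).inv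
  xRight_eq : xRight = xLeft c' d'
  sRight_eq : sRight = sLeft c' d'
  curlLeft_eq (n N : ℕ) (hN : n + k.natAbs < N) :
    curlLeft d' n = ∑ m ∈ Finset.range N, bubbleLeft (b (n - m - 1)) (xPow m)
  curlRight_eq (n N : ℕ) (hN : n + k.natAbs < N) :
    curlRight c' n = -∑ m ∈ Finset.range N, bubbleRight (xPow m) (a (n - m - 1))
  slide_b (n : ℤ) (N : ℕ) (hN : n + k.natAbs < N) : bubbleRight (𝟙 up) (b n) =
    bubbleLeft (b n) (𝟙 up) -
      ∑ m ∈ Finset.range N, (m + 1) • bubbleLeft (b (n - m - 2)) (xPow m)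
  slide_a (n : ℤ) (N : ℕ) (hN : n + k.natAbs < N) : bubbleLeft (a n) (𝟙 up) =
    bubbleRight (𝟙 up) (a n) -
      ∑ m ∈ Finset.range N, (m + 1) • bubbleRight (xPow m) (a (n - m - 2))
  alt_of_nonneg (hk : 0 ≤ k) (N : ℕ) (hN : k.natAbs ≤ N) : altLeft c' d' - altRight c' d' =
    ∑ i ∈ Finset.range N, ∑ j ∈ Finset.range N, ∑ n ∈ Finset.range N,
      bubbleLeft (b (-i - j - n - 3)) (𝟙 _ ⊗≫ ((dDot j ≫ cDot' c' i) ⊗ₘ xPow n) ⊗≫ 𝟙 _)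
  alt_of_nonpos (hk : k ≤ 0) (N : ℕ) (hN : k.natAbs ≤ N) : altLeft c' d' - altRight c' d' =
    ∑ i ∈ Finset.range N, ∑ j ∈ Finset.range N, ∑ n ∈ Finset.range N,
      bubbleRight (xPow n ⊗ₘ (dDot' d' j ≫ cDot i)) (a (-i - j - n - 3))
  tInv_eq : tInv = t' c' d'
  cupInv_eq (r : ℕ) : ∃ (N : ℕ) (f : ℕ → (𝟙_ (Heis R k) ⟶ 𝟙_ (Heis R k))),
    cupInv r = ∑ i ∈ Finset.range N, f i ≫ cDot' c' i
  capInv_eq (r : ℕ) : ∃ (N : ℕ) (f : ℕ → (𝟙_ (Heis R k) ⟶ 𝟙_ (Heis R k))),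
    capInv r = ∑ i ∈ Finset.range N, dDot' d' i ≫ f i

/-- For `k ≥ 0`, the inverse of the column `[t, d₀, …, d_{k-1}]` acts on the left. -/
noncomputable def leftInversion (hk : 0 ≤ k) : (leftAction R k).Inversion k.toNat where
  T Z := (α_ _ _ _).inv ≫ tInv ▷ Z ≫ (α_ _ _ _).hom
  E r Z := (λ_ Z).inv ≫ cupInv r ▷ Z ≫ (α_ _ _ _).hom
  T_nat f := by
    dsimp [leftAction, tensorLeft]
    have h := congrArg (fun f => (α_ _ _ _).inv ≫ f ≫ (α_ up down _).hom) (whisker_exchange tInv f)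
    refine Eq.trans ?_ (h.trans ?_)
    · monoidal
    · monoidal
  E_nat r _ _ f := by
    dsimp [leftAction, tensorLeft]
    have h := congrArg (fun f => (λ_ _).inv ≫ f ≫ (α_ up down _).hom)
      (whisker_exchange (cupInv r) f)
    refine Eq.trans ?_ (h.trans ?_)
    · monoidal
    · monoidal
  t_T Z := by
    have h := congrArg (fun f => (α_ up down Z).inv ≫ f ▷ Z ≫ (α_ up down Z).hom)
      (t_tInv (R := R) (k := k))
    simp only [left_t, left_dn]
    dsimp [leftAction, tensorLeft]
    simp [MonoidalPreadditive.add_whiskerRight, sum_whiskerRight, Preadditive.comp_sum,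
      Preadditive.sum_comp] at h ⊢
    exact h
  T_t Z := by
    have h := tInv_t (R := R) (k := k)
    rw [show (-k).toNat = 0 by omega, Finset.range_zero, Finset.sum_empty, add_zero] at h
    rw [left_t]
    dsimp [leftAction, tensorLeft]
    simp [← comp_whiskerRight_assoc, h]
  T_dn r hr Z := by
    rw [left_dn]
    dsimp [leftAction, tensorLeft]
    simp only [Category.assoc, Iso.hom_inv_id_assoc, ← comp_whiskerRight_assoc, tInv_dDot hr]
    simp
    rfl
  E_t r hr Z := by
    rw [left_t]
    dsimp [leftAction, tensorLeft]
    simp only [Category.assoc, Iso.hom_inv_id_assoc, ← comp_whiskerRight_assoc, cupInv_t hr]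
    simp
    rfl
  E_dn r r' hr hr' Z := by
    rw [left_dn]
    dsimp [leftAction, tensorLeft]
    simp only [Category.assoc, Iso.hom_inv_id_assoc, ← comp_whiskerRight_assoc, cupInv_dDot hr hr']
    split_ifs <;> simp

/-- The bubbles of the right hand action of the inverse, for `k ≥ 0`. -/
def bubL (r : ℕ) : 𝟙_ (Heis R k) ⟶ 𝟙_ (Heis R k) :=
  if r < k.toNat then -(cupInv r ≫ dDot k.toNat) else if r = k.toNat then 𝟙 _ else 0

/-- The clockwise bubbles for `k ≥ 0`. -/
def cwL (c' : 𝟙_ (Heis R k) ⟶ up ⊗ down) (n : ℤ) : 𝟙_ (Heis R k) ⟶ 𝟙_ (Heis R k) :=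
  if 0 ≤ n then c' ≫ dDot n.toNat else if n = k.toNat - 1 then -𝟙 _ else 0

/-- The counterclockwise bubbles for `k ≥ 0`. -/
def ccwL (d' : (down ⊗ up : Heis R k) ⟶ 𝟙_ (Heis R k)) (n : ℤ) :
    𝟙_ (Heis R k) ⟶ 𝟙_ (Heis R k) :=
  if 0 ≤ n then c ≫ dDot' d' n.toNat else bubL (-n - 1).toNat

theorem left_cwZ (hk : 0 ≤ k) (c' : 𝟙_ (Heis R k) ⟶ up ⊗ down)
    (d' : (down ⊗ up : Heis R k) ⟶ 𝟙_ (Heis R k)) (n : ℤ) (Z : Heis R k) :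
    (leftInversion hk).cwZ (leftPair c' d') n Z = (λ_ Z).inv ≫ cwL c' n ▷ Z ≫ (λ_ Z).hom := by
  rw [HeckeAction.Inversion.cwZ, cwL]
  split_ifs
  · rw [left_cw]
  · rw [show (-𝟙 _ : 𝟙_ (Heis R k) ⟶ 𝟙_ (Heis R k)) ▷ Z = -𝟙 _ by
      rw [← id_whiskerRight]; exact ((tensorRight Z).map_neg)]
    simp
  · simp

theorem neg_whiskerRight {X Y : Heis R k} (f : X ⟶ Y) (Z : Heis R k) :
    (-f) ▷ Z = -(f ▷ Z) :=
  (tensorRight Z).map_neg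

theorem whiskerLeft_neg {X Y : Heis R k} (Z : Heis R k) (f : X ⟶ Y) :
    Z ◁ (-f) = -(Z ◁ f) :=
  (tensorLeft Z).map_neg

theorem sub_whiskerRight {X Y : Heis R k} (f g : X ⟶ Y) (Z : Heis R k) :
    (f - g) ▷ Z = f ▷ Z - g ▷ Z :=
  (tensorRight Z).map_sub

theorem whiskerLeft_sub {X Y : Heis R k} (Z : Heis R k) (f g : X ⟶ Y) :
    Z ◁ (f - g) = Z ◁ f - Z ◁ g :=
  (tensorLeft Z).map_sub

theorem nsmul_whiskerRight {X Y : Heis R k} (n : ℕ) (f : X ⟶ Y) (Z : Heis R k) :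
    (n • f) ▷ Z = n • f ▷ Z :=
  (tensorRight Z).map_nsmul

theorem whiskerLeft_nsmul {X Y : Heis R k} (Z : Heis R k) (n : ℕ) (f : X ⟶ Y) :
    Z ◁ (n • f) = n • Z ◁ f :=
  (tensorLeft Z).map_nsmul

theorem left_al (hk : 0 ≤ k) (r : ℕ) (Z : Heis R k) :
    (leftInversion hk).al r Z = (λ_ Z).inv ≫ bubL r ▷ Z ≫ (λ_ Z).hom := by
  rw [HeckeAction.Inversion.al, bubL]
  split_ifs
  · rw [left_dn, neg_whiskerRight]
    dsimp [leftInversion, leftAction, tensorLeft]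
    simp
  · simp
  · simp

theorem left_ccwZ (hk : 0 ≤ k) (c' : 𝟙_ (Heis R k) ⟶ up ⊗ down)
    (d' : (down ⊗ up : Heis R k) ⟶ 𝟙_ (Heis R k)) (n : ℤ) (Z : Heis R k) :
    (leftInversion hk).ccwZ (leftPair c' d') n Z =
      (λ_ Z).inv ≫ ccwL d' n ▷ Z ≫ (λ_ Z).hom := by
  rw [HeckeAction.Inversion.ccwZ, ccwL]
  split_ifs
  · rw [left_ccw]
  · rw [left_al]

/-- The unit object acts faithfully, so an identity between actions, evaluated there, is an identity
of diagrams. -/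
theorem whiskerRight_unit_injective {X Y : Heis R k} {f g : X ⟶ Y}
    (h : f ▷ 𝟙_ (Heis R k) = g ▷ 𝟙_ (Heis R k)) : f = g := by
  simpa [MonoidalCategory.whiskerRight_id] using h

/-- Restriction of a bubble acting on the unit object. -/
theorem bubble_unit (B : 𝟙_ (Heis R k) ⟶ 𝟙_ (Heis R k)) :
    (λ_ (𝟙_ (Heis R k))).inv ≫ B ▷ 𝟙_ (Heis R k) ≫ (λ_ (𝟙_ (Heis R k))).hom = B := by
  rw [MonoidalCategory.whiskerRight_id]
  monoidal

theorem left_isLeftward (hk : 0 ≤ k) {c' : 𝟙_ (Heis R k) ⟶ up ⊗ down}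
    {d' : (down ⊗ up : Heis R k) ⟶ 𝟙_ (Heis R k)}
    (h₁ : c' ≫ t = if k = 0 then c else 0)
    (h₂ : ∀ r < k.toNat, c' ≫ dDot r = if r + 1 = k.toNat then -𝟙 _ else 0)
    (h₃ : d' = tInv ≫ dDot k.toNat) :
    (leftInversion hk).IsLeftward (leftPair c' d') where
  p_t Z := by
    by_cases h0 : k = 0
    · rw [if_pos h0] at h₁
      rw [if_pos (by omega), left_t]
      dsimp [leftAction, leftPair, tensorLeft]
      simp only [Category.assoc, Iso.hom_inv_id_assoc, ← comp_whiskerRight_assoc, h₁]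
    · rw [if_neg h0] at h₁
      rw [if_neg (by omega), left_t]
      dsimp [leftAction, leftPair, tensorLeft]
      simp only [Category.assoc, Iso.hom_inv_id_assoc, ← comp_whiskerRight_assoc, h₁]
      simp
      rfl
  p_dn r hr Z := by
    rw [left_dn]
    dsimp [leftAction, leftPair, tensorLeft]
    simp only [Category.assoc, Iso.hom_inv_id_assoc, ← comp_whiskerRight_assoc, h₂ r hr]
    split_ifs
    · rw [neg_whiskerRight]; simp
    · simp
  q_eq Z := by
    rw [left_dn]
    dsimp [leftInversion, leftAction, leftPair, tensorLeft]
    simp [h₃]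

theorem cwL_of_lt (hk : 0 ≤ k) {c' : 𝟙_ (Heis R k) ⟶ up ⊗ down}
    {d' : (down ⊗ up : Heis R k) ⟶ 𝟙_ (Heis R k)}
    (h : (leftInversion hk).IsLeftward (leftPair c' d')) (n : ℤ) (hn : n < k) :
    cwL c' n = if n = k - 1 then -𝟙 _ else 0 := by
  have h1 := h.cwZ_of_lt (n := n) (by omega) (𝟙_ _)
  rw [left_cwZ, bubble_unit] at h1
  rw [h1, Int.toNat_of_nonneg hk]

theorem ccwL_of_lt (hk : 0 ≤ k) (d' : (down ⊗ up : Heis R k) ⟶ 𝟙_ (Heis R k)) (n : ℤ)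
    (hn : n < -k) : ccwL d' n = if n = -k - 1 then 𝟙 _ else 0 := by
  rw [ccwL, if_neg (by omega), bubL, if_neg (by omega)]
  by_cases h1 : n = -k - 1
  · rw [if_pos h1, if_pos (by omega)]
  · rw [if_neg h1, if_neg (by omega)]

/-- By interchange a bubble at the side of a diagram can be moved to any height. This and the next
lemmas bring bubbles to where the action formulas have them. -/
theorem bubbleLeft_eq {a b : Heis R k} (B : 𝟙_ (Heis R k) ⟶ 𝟙_ (Heis R k)) (f : a ⟶ b) :
    bubbleLeft B f = f ≫ bubbleLeft B (𝟙 b) := by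
  rw [bubbleLeft, bubbleLeft, MonoidalCategory.tensorHom_def', MonoidalCategory.tensorHom_def']
  monoidal

theorem bubbleRight_eq {a b : Heis R k} (B : 𝟙_ (Heis R k) ⟶ 𝟙_ (Heis R k)) (f : a ⟶ b) :
    bubbleRight f B = f ≫ bubbleRight (𝟙 b) B := by
  rw [bubbleRight, bubbleRight, MonoidalCategory.tensorHom_def, MonoidalCategory.tensorHom_def]
  monoidal

theorem bubbleLeft_comp {a b e : Heis R k} (B : 𝟙_ (Heis R k) ⟶ 𝟙_ (Heis R k)) (f : a ⟶ b) (g : b ⟶ e) :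
    bubbleLeft B (f ≫ g) = f ≫ bubbleLeft B g := by
  rw [bubbleLeft_eq, bubbleLeft_eq B g, Category.assoc]

theorem bubbleRight_comp {a b e : Heis R k} (B : 𝟙_ (Heis R k) ⟶ 𝟙_ (Heis R k)) (f : a ⟶ b) (g : b ⟶ e) :
    bubbleRight (f ≫ g) B = f ≫ bubbleRight g B := by
  rw [bubbleRight_eq, bubbleRight_eq B g, Category.assoc]

theorem bubbleLeft_id_comp {a b : Heis R k} (B : 𝟙_ (Heis R k) ⟶ 𝟙_ (Heis R k)) (f : a ⟶ b) :
    bubbleLeft B (𝟙 a) ≫ f = bubbleLeft B f := by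
  rw [bubbleLeft, bubbleLeft, MonoidalCategory.tensorHom_def, MonoidalCategory.tensorHom_def]
  monoidal

theorem bubbleRight_id_comp {a b : Heis R k} (B : 𝟙_ (Heis R k) ⟶ 𝟙_ (Heis R k)) (f : a ⟶ b) :
    bubbleRight (𝟙 a) B ≫ f = bubbleRight f B := by
  rw [bubbleRight, bubbleRight, MonoidalCategory.tensorHom_def', MonoidalCategory.tensorHom_def']
  monoidal

theorem bubbleLeft_id (B : 𝟙_ (Heis R k) ⟶ 𝟙_ (Heis R k)) (a : Heis R k) :
    bubbleLeft B (𝟙 a) = (λ_ a).inv ≫ B ▷ a ≫ (λ_ a).hom := by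
  rw [bubbleLeft, tensorHom_id]

theorem bubbleRight_id (B : 𝟙_ (Heis R k) ⟶ 𝟙_ (Heis R k)) (a : Heis R k) :
    bubbleRight (𝟙 a) B = (ρ_ a).inv ≫ a ◁ B ≫ (ρ_ a).hom := by
  rw [bubbleRight, id_tensorHom]

theorem relations_left (hk : 0 ≤ k) {c' : 𝟙_ (Heis R k) ⟶ up ⊗ down}
    {d' : (down ⊗ up : Heis R k) ⟶ 𝟙_ (Heis R k)}
    (h : (leftInversion hk).IsLeftward (leftPair c' d')) :
    Relations c' d' (cwL c') (ccwL d') where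
  a_natCast n := by simp [cwL]
  b_natCast n := by simp [ccwL]
  a_of_lt n hn := cwL_of_lt hk h n hn
  b_of_lt n hn := ccwL_of_lt hk d' n hn
  grassmannian m := by
    have h1 := h.grassmannian_eq m (𝟙_ _)
    simp only [left_cwZ, left_ccwZ, Int.toNat_of_nonneg hk, bubble_unit] at h1
    exact h1
  t_t' N hN := by
    refine whiskerRight_unit_injective ?_
    rw [← cancel_epi (α_ _ _ _).inv, ← cancel_mono (α_ _ _ _).hom]
    have h1 := h.t_tp_eq (N := N) (by omega) (𝟙_ _)
    simp only [left_ccwZ, left_t, left_tp, left_dn, left_cp] at h1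
    dsimp [leftAction, tensorLeft] at h1
    simp [Preadditive.comp_sum,
      Preadditive.sum_comp] at h1 ⊢
    exact h1
  t'_t N hN := by
    have h1 := h.tp_t (𝟙_ _)
    rw [left_t, left_tp] at h1
    dsimp [leftAction, tensorLeft] at h1
    simp only [Category.assoc, Iso.hom_inv_id_assoc, ← comp_whiskerRight_assoc] at h1
    -- For `k ≥ 0` a clockwise bubble with at most `-2` dots is zero, so `t'` is exactly inverse to
    -- `t` on this side.
    rw [Finset.sum_eq_zero, add_zero]
    · refine whiskerRight_unit_injective ?_
      rw [← cancel_epi (α_ _ _ _).inv, ← cancel_mono (α_ _ _ _).hom, Category.assoc]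
      refine h1.trans ?_
      simp
    · intro i _
      refine Finset.sum_eq_zero fun j _ => ?_
      rw [cwL_of_lt hk h _ (by omega), if_neg (by omega)]
      simp
  zigzag_up' := by
    refine whiskerRight_unit_injective ?_
    have h1 := h.zigzag_up (𝟙_ _)
    dsimp [leftAction, leftPair, tensorLeft] at h1
    have h2 := congrArg (fun f => (λ_ up).hom ▷ 𝟙_ _ ≫ f ≫ (ρ_ up).inv ▷ 𝟙_ _) h1
    refine Eq.trans ?_ (h2.trans ?_)
    · monoidal
    · monoidal
  zigzag_down' := by
    refine whiskerRight_unit_injective ?_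
    have h1 := h.zigzag_down (𝟙_ _)
    dsimp [leftAction, leftPair, tensorLeft] at h1
    have h2 := congrArg (fun f => (ρ_ down).hom ▷ 𝟙_ _ ≫ f ≫ (λ_ down).inv ▷ 𝟙_ _) h1
    refine Eq.trans ?_ (h2.trans ?_)
    · monoidal
    · monoidal
  xRight_eq := by
    refine whiskerRight_unit_injective ?_
    rw [← left_y, ← left_yL, h.y_eq]
  sRight_eq := by
    refine whiskerRight_unit_injective ?_
    rw [← cancel_epi (α_ _ _ _).inv, ← cancel_mono (α_ _ _ _).hom, Category.assoc, Category.assoc,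
      ← left_sR, ← left_sL, h.sL_eq]
  curlLeft_eq n N hN := by
    refine whiskerRight_unit_injective ?_
    have h1 := h.curlL_eq_sum n (N := N) (by omega) (𝟙_ _)
    simp only [left_ccwZ, left_curlL, left_xp] at h1
    dsimp [leftAction, tensorLeft] at h1
    rw [h1, sum_whiskerRight]
    refine Finset.sum_congr rfl fun m _ => ?_
    rw [bubbleLeft_eq, bubbleLeft_id]
    monoidal
  curlRight_eq n N hN := by
    refine whiskerRight_unit_injective ?_
    have h1 := h.curlR_eq_sum n (N := N) (by omega) (𝟙_ _)
    simp only [left_cwZ, left_curlR, left_xp] at h1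
    dsimp [leftAction, tensorLeft] at h1
    rw [h1, neg_whiskerRight, sum_whiskerRight]
    refine congrArg _ (Finset.sum_congr rfl fun m _ => ?_)
    rw [bubbleRight_eq, bubbleRight_id]
    monoidal
  slide_b n N hN := by
    refine whiskerRight_unit_injective ?_
    have h1 := h.ccwZ_slide n (N := N) (by omega) (𝟙_ _)
    simp only [left_ccwZ, left_xp] at h1
    dsimp [leftAction, tensorLeft] at h1
    rw [sub_whiskerRight, sum_whiskerRight]
    refine Eq.trans ?_ (h1.trans (congrArg₂ _ ?_ (Finset.sum_congr rfl fun m _ => ?_)))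
    · rw [bubbleRight_id]; monoidal
    · rw [bubbleLeft_id]; monoidal
    · rw [bubbleLeft_eq, bubbleLeft_id, nsmul_whiskerRight]
      congr 1
      monoidal
  slide_a n N hN := by
    refine whiskerRight_unit_injective ?_
    have h1 := h.cwZ_slide n (N := N) (by omega) (𝟙_ _)
    simp only [left_cwZ, left_xp] at h1
    dsimp [leftAction, tensorLeft] at h1
    rw [sub_whiskerRight, sum_whiskerRight]
    refine Eq.trans ?_ (h1.trans (congrArg₂ _ ?_ (Finset.sum_congr rfl fun m _ => ?_)))
    · rw [bubbleLeft_id]; monoidal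
    · rw [bubbleRight_id]; monoidal
    · rw [bubbleRight_eq, bubbleRight_id, nsmul_whiskerRight]
      congr 1
      monoidal
  alt_of_nonneg hk N hN := by
    refine whiskerRight_unit_injective ?_
    have h1 := h.altL_sub_altR_eq (N := N) (by omega) (𝟙_ _)
    simp only [left_ccwZ, left_altL, left_altR, left_dn, left_xp, left_cp] at h1
    dsimp [leftAction, tensorLeft] at h1
    rw [← cancel_epi (up ◁ (α_ down up (𝟙_ _)).inv ≫ (α_ up (down ⊗ up) (𝟙_ _)).inv),
      ← cancel_mono ((α_ up (down ⊗ up) (𝟙_ _)).hom ≫ up ◁ (α_ down up (𝟙_ _)).hom)]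
    simp only [sub_whiskerRight, sum_whiskerRight, Preadditive.comp_sub, Preadditive.sub_comp,
      Preadditive.comp_sum, Preadditive.sum_comp]
    refine Eq.trans ?_ (h1.trans (Finset.sum_congr rfl fun i _ => Finset.sum_congr rfl fun j _ =>
      Finset.sum_congr rfl fun n _ => ?_))
    · simp only [Category.assoc]
      rfl
    -- The dotted strand is slid to the height between the cap and the cup, where only `↑` is left;
    -- the bubble is inserted there, as in the action formula.
    · rw [show 𝟙 _ ⊗≫ ((dDot j ≫ cDot' c' i) ⊗ₘ xPow n) ⊗≫ 𝟙 (up ⊗ down ⊗ up) =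
        ((α_ _ _ _).inv ≫ dDot j ▷ up ≫ (λ_ _).hom ≫ xPow n) ≫
          ((λ_ _).inv ≫ cDot' c' i ▷ up ≫ (α_ _ _ _).hom) by
        rw [show (dDot j ≫ cDot' c' i) ⊗ₘ xPow n = dDot j ▷ up ≫ (𝟙_ _) ◁ xPow n ≫
          cDot' c' i ▷ up by
          rw [MonoidalCategory.tensorHom_def', comp_whiskerRight, whisker_exchange_assoc]]
        monoidal,
        bubbleLeft_comp, ← bubbleLeft_id_comp, bubbleLeft_id]
      monoidal
  alt_of_nonpos hk' N hN := by
    -- Only `k = 0` remains, so the correction is empty and the action formula may be used with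
    -- bound `0`.
    rw [Finset.sum_eq_zero]
    · refine whiskerRight_unit_injective ?_
      have h1 := h.altL_sub_altR_eq (N := 0) (by omega) (𝟙_ _)
      rw [Finset.range_zero, Finset.sum_empty, left_altL, left_altR] at h1
      rw [← cancel_epi (up ◁ (α_ down up (𝟙_ _)).inv ≫ (α_ up (down ⊗ up) (𝟙_ _)).inv),
        ← cancel_mono ((α_ up (down ⊗ up) (𝟙_ _)).hom ≫ up ◁ (α_ down up (𝟙_ _)).hom)]
      simp only [sub_whiskerRight, Preadditive.comp_sub, Preadditive.sub_comp, Category.assoc,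
        MonoidalPreadditive.zero_whiskerRight, Limits.comp_zero, Limits.zero_comp]
      exact h1
    · intro i _
      refine Finset.sum_eq_zero fun j _ => Finset.sum_eq_zero fun n _ => ?_
      rw [cwL_of_lt hk h _ (by omega), if_neg (by omega), bubbleRight_eq, bubbleRight_id]
      simp
  tInv_eq := by
    refine whiskerRight_unit_injective ?_
    rw [← cancel_epi (α_ _ _ _).inv, ← cancel_mono (α_ _ _ _).hom, Category.assoc, Category.assoc,
      ← left_tp, ← h.T_eq]
    rfl
  cupInv_eq r := by
    by_cases hr : r < k.toNat
    · refine ⟨k.toNat - r, fun i => -bubL (r + 1 + i), whiskerRight_unit_injective ?_⟩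
      have h1 := h.E_eq r hr (𝟙_ _)
      simp only [left_al, left_cp] at h1
      dsimp [leftAction, leftInversion, tensorLeft] at h1
      rw [← cancel_epi (λ_ (𝟙_ _)).inv, ← cancel_mono (α_ up down (𝟙_ _)).hom]
      simp only [sum_whiskerRight, Preadditive.comp_sum, Preadditive.sum_comp]
      refine Eq.trans ?_ (h1.trans ?_)
      · simp only [Category.assoc]
      · refine (Finset.sum_neg_distrib _).symm.trans ?_
        refine Finset.sum_congr rfl fun i _ => ?_
        rw [Preadditive.neg_comp, neg_whiskerRight, Preadditive.comp_neg, Preadditive.neg_comp]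
        refine congrArg _ ?_
        monoidal
    · exact ⟨0, 0, by rw [cupInv, dif_neg hr]; simp⟩
  capInv_eq r := ⟨0, 0, by rw [capInv, dif_neg (by omega)]; simp⟩

/-- The candidate for the leftward cup for `k ≥ 0`. -/
def leftCup : 𝟙_ (Heis R k) ⟶ up ⊗ down :=
  if k = 0 then c ≫ tInv else -cupInv (k.toNat - 1)

/-- The candidate for the leftward cap for `k ≥ 0`. -/
def leftCap : (down ⊗ up : Heis R k) ⟶ 𝟙_ (Heis R k) := tInv ≫ dDot k.toNat

theorem relations_leftCup (hk : 0 ≤ k) :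
    Relations (leftCup (R := R) (k := k)) leftCap (cwL leftCup) (ccwL leftCap) := by
  refine relations_left hk (left_isLeftward hk ?_ ?_ rfl)
  · rw [leftCup]
    split_ifs with h0
    · have h := tInv_t (R := R) (k := k)
      rw [show (-k).toNat = 0 by omega, Finset.range_zero, Finset.sum_empty, add_zero] at h
      rw [Category.assoc, h, Category.comp_id]
    · rw [Preadditive.neg_comp, cupInv_t (by omega)]
      exact neg_zero
  · intro r hr
    rw [leftCup, if_neg (by omega), Preadditive.neg_comp, cupInv_dDot (by omega) hr]
    by_cases h : r + 1 = k.toNat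
    · rw [if_pos h, if_pos (by omega)]
    · rw [if_neg h, if_neg (by omega)]; exact neg_zero

/-- The hypotheses hold after whiskering with every object, so uniqueness for actions applies;
evaluate at the unit. -/
theorem eq_leftCup (hk : 0 ≤ k) {c' : 𝟙_ (Heis R k) ⟶ up ⊗ down}
    {d' : (down ⊗ up : Heis R k) ⟶ 𝟙_ (Heis R k)} (ht : t' c' d' ≫ t = 𝟙 _)
    (hR : curlRight c' 0 = if k = 0 then 𝟙 _ else 0)
    (hc : ∀ r < k.toNat, c' ≫ dDot r = if r + 1 = k.toNat then -𝟙 _ else 0) :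
    c' = leftCup ∧ d' = leftCap := by
  have h : (leftInversion hk).IsLeftward (leftPair c' d') := by
    refine HeckeAction.Inversion.isLeftward_of_relations _ _ (fun Z => ?_) (fun Z => ?_)
      fun r hr Z => ?_
    · rw [left_t, left_tp]
      dsimp [leftAction, tensorLeft]
      simp only [Category.assoc, Iso.hom_inv_id_assoc, ← comp_whiskerRight_assoc, ht]
      simp
    · rw [left_curlR, hR]
      by_cases h0 : k = 0
      · rw [if_pos h0, if_pos (by omega)]; simp; rfl
      · rw [if_neg h0, if_neg (by omega)]; simp; rfl
    · rw [left_cw, hc r hr]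
      split_ifs
      · rw [neg_whiskerRight]; simp
      · simp
  constructor
  · refine whiskerRight_unit_injective ?_
    rw [← cancel_epi (λ_ _).inv, ← cancel_mono (α_ _ _ _).hom, Category.assoc, Category.assoc]
    refine (h.p_eq (𝟙_ _)).trans ?_
    dsimp [leftCup, HeckeAction.Inversion.cupCap]
    by_cases h0 : k = 0
    · rw [if_pos h0, if_pos (by omega)]
      dsimp [leftAction, leftInversion, tensorLeft]
      simp
    · rw [if_neg h0, if_neg (by omega), neg_whiskerRight, Preadditive.neg_comp,
        Preadditive.comp_neg]
      rfl
  · refine whiskerRight_unit_injective ?_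
    rw [← cancel_epi (α_ _ _ _).inv, ← cancel_mono (λ_ _).hom, Category.assoc, Category.assoc]
    refine (h.q_eq (𝟙_ _)).trans ?_
    rw [left_dn]
    dsimp [leftAction, leftInversion, leftCap, tensorLeft]
    simp

end Heis
end Heisenberg

/-! ### The action by tensoring on the right on the opposite category. -/

namespace Heisenberg

namespace Heis

variable {R : Type u} [CommRing R] {k : ℤ}

/-- The opposite of the Heisenberg category is acted upon by tensoring on the right. -/
noncomputable def rightAction (R : Type u) [CommRing R] (k : ℤ) :
    HeckeAction (Heis R k)ᵒᵖ where
  U := (tensorRight up).op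
  D := (tensorRight down).op
  x Z := (Z.unop ◁ x).op
  -- Reversing both composition and tensor product turns the dot relation into the one with the
  -- opposite sign on the identity term; `-s` restores it.
  s Z := (-((α_ Z.unop up up).hom ≫ Z.unop ◁ s ≫ (α_ Z.unop up up).inv)).op
  c Z := ((α_ Z.unop up down).hom ≫ Z.unop ◁ d ≫ (ρ_ Z.unop).hom).op
  d Z := ((ρ_ Z.unop).inv ≫ Z.unop ◁ c ≫ (α_ Z.unop down up).inv).op
  x_nat f := Quiver.Hom.unop_inj (whisker_exchange f.unop x)
  s_nat {Z W} f := by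
    refine Quiver.Hom.unop_inj ?_
    dsimp [tensorRight]
    rw [Preadditive.neg_comp, Preadditive.comp_neg]
    refine congrArg _ ?_
    have h := congrArg (fun f => (α_ _ up up).hom ≫ f ≫ (α_ _ up up).inv)
      (whisker_exchange f.unop s)
    refine Eq.trans ?_ (h.trans ?_)
    · monoidal
    · monoidal
  c_nat {Z W} f := by
    refine Quiver.Hom.unop_inj ?_
    dsimp [tensorRight]
    have h := congrArg (fun f => (α_ _ up down).hom ≫ f ≫ (ρ_ _).hom)
      (whisker_exchange f.unop d)
    refine Eq.trans ?_ (h.trans ?_)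
    · monoidal
    · monoidal
  d_nat {Z W} f := by
    refine Quiver.Hom.unop_inj ?_
    dsimp [tensorRight]
    have h := congrArg (fun f => (ρ_ _).inv ≫ f ≫ (α_ _ down up).inv)
      (whisker_exchange f.unop c)
    refine Eq.trans ?_ (h.trans ?_)
    · monoidal
    · monoidal
  s_s Z := by
    refine Quiver.Hom.unop_inj ?_
    dsimp [tensorRight]
    simp [← whiskerLeft_comp_assoc, s_s]
  braid Z := by
    refine Quiver.Hom.unop_inj ?_
    dsimp [tensorRight]
    simp only [neg_whiskerRight, Preadditive.neg_comp, Preadditive.comp_neg]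
    refine congrArg _ (congrArg _ (congrArg _ ?_))
    have h := congrArg (fun f => (α_ (Z.unop ⊗ up) up up).hom ≫ (α_ Z.unop up (up ⊗ up)).hom ≫
      Z.unop ◁ (α_ up up up).inv ≫ Z.unop ◁ f ≫
      Z.unop ◁ (α_ up up up).hom ≫ (α_ Z.unop up (up ⊗ up)).inv ≫
      (α_ (Z.unop ⊗ up) up up).inv) (braid (R := R) (k := k))
    refine Eq.trans ?_ (h.symm.trans ?_)
    · monoidal
    · monoidal
  s_x Z := by
    refine Quiver.Hom.unop_inj ?_
    dsimp [tensorRight]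
    have h := congrArg (fun f => (α_ Z.unop up up).hom ≫ Z.unop ◁ f ≫ (α_ Z.unop up up).inv)
      (s_x (R := R) (k := k))
    simp only [MonoidalPreadditive.whiskerLeft_add, Preadditive.comp_add,
      Preadditive.add_comp] at h
    rw [Preadditive.neg_comp, Preadditive.comp_neg, eq_comm, neg_add_eq_iff_eq_add,
      ← sub_eq_add_neg, eq_sub_iff_add_eq', eq_comm]
    refine Eq.trans ?_ (h.trans ?_)
    · monoidal
    · congr 1 <;> monoidal
  zigzag_up Z := by
    refine Quiver.Hom.unop_inj ?_
    dsimp [tensorRight]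
    have h := congrArg (fun f => (ρ_ _).inv ≫ (α_ _ _ _).hom ≫ Z.unop ◁ f ≫ Z.unop ◁ (λ_ _).hom)
      (zigzag_up (R := R) (k := k))
    refine Eq.trans ?_ (h.trans ?_)
    · monoidal
    · monoidal
  zigzag_down Z := by
    refine Quiver.Hom.unop_inj ?_
    dsimp [tensorRight]
    have h := congrArg (fun f => (ρ_ _).inv ▷ down ≫ (α_ _ _ _).hom ≫ Z.unop ◁ f ≫
      Z.unop ◁ (ρ_ _).hom) (zigzag_down (R := R) (k := k))
    refine Eq.trans ?_ (h.trans ?_)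
    · monoidal
    · monoidal

/-- A leftward cup and cap act on the right. -/
noncomputable def rightPair (c' : 𝟙_ (Heis R k) ⟶ up ⊗ down)
    (d' : (down ⊗ up : Heis R k) ⟶ 𝟙_ (Heis R k)) : (rightAction R k).CupCap where
  -- The signs compensate for `-s`: a counterclockwise bubble of value `1` must become a clockwise
  -- bubble of value `-1` of this action, and `T` is minus the adjoined crossing.
  p Z := (-((α_ Z.unop down up).hom ≫ Z.unop ◁ d' ≫ (ρ_ Z.unop).hom)).op
  q Z := (-((ρ_ Z.unop).inv ≫ Z.unop ◁ c' ≫ (α_ Z.unop up down).inv)).op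
  p_nat {Z W} f := by
    refine Quiver.Hom.unop_inj ?_
    dsimp [rightAction, tensorRight]
    rw [Preadditive.neg_comp, Preadditive.comp_neg]
    refine congrArg _ ?_
    have h := congrArg (fun f => (α_ _ down up).hom ≫ f ≫ (ρ_ _).hom)
      (whisker_exchange f.unop d')
    refine Eq.trans ?_ (h.trans ?_)
    · monoidal
    · monoidal
  q_nat {Z W} f := by
    refine Quiver.Hom.unop_inj ?_
    dsimp [rightAction, tensorRight]
    rw [Preadditive.neg_comp, Preadditive.comp_neg]
    refine congrArg _ ?_
    have h := congrArg (fun f => (ρ_ _).inv ≫ f ≫ (α_ _ up down).inv)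
      (whisker_exchange f.unop c')
    refine Eq.trans ?_ (h.trans ?_)
    · monoidal
    · monoidal

theorem right_U_map {Z W : (Heis R k)ᵒᵖ} (f : Z ⟶ W) :
    ((rightAction R k).U.map f).unop = f.unop ▷ up := rfl

theorem right_D_map {Z W : (Heis R k)ᵒᵖ} (f : Z ⟶ W) :
    ((rightAction R k).D.map f).unop = f.unop ▷ down := rfl

theorem right_xp (n : ℕ) (Z : (Heis R k)ᵒᵖ) :
    ((rightAction R k).xp n Z).unop = Z.unop ◁ xPow n := by
  induction n with
  | zero => exact (whiskerLeft_id _ _).symm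
  | succ n ih =>
    rw [HeckeAction.xp_succ, unop_comp, ih, show (xPow (n + 1) : (up : Heis R k) ⟶ up) =
      x ≫ xPow n from pow_succ (show End (up : Heis R k) from x) n, whiskerLeft_comp]
    rfl

theorem right_dn (n : ℕ) (Z : (Heis R k)ᵒᵖ) : ((rightAction R k).dn n Z).unop =
    (ρ_ Z.unop).inv ≫ Z.unop ◁ cDot n ≫ (α_ Z.unop down up).inv := by
  rw [HeckeAction.dn, unop_comp, right_xp, cDot]
  dsimp [rightAction, tensorRight]
  monoidal

theorem right_cn (n : ℕ) (Z : (Heis R k)ᵒᵖ) : ((rightAction R k).cn n Z).unop =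
    (α_ Z.unop up down).hom ≫ Z.unop ◁ dDot n ≫ (ρ_ Z.unop).hom := by
  rw [HeckeAction.cn, unop_comp, right_D_map, right_xp, dDot]
  dsimp [rightAction, tensorRight]
  monoidal

theorem right_t (Z : (Heis R k)ᵒᵖ) : ((rightAction R k).t Z).unop =
    (-((α_ Z.unop up down).hom ≫ Z.unop ◁ t ≫ (α_ Z.unop down up).inv) :
      (Z.unop ⊗ up) ⊗ down ⟶ (Z.unop ⊗ down) ⊗ up) := by
  rw [HeckeAction.t, t]
  dsimp [rightAction, tensorRight]
  simp only [neg_whiskerRight, Preadditive.neg_comp, Preadditive.comp_neg]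
  refine congrArg _ ?_
  monoidal

theorem right_y (Z : (Heis R k)ᵒᵖ) : ((rightAction R k).y Z).unop = Z.unop ◁ xRight := by
  rw [HeckeAction.y, xRight]
  dsimp [rightAction, tensorRight]
  monoidal

theorem right_sR (Z : (Heis R k)ᵒᵖ) : ((rightAction R k).sR Z).unop =
    -((α_ Z.unop down down).hom ≫ Z.unop ◁ sRight ≫ (α_ Z.unop down down).inv) := by
  rw [HeckeAction.sR, HeckeAction.t, sRight]
  dsimp [rightAction, tensorRight]
  simp only [neg_whiskerRight, Preadditive.neg_comp, Preadditive.comp_neg]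
  refine congrArg _ ?_
  monoidal

section

variable (c' : 𝟙_ (Heis R k) ⟶ up ⊗ down) (d' : (down ⊗ up : Heis R k) ⟶ 𝟙_ (Heis R k))

theorem right_cp (n : ℕ) (Z : (Heis R k)ᵒᵖ) : ((rightPair c' d').cp n Z).unop =
    (-((α_ Z.unop down up).hom ≫ Z.unop ◁ dDot' d' n ≫ (ρ_ Z.unop).hom) :
      (Z.unop ⊗ down) ⊗ up ⟶ Z.unop) := by
  rw [HeckeAction.CupCap.cp, unop_comp, right_xp, dDot']
  dsimp [rightAction, rightPair, tensorRight]
  simp only [Preadditive.comp_neg]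
  refine congrArg _ ?_
  monoidal

theorem right_dq (n : ℕ) (Z : (Heis R k)ᵒᵖ) : ((rightPair c' d').dq n Z).unop =
    -((ρ_ Z.unop).inv ≫ Z.unop ◁ cDot' c' n ≫ (α_ Z.unop up down).inv) := by
  rw [HeckeAction.CupCap.dq, unop_comp, right_D_map, right_xp, cDot']
  dsimp [rightAction, rightPair, tensorRight]
  simp only [Preadditive.neg_comp]
  refine congrArg _ ?_
  monoidal

theorem right_cw (n : ℕ) (Z : (Heis R k)ᵒᵖ) : ((rightPair c' d').cw n Z).unop =
    -((ρ_ Z.unop).inv ≫ Z.unop ◁ (c ≫ dDot' d' n) ≫ (ρ_ Z.unop).hom) := by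
  rw [HeckeAction.CupCap.cw, unop_comp, right_dn, cDot, dDot']
  dsimp [rightAction, rightPair, tensorRight]
  simp only [Preadditive.comp_neg]
  refine congrArg _ ?_
  monoidal

theorem right_ccw (n : ℕ) (Z : (Heis R k)ᵒᵖ) : ((rightPair c' d').ccw n Z).unop =
    -((ρ_ Z.unop).inv ≫ Z.unop ◁ (c' ≫ dDot n) ≫ (ρ_ Z.unop).hom) := by
  rw [HeckeAction.CupCap.ccw, unop_comp, right_dq, dDot, cDot']
  dsimp [rightAction, rightPair, tensorRight]
  simp only [Preadditive.neg_comp]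
  refine congrArg _ ?_
  monoidal

theorem right_tp (Z : (Heis R k)ᵒᵖ) : ((rightPair c' d').tp Z).unop =
    (-((α_ Z.unop down up).hom ≫ Z.unop ◁ t' c' d' ≫ (α_ Z.unop up down).inv) :
      (Z.unop ⊗ down) ⊗ up ⟶ (Z.unop ⊗ up) ⊗ down) := by
  rw [HeckeAction.CupCap.tp, t']
  dsimp [rightAction, rightPair, tensorRight]
  simp only [neg_whiskerRight, Preadditive.neg_comp, Preadditive.comp_neg, neg_neg]
  refine congrArg _ ?_
  monoidal

theorem right_curlR_zero (Z : (Heis R k)ᵒᵖ) :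
    ((rightPair c' d').curlR 0 Z).unop = Z.unop ◁ curlLeft d' 0 := by
  rw [HeckeAction.CupCap.curlR, curlLeft, HeckeAction.dn_zero, dDot', xPow_zero]
  dsimp [rightAction, rightPair, tensorRight]
  simp only [neg_whiskerRight, Preadditive.neg_comp, Preadditive.comp_neg, neg_neg]
  monoidal

/-- Reversal carries the dots on the cap of a curl to its cup. The left curl `L_n` is therefore not
`curlR n` of this action by definition, but the variant with the dots at the other end of the loop.
-/
theorem right_curlR (n : ℕ) (Z : (Heis R k)ᵒᵖ) :
    ((rightAction R k).U.map ((rightPair c' d').cp n Z) ≫ (rightAction R k).s _ ≫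
      (rightAction R k).U.map ((rightAction R k).d Z)).unop = Z.unop ◁ curlLeft d' n := by
  rw [curlLeft, unop_comp, unop_comp, right_U_map, right_U_map, right_cp]
  dsimp [rightAction, tensorRight]
  simp only [neg_whiskerRight, Preadditive.neg_comp, Preadditive.comp_neg, neg_neg]
  monoidal

theorem right_curlL (n : ℕ) (Z : (Heis R k)ᵒᵖ) :
    ((rightAction R k).cn n _ ≫ (rightAction R k).D.map ((rightAction R k).s Z) ≫
      (rightPair c' d').q _).unop = Z.unop ◁ curlRight c' n := by
  rw [curlRight, unop_comp, right_cn]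
  dsimp [rightAction, rightPair, tensorRight]
  simp only [neg_whiskerRight, Preadditive.neg_comp, Preadditive.comp_neg, neg_neg]
  monoidal

theorem right_sL (Z : (Heis R k)ᵒᵖ) : ((rightPair c' d').sL Z).unop =
    -((α_ Z.unop down down).hom ≫ Z.unop ◁ sLeft c' d' ≫ (α_ Z.unop down down).inv) := by
  rw [HeckeAction.CupCap.sL, sLeft]
  dsimp [rightAction, rightPair, tensorRight]
  simp only [neg_whiskerRight, Preadditive.neg_comp, Preadditive.comp_neg, neg_neg]
  refine congrArg _ ?_
  monoidal

theorem right_yL (Z : (Heis R k)ᵒᵖ) : ((rightPair c' d').yL Z).unop = Z.unop ◁ xLeft c' d' := by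
  rw [HeckeAction.CupCap.yL, xLeft]
  dsimp [rightAction, rightPair, tensorRight]
  simp only [neg_whiskerRight, Preadditive.neg_comp, Preadditive.comp_neg, neg_neg]
  monoidal

theorem right_altL (Z : (Heis R k)ᵒᵖ) : ((rightPair c' d').altL Z).unop =
    (-((α_ _ _ _).hom ▷ up ≫ (α_ _ _ _).hom ≫ Z.unop ◁ (α_ _ _ _).hom ≫
      Z.unop ◁ altRight c' d' ≫ Z.unop ◁ (α_ _ _ _).inv ≫ (α_ _ _ _).inv ≫
      (α_ _ _ _).inv ▷ up) :
      ((Z.unop ⊗ up) ⊗ down) ⊗ up ⟶ ((Z.unop ⊗ up) ⊗ down) ⊗ up) := by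
  have h₁ : ((rightPair c' d').tp ((rightAction R k).U.obj Z)).unop =
    (-((α_ (Z.unop ⊗ up) down up).hom ≫ (Z.unop ⊗ up) ◁ t' c' d' ≫ (α_ _ up down).inv) :
      ((Z.unop ⊗ up) ⊗ down) ⊗ up ⟶ ((Z.unop ⊗ up) ⊗ up) ⊗ down) := right_tp ..
  have h₂ : ((rightAction R k).t ((rightAction R k).U.obj Z)).unop =
    (-((α_ (Z.unop ⊗ up) up down).hom ≫ (Z.unop ⊗ up) ◁ t ≫ (α_ _ down up).inv) :
      ((Z.unop ⊗ up) ⊗ up) ⊗ down ⟶ ((Z.unop ⊗ up) ⊗ down) ⊗ up) := right_t ..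
  rw [HeckeAction.CupCap.altL, altRight, unop_comp, unop_comp, h₁, h₂]
  dsimp [rightAction, rightPair, tensorRight]
  simp only [neg_whiskerRight, Preadditive.neg_comp, Preadditive.comp_neg, neg_neg]
  refine congrArg _ ?_
  monoidal

theorem right_altR (Z : (Heis R k)ᵒᵖ) : ((rightPair c' d').altR Z).unop =
    (-((α_ _ _ _).hom ▷ up ≫ (α_ _ _ _).hom ≫ Z.unop ◁ (α_ _ _ _).hom ≫
      Z.unop ◁ altLeft c' d' ≫ Z.unop ◁ (α_ _ _ _).inv ≫ (α_ _ _ _).inv ≫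
      (α_ _ _ _).inv ▷ up) :
      ((Z.unop ⊗ up) ⊗ down) ⊗ up ⟶ ((Z.unop ⊗ up) ⊗ down) ⊗ up) := by
  rw [HeckeAction.CupCap.altR, altLeft, unop_comp, unop_comp, right_U_map, right_U_map, right_tp, right_t]
  dsimp [rightAction, rightPair, tensorRight]
  simp only [neg_whiskerRight, Preadditive.neg_comp, Preadditive.comp_neg, neg_neg]
  refine congrArg _ ?_
  monoidal

end

end Heis
end Heisenberg

/-! ### Dots travelling around loops, and the inversion for nonpositive charge. -/

namespace Heisenberg

universe v w

namespace HeckeAction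

variable {𝒞 : Type w} [Category.{v} 𝒞] [Preadditive 𝒞] (A : HeckeAction 𝒞)

/-- Powers of the dot on the downward strand. -/
def yp : ℕ → ∀ Z : 𝒞, A.D.obj Z ⟶ A.D.obj Z
  | 0, _ => 𝟙 _
  | n + 1, Z => A.y Z ≫ yp n Z

theorem yp_succ (n : ℕ) (Z : 𝒞) : A.yp (n + 1) Z = A.y Z ≫ A.yp n Z := rfl

theorem yp_nat (n : ℕ) {Z W : 𝒞} (f : Z ⟶ W) :
    A.D.map f ≫ A.yp n W = A.yp n Z ≫ A.D.map f := by
  induction n with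
  | zero => simp [yp]
  | succ n ih => rw [yp_succ, yp_succ, reassoc_of% A.y_nat f, ih, Category.assoc]

theorem c_yp (n : ℕ) (Z : 𝒞) : A.c Z ≫ A.yp n (A.U.obj Z) = A.cn n Z := by
  induction n with
  | zero => simp [yp, cn]
  | succ n ih =>
    rw [yp_succ, reassoc_of% A.c_y, yp_nat, reassoc_of% ih, cn, Category.assoc,
      ← Functor.map_comp, ← xp_succ, cn]

theorem U_yp_d (n : ℕ) (Z : 𝒞) : A.U.map (A.yp n Z) ≫ A.d Z = A.dn n Z := by
  induction n with
  | zero => simp [yp, dn]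
  | succ n ih =>
    rw [yp_succ, Functor.map_comp, Category.assoc, ih, dn, reassoc_of% A.xp_nat, A.U_y_d, dn, xp_succ,
      Category.assoc]

end HeckeAction

namespace HeckeAction.Inversion.IsLeftward

variable {𝒞 : Type w} [Category.{v} 𝒞] [Preadditive 𝒞] {A : HeckeAction 𝒞} {k : ℕ}
  {I : A.Inversion k} {P : A.CupCap}

theorem q_dots (h : I.IsLeftward P) (n : ℕ) (Z : 𝒞) :
    A.D.map (A.xp n Z) ≫ P.q Z = A.yp n _ ≫ P.q Z := by
  induction n with
  | zero => simp [yp]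
  | succ n ih =>
    rw [A.xp_succ, Functor.map_comp, Category.assoc, h.q_dot, reassoc_of% A.y_nat, ih, A.yp_succ,
      Category.assoc]

/-- The downward dot is also the left mate by cyclicity, and a leftward zigzag then straightens. -/
theorem p_y (h : I.IsLeftward P) (Z : 𝒞) : P.p Z ≫ A.U.map (A.y Z) = P.p Z ≫ A.x _ := by
  rw [← h.y_eq, CupCap.yL, ← Category.assoc (A.D.map _), ← Functor.map_comp, Functor.map_comp,
    ← reassoc_of% P.p_nat, h.zigzag_up, Category.assoc, Category.comp_id]

theorem p_yp (h : I.IsLeftward P) (n : ℕ) (Z : 𝒞) :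
    P.p Z ≫ A.U.map (A.yp n Z) = P.cp n Z := by
  induction n with
  | zero => simp [yp, CupCap.cp]
  | succ n ih =>
    rw [yp_succ, Functor.map_comp, reassoc_of% h.p_y, ← A.x_nat, reassoc_of% ih, CupCap.cp,
      CupCap.cp, xp_succ, Category.assoc]

/-- The dots travel along the downward part of the loop, from cup to cap. Together with
`curlR_eq_cp` this repairs the mismatch of dot positions in the right action. -/
theorem curlL_eq_cn (h : I.IsLeftward P) (n : ℕ) (Z : 𝒞) :
    A.cn n _ ≫ A.D.map (A.s Z) ≫ P.q _ = P.curlL n Z := by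
  rw [← A.c_yp, Category.assoc, ← reassoc_of% A.yp_nat, ← h.q_dots]
  rfl

theorem curlR_eq_cp (h : I.IsLeftward P) (n : ℕ) (Z : 𝒞) :
    A.U.map (P.cp n Z) ≫ A.s _ ≫ A.U.map (A.d Z) = P.curlR n Z := by
  rw [← h.p_yp, Functor.map_comp, Category.assoc, reassoc_of% A.s_nat, ← Functor.map_comp,
    A.U_yp_d]
  rfl

end HeckeAction.Inversion.IsLeftward

namespace Heis

variable {R : Type u} [CommRing R] {k : ℤ}

/-- The adjoined crossing acting on the right. -/
noncomputable def rightT (Z : (Heis R k)ᵒᵖ) :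
    (rightAction R k).D.obj ((rightAction R k).U.obj Z) ⟶
      (rightAction R k).U.obj ((rightAction R k).D.obj Z) :=
  (-((α_ Z.unop down up).hom ≫ Z.unop ◁ tInv ≫ (α_ Z.unop up down).inv)).op

/-- The adjoined caps acting on the right. -/
noncomputable def rightE (r : ℕ) (Z : (Heis R k)ᵒᵖ) :
    Z ⟶ (rightAction R k).U.obj ((rightAction R k).D.obj Z) :=
  ((α_ Z.unop down up).hom ≫ Z.unop ◁ capInv r ≫ (ρ_ Z.unop).hom).op

theorem unop_rightT (Z : (Heis R k)ᵒᵖ) : (rightT Z).unop =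
    (-((α_ Z.unop down up).hom ≫ Z.unop ◁ tInv ≫ (α_ Z.unop up down).inv) :
      (Z.unop ⊗ down) ⊗ up ⟶ (Z.unop ⊗ up) ⊗ down) := rfl

theorem unop_rightE (r : ℕ) (Z : (Heis R k)ᵒᵖ) : (rightE r Z).unop =
    (α_ Z.unop down up).hom ≫ Z.unop ◁ capInv r ≫ (ρ_ Z.unop).hom := rfl

/-- For `k ≤ 0`, the inverse of the row `[t, c₀, …, c_{-k-1}]` acts on the right. -/
noncomputable def rightInversion (hk : k ≤ 0) : (rightAction R k).Inversion (-k).toNat where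
  T := rightT
  E := rightE
  T_nat {Z W} f := by
    refine Quiver.Hom.unop_inj ?_
    rw [unop_comp, unop_comp, unop_rightT, unop_rightT]
    dsimp [rightAction, tensorRight]
    rw [Preadditive.neg_comp, Preadditive.comp_neg]
    refine congrArg _ ?_
    have h := congrArg (fun f => (α_ _ down up).hom ≫ f ≫ (α_ _ up down).inv)
      (whisker_exchange f.unop tInv)
    refine Eq.trans ?_ (h.trans ?_)
    · monoidal
    · monoidal
  E_nat r Z W f := by
    refine Quiver.Hom.unop_inj ?_
    rw [unop_comp, unop_comp, unop_rightE, unop_rightE]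
    dsimp [rightAction, tensorRight]
    have h := congrArg (fun f => (α_ _ down up).hom ≫ f ≫ (ρ_ _).hom)
      (whisker_exchange f.unop (capInv r))
    refine Eq.trans ?_ (h.trans ?_)
    · monoidal
    · monoidal
  -- In the opposite category the row is a column and the two composites with its inverse change
  -- places; the two minus signs of `t` and `T` cancel.
  t_T Z := by
    refine Quiver.Hom.unop_inj ?_
    have h := congrArg (fun f => (α_ Z.unop down up).hom ≫ Z.unop ◁ f ≫ (α_ Z.unop down up).inv)
      (tInv_t (R := R) (k := k))
    rw [unop_add, unop_sum]
    simp only [unop_comp, right_t, right_dn, unop_rightT, unop_rightE]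
    dsimp [rightAction, tensorRight]
    simp only [MonoidalPreadditive.whiskerLeft_add, whiskerLeft_sum, Preadditive.comp_sum,
      Preadditive.sum_comp, Preadditive.comp_add, Preadditive.add_comp] at h
    refine Eq.trans ?_ (h.trans ?_)
    · congr 1
      · rw [Preadditive.neg_comp, Preadditive.comp_neg, neg_neg]
        monoidal
      · refine Finset.sum_congr rfl fun r _ => ?_
        monoidal
    · monoidal
  T_t Z := by
    refine Quiver.Hom.unop_inj ?_
    have h := t_tInv (R := R) (k := k)
    rw [show k.toNat = 0 by omega, Finset.range_zero, Finset.sum_empty, add_zero] at h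
    rw [unop_comp, right_t, unop_rightT]
    dsimp [rightAction, tensorRight]
    rw [Preadditive.neg_comp, Preadditive.comp_neg, neg_neg]
    simp [← whiskerLeft_comp_assoc, h]
  T_dn r hr Z := by
    refine Quiver.Hom.unop_inj ?_
    rw [unop_comp, right_dn, unop_rightT]
    dsimp [rightAction, tensorRight]
    rw [Preadditive.comp_neg]
    simp only [Category.assoc, Iso.inv_hom_id_assoc, ← whiskerLeft_comp_assoc, cDot_tInv hr]
    simp
    rfl
  E_t r hr Z := by
    refine Quiver.Hom.unop_inj ?_
    rw [unop_comp, right_t, unop_rightE]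
    dsimp [rightAction, tensorRight]
    rw [Preadditive.neg_comp]
    simp only [Category.assoc, Iso.inv_hom_id_assoc, ← whiskerLeft_comp_assoc, t_capInv hr]
    simp
    rfl
  E_dn r r' hr hr' Z := by
    refine Quiver.Hom.unop_inj ?_
    rw [unop_comp, right_dn, unop_rightE]
    dsimp [rightAction, tensorRight]
    simp only [Category.assoc, Iso.inv_hom_id_assoc, ← whiskerLeft_comp_assoc,
      cDot_capInv hr' hr]
    simp only [eq_comm (a := r')]
    split_ifs
    · simp
    · simp

/-- The bubbles of the action of the inverse, for `k ≤ 0`. -/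
def bubR (r : ℕ) : 𝟙_ (Heis R k) ⟶ 𝟙_ (Heis R k) :=
  if r < (-k).toNat then cDot (-k).toNat ≫ capInv r else if r = (-k).toNat then -𝟙 _ else 0

/-- The counterclockwise bubbles for `k ≤ 0`. -/
def ccwR (d' : (down ⊗ up : Heis R k) ⟶ 𝟙_ (Heis R k)) (n : ℤ) :
    𝟙_ (Heis R k) ⟶ 𝟙_ (Heis R k) :=
  if 0 ≤ n then c ≫ dDot' d' n.toNat else if n = (-k).toNat - 1 then 𝟙 _ else 0

/-- The clockwise bubbles for `k ≤ 0`. -/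
def cwR (c' : 𝟙_ (Heis R k) ⟶ up ⊗ down) (n : ℤ) : 𝟙_ (Heis R k) ⟶ 𝟙_ (Heis R k) :=
  if 0 ≤ n then c' ≫ dDot n.toNat else bubR (-n - 1).toNat

theorem right_cwZ (hk : k ≤ 0) (c' : 𝟙_ (Heis R k) ⟶ up ⊗ down)
    (d' : (down ⊗ up : Heis R k) ⟶ 𝟙_ (Heis R k)) (n : ℤ) (Z : (Heis R k)ᵒᵖ) :
    ((rightInversion hk).cwZ (rightPair c' d') n Z).unop =
      -((ρ_ Z.unop).inv ≫ Z.unop ◁ ccwR d' n ≫ (ρ_ Z.unop).hom) := by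
  rw [HeckeAction.Inversion.cwZ, ccwR]
  split_ifs
  · rw [right_cw]
  · simp
  · simp

theorem right_al (hk : k ≤ 0) (r : ℕ) (Z : (Heis R k)ᵒᵖ) :
    ((rightInversion hk).al r Z).unop =
      -((ρ_ Z.unop).inv ≫ Z.unop ◁ bubR r ≫ (ρ_ Z.unop).hom) := by
  rw [HeckeAction.Inversion.al, bubR]
  split_ifs
  · rw [unop_neg, unop_comp, right_dn]
    refine congrArg _ ?_
    rw [rightInversion, unop_rightE]
    dsimp [rightAction, tensorRight]
    simp
  · rw [whiskerLeft_neg]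
    simp
  · simp

theorem right_ccwZ (hk : k ≤ 0) (c' : 𝟙_ (Heis R k) ⟶ up ⊗ down)
    (d' : (down ⊗ up : Heis R k) ⟶ 𝟙_ (Heis R k)) (n : ℤ) (Z : (Heis R k)ᵒᵖ) :
    ((rightInversion hk).ccwZ (rightPair c' d') n Z).unop =
      -((ρ_ Z.unop).inv ≫ Z.unop ◁ cwR c' n ≫ (ρ_ Z.unop).hom) := by
  rw [HeckeAction.Inversion.ccwZ, cwR]
  split_ifs
  · rw [right_ccw]
  · rw [right_al]

/-- The mirror image of `whiskerRight_unit_injective`, used to leave the right action. -/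
theorem whiskerLeft_unit_injective {X Y : Heis R k} {f g : X ⟶ Y}
    (h : 𝟙_ (Heis R k) ◁ f = 𝟙_ (Heis R k) ◁ g) : f = g := by
  simpa [MonoidalCategory.id_whiskerLeft] using h

theorem bubble_unit' (B : 𝟙_ (Heis R k) ⟶ 𝟙_ (Heis R k)) :
    (ρ_ (𝟙_ (Heis R k))).inv ≫ 𝟙_ (Heis R k) ◁ B ≫ (ρ_ (𝟙_ (Heis R k))).hom = B := by
  rw [MonoidalCategory.id_whiskerLeft]
  monoidal

theorem ccwR_of_lt (hk : k ≤ 0) {c' : 𝟙_ (Heis R k) ⟶ up ⊗ down}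
    {d' : (down ⊗ up : Heis R k) ⟶ 𝟙_ (Heis R k)}
    (h : (rightInversion hk).IsLeftward (rightPair c' d')) (n : ℤ) (hn : n < -k) :
    ccwR d' n = if n = -k - 1 then 𝟙 _ else 0 := by
  have h1 := congrArg Quiver.Hom.unop (h.cwZ_of_lt (n := n) (by omega) (Opposite.op (𝟙_ _)))
  rw [right_cwZ, bubble_unit', Int.toNat_of_nonneg (by omega)] at h1
  rw [← neg_neg (ccwR d' n), h1]
  split_ifs
  · simp
  · simp

theorem cwR_of_lt (hk : k ≤ 0) (c' : 𝟙_ (Heis R k) ⟶ up ⊗ down) (n : ℤ)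
    (hn : n < k) : cwR c' n = if n = k - 1 then -𝟙 _ else 0 := by
  rw [cwR, if_neg (by omega), bubR, if_neg (by omega)]
  by_cases h1 : n = k - 1
  · rw [if_pos h1, if_pos (by omega)]
  · rw [if_neg h1, if_neg (by omega)]

theorem right_isLeftward (hk : k ≤ 0) {c' : 𝟙_ (Heis R k) ⟶ up ⊗ down}
    {d' : (down ⊗ up : Heis R k) ⟶ 𝟙_ (Heis R k)}
    (h₁ : t ≫ d' = if k = 0 then d else 0)
    (h₂ : ∀ r < (-k).toNat, cDot r ≫ d' = if r + 1 = (-k).toNat then 𝟙 _ else 0)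
    (h₃ : c' = cDot (-k).toNat ≫ tInv) :
    (rightInversion hk).IsLeftward (rightPair c' d') where
  p_t Z := by
    refine Quiver.Hom.unop_inj ?_
    rw [unop_comp, right_t]
    by_cases h0 : k = 0
    · rw [if_pos h0] at h₁
      rw [if_pos (by omega)]
      dsimp [rightAction, rightPair, tensorRight]
      rw [Preadditive.neg_comp, Preadditive.comp_neg, neg_neg]
      simp only [Category.assoc, Iso.inv_hom_id_assoc, ← whiskerLeft_comp_assoc, h₁]
    · rw [if_neg h0] at h₁
      rw [if_neg (by omega)]
      dsimp [rightAction, rightPair, tensorRight]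
      rw [Preadditive.neg_comp, Preadditive.comp_neg, neg_neg]
      simp only [Category.assoc, Iso.inv_hom_id_assoc, ← whiskerLeft_comp_assoc, h₁]
      simp
      rfl
  p_dn r hr Z := by
    refine Quiver.Hom.unop_inj ?_
    rw [unop_comp, right_dn]
    dsimp [rightAction, rightPair, tensorRight]
    rw [Preadditive.comp_neg]
    simp only [Category.assoc, Iso.inv_hom_id_assoc, ← whiskerLeft_comp_assoc, h₂ r hr]
    split_ifs
    · simp
    · simp
  q_eq Z := by
    refine Quiver.Hom.unop_inj ?_
    rw [unop_comp, right_dn, rightInversion, unop_rightT]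
    dsimp [rightAction, rightPair, tensorRight]
    rw [Preadditive.comp_neg]
    simp [h₃]

end Heis
end Heisenberg

/-! ### All relations for nonpositive charge. -/

namespace Heisenberg

namespace Heis

variable {R : Type u} [CommRing R] {k : ℤ}

theorem right_ccwZ_U (hk : k ≤ 0) (c' : 𝟙_ (Heis R k) ⟶ up ⊗ down)
    (d' : (down ⊗ up : Heis R k) ⟶ 𝟙_ (Heis R k)) (n : ℤ) (Z : (Heis R k)ᵒᵖ) :
    ((rightInversion hk).ccwZ (rightPair c' d') n ((rightAction R k).U.obj Z)).unop =
      (-((ρ_ (Z.unop ⊗ up)).inv ≫ (Z.unop ⊗ up) ◁ cwR c' n ≫ (ρ_ (Z.unop ⊗ up)).hom) :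
        Z.unop ⊗ up ⟶ Z.unop ⊗ up) :=
  right_ccwZ hk c' d' n _

theorem right_cwZ_U (hk : k ≤ 0) (c' : 𝟙_ (Heis R k) ⟶ up ⊗ down)
    (d' : (down ⊗ up : Heis R k) ⟶ 𝟙_ (Heis R k)) (n : ℤ) (Z : (Heis R k)ᵒᵖ) :
    ((rightInversion hk).cwZ (rightPair c' d') n ((rightAction R k).U.obj Z)).unop =
      (-((ρ_ (Z.unop ⊗ up)).inv ≫ (Z.unop ⊗ up) ◁ ccwR d' n ≫ (ρ_ (Z.unop ⊗ up)).hom) :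
        Z.unop ⊗ up ⟶ Z.unop ⊗ up) :=
  right_cwZ hk c' d' n _

theorem right_cp_U (c' : 𝟙_ (Heis R k) ⟶ up ⊗ down)
    (d' : (down ⊗ up : Heis R k) ⟶ 𝟙_ (Heis R k)) (n : ℕ) (Z : (Heis R k)ᵒᵖ) :
    ((rightPair c' d').cp n ((rightAction R k).U.obj Z)).unop =
      (-((α_ (Z.unop ⊗ up) down up).hom ≫ (Z.unop ⊗ up) ◁ dDot' d' n ≫ (ρ_ (Z.unop ⊗ up)).hom) :
        ((Z.unop ⊗ up) ⊗ down) ⊗ up ⟶ Z.unop ⊗ up) :=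
  right_cp c' d' n _

theorem right_dn_U (n : ℕ) (Z : (Heis R k)ᵒᵖ) :
    ((rightAction R k).dn n ((rightAction R k).U.obj Z)).unop =
      ((ρ_ (Z.unop ⊗ up)).inv ≫ (Z.unop ⊗ up) ◁ cDot n ≫ (α_ (Z.unop ⊗ up) down up).inv :
        Z.unop ⊗ up ⟶ ((Z.unop ⊗ up) ⊗ down) ⊗ up) :=
  right_dn n _

theorem unop_nsmul {X Y : (Heis R k)ᵒᵖ} (n : ℕ) (f : X ⟶ Y) : (n • f).unop = n • f.unop :=
  (unopHom X Y).map_nsmul n f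

theorem relations_right (hk : k ≤ 0) {c' : 𝟙_ (Heis R k) ⟶ up ⊗ down}
    {d' : (down ⊗ up : Heis R k) ⟶ 𝟙_ (Heis R k)}
    (h : (rightInversion hk).IsLeftward (rightPair c' d')) :
    Relations c' d' (cwR c') (ccwR d') where
  a_natCast n := by simp [cwR]
  b_natCast n := by simp [ccwR]
  a_of_lt n hn := cwR_of_lt hk c' n hn
  b_of_lt n hn := ccwR_of_lt hk h n hn
  grassmannian m := by
    have h1 := congrArg Quiver.Hom.unop (h.grassmannian_eq m (Opposite.op (𝟙_ _)))
    rw [unop_sum] at h1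
    simp only [unop_comp, right_cwZ, right_ccwZ, bubble_unit', Preadditive.neg_comp,
      Preadditive.comp_neg, neg_neg] at h1
    -- The right action turns clockwise bubbles into minus counterclockwise ones and conversely, so
    -- the factors of each product are exchanged.
    rw [Int.toNat_of_nonneg (by omega), ← Finset.Nat.sum_antidiagonal_swap] at h1
    simp only [Prod.fst_swap, Prod.snd_swap, sub_neg_eq_add, ← sub_eq_add_neg] at h1
    refine h1.trans ?_
    split_ifs
    · simp
    · simp
  t_t' N hN := by
    have h1 := congrArg Quiver.Hom.unop (h.tp_t (Opposite.op (𝟙_ _)))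
    rw [unop_comp, right_t, right_tp] at h1
    dsimp [rightAction, tensorRight] at h1
    rw [Preadditive.neg_comp, Preadditive.comp_neg, neg_neg] at h1
    simp only [Category.assoc, Iso.inv_hom_id_assoc, ← whiskerLeft_comp_assoc] at h1
    rw [Finset.sum_eq_zero, add_zero]
    · refine whiskerLeft_unit_injective ?_
      rw [← cancel_epi (α_ _ _ _).hom, ← cancel_mono (α_ _ _ _).inv, Category.assoc]
      refine h1.trans ?_
      simp
    · intro i _
      refine Finset.sum_eq_zero fun j _ => ?_
      rw [ccwR_of_lt hk h _ (by omega), if_neg (by omega)]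
      simp
  t'_t N hN := by
    refine whiskerLeft_unit_injective ?_
    rw [← cancel_epi (α_ _ _ _).hom, ← cancel_mono (α_ _ _ _).inv]
    have h1 := congrArg Quiver.Hom.unop (h.t_tp_eq (N := N) (by omega) (Opposite.op (𝟙_ _)))
    rw [unop_comp, unop_add, right_t, right_tp, unop_sum] at h1
    simp only [unop_sum, unop_comp, right_ccwZ, right_dn, right_cp] at h1
    dsimp [rightAction, tensorRight] at h1
    rw [Preadditive.neg_comp, Preadditive.comp_neg, neg_neg] at h1
    simp only [Preadditive.neg_comp, Preadditive.comp_neg, neg_neg] at h1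
    simp only [MonoidalPreadditive.whiskerLeft_add, whiskerLeft_sum, Preadditive.comp_sum,
      Preadditive.sum_comp, Preadditive.add_comp, Preadditive.comp_add]
    refine Eq.trans ?_ (h1.trans (congrArg₂ _ ?_ (Finset.sum_congr rfl fun i _ =>
      Finset.sum_congr rfl fun j _ => ?_)))
    · monoidal
    · monoidal
    · monoidal
  zigzag_up' := by
    refine whiskerLeft_unit_injective ?_
    have h1 := congrArg Quiver.Hom.unop (h.zigzag_up (Opposite.op (𝟙_ _)))
    dsimp [rightAction, rightPair, tensorRight] at h1
    simp only [neg_whiskerRight, Preadditive.neg_comp, Preadditive.comp_neg, neg_neg] at h1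
    have h2 := congrArg (fun f => 𝟙_ _ ◁ (λ_ up).hom ≫ f ≫ 𝟙_ _ ◁ (ρ_ up).inv) h1
    refine Eq.trans ?_ (h2.trans ?_)
    · monoidal
    · monoidal
  zigzag_down' := by
    refine whiskerLeft_unit_injective ?_
    have h1 := congrArg Quiver.Hom.unop (h.zigzag_down (Opposite.op (𝟙_ _)))
    dsimp [rightAction, rightPair, tensorRight] at h1
    simp only [neg_whiskerRight, Preadditive.neg_comp, Preadditive.comp_neg, neg_neg] at h1
    have h2 := congrArg (fun f => 𝟙_ _ ◁ (ρ_ down).hom ≫ f ≫ 𝟙_ _ ◁ (λ_ down).inv) h1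
    refine Eq.trans ?_ (h2.trans ?_)
    · monoidal
    · monoidal
  xRight_eq := by
    refine whiskerLeft_unit_injective ?_
    exact (right_y (Opposite.op (𝟙_ _))).symm.trans
      ((congrArg Quiver.Hom.unop (h.y_eq _)).symm.trans (right_yL c' d' _))
  sRight_eq := by
    refine whiskerLeft_unit_injective ?_
    rw [← cancel_epi (α_ _ _ _).hom, ← cancel_mono (α_ _ _ _).inv, Category.assoc, Category.assoc,
      ← neg_inj]
    exact (right_sR (Opposite.op (𝟙_ _))).symm.trans
      ((congrArg Quiver.Hom.unop (h.sL_eq _)).symm.trans (right_sL c' d' _))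
  curlLeft_eq n N hN := by
    refine whiskerLeft_unit_injective ?_
    -- The left curl is the right curl of the reversed action, after its dots have been moved to the
    -- other end of the loop.
    have h1 := congrArg Quiver.Hom.unop ((h.curlR_eq_cp n (Opposite.op (𝟙_ _))).trans
      (h.curlR_eq_sum n (N := N) (by omega) (Opposite.op (𝟙_ _))))
    rw [right_curlR, unop_neg, unop_sum] at h1
    simp only [unop_comp, right_xp, right_U_map, right_cwZ] at h1
    refine h1.trans ?_
    rw [whiskerLeft_sum]
    refine (Finset.sum_neg_distrib _).symm.trans (Finset.sum_congr rfl fun m _ => ?_)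
    dsimp [rightAction, tensorRight]
    rw [neg_whiskerRight, Preadditive.neg_comp]
    refine (neg_neg _).trans ?_
    rw [← bubbleLeft_id_comp, bubbleLeft_id]
    monoidal
  curlRight_eq n N hN := by
    refine whiskerLeft_unit_injective ?_
    have h1 := congrArg Quiver.Hom.unop ((h.curlL_eq_cn n (Opposite.op (𝟙_ _))).trans
      (h.curlL_eq_sum n (N := N) (by omega) (Opposite.op (𝟙_ _))))
    rw [right_curlL, unop_sum] at h1
    simp only [unop_comp, right_xp, right_ccwZ_U] at h1
    refine h1.trans ?_
    rw [whiskerLeft_neg, whiskerLeft_sum, ← Finset.sum_neg_distrib]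
    refine Finset.sum_congr rfl fun m _ => ?_
    dsimp [rightAction, tensorRight]
    rw [Preadditive.neg_comp, ← bubbleRight_id_comp, bubbleRight_id]
    refine congrArg _ ?_
    monoidal
  slide_b n N hN := by
    refine whiskerLeft_unit_injective ?_
    -- Orientation is exchanged: counterclockwise bubbles slide by the clockwise slide of the
    -- reversed action. The common sign of all bubbles drops out.
    have h1 := congrArg Quiver.Hom.unop (h.cwZ_slide n (N := N) (by omega) (Opposite.op (𝟙_ _)))
    rw [unop_sub, unop_sum, right_U_map, right_cwZ_U, right_cwZ] at h1
    simp only [unop_nsmul, unop_comp, right_U_map, right_xp, right_cwZ] at h1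
    dsimp [rightAction, tensorRight] at h1
    rw [whiskerLeft_sub, whiskerLeft_sum, ← neg_inj, neg_sub']
    refine Eq.trans ?_ (h1.trans (congrArg₂ _ ?_
      ((Finset.sum_congr rfl fun m _ => ?_).trans (Finset.sum_neg_distrib _))))
    · rw [bubbleRight_id]; refine congrArg _ ?_; monoidal
    · rw [bubbleLeft_id, neg_whiskerRight]; refine congrArg _ ?_; monoidal
    · rw [neg_whiskerRight, Preadditive.neg_comp, ← bubbleLeft_id_comp, bubbleLeft_id,
        whiskerLeft_nsmul]
      refine (smul_neg _ _).trans (congrArg _ (congrArg _ ?_))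
      monoidal
  slide_a n N hN := by
    refine whiskerLeft_unit_injective ?_
    have h1 := congrArg Quiver.Hom.unop (h.ccwZ_slide n (N := N) (by omega) (Opposite.op (𝟙_ _)))
    rw [unop_sub, unop_sum, right_U_map, right_ccwZ_U, right_ccwZ] at h1
    simp only [unop_nsmul, unop_comp, right_xp, right_ccwZ_U] at h1
    dsimp [rightAction, tensorRight] at h1
    rw [whiskerLeft_sub, whiskerLeft_sum, ← neg_inj, neg_sub']
    refine Eq.trans ?_ (h1.trans (congrArg₂ _ ?_
      ((Finset.sum_congr rfl fun m _ => ?_).trans (Finset.sum_neg_distrib _))))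
    · rw [bubbleLeft_id, neg_whiskerRight]; refine congrArg _ ?_; monoidal
    · rw [bubbleRight_id]; refine congrArg _ ?_; monoidal
    · rw [Preadditive.neg_comp, ← bubbleRight_id_comp, bubbleRight_id, whiskerLeft_nsmul]
      refine (smul_neg _ _).trans (congrArg _ (congrArg _ ?_))
      monoidal
  alt_of_nonneg hk' N hN := by
    rw [Finset.sum_eq_zero]
    · refine whiskerLeft_unit_injective ?_
      have h1 := congrArg Quiver.Hom.unop
        (h.altL_sub_altR_eq (N := 0) (by omega) (Opposite.op (𝟙_ _)))
      rw [Finset.range_zero, Finset.sum_empty, unop_sub, right_altL, right_altR] at h1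
      rw [← cancel_epi ((α_ _ _ _).hom ▷ up ≫ (α_ _ _ _).hom ≫ 𝟙_ _ ◁ (α_ up down up).hom),
        ← cancel_mono (𝟙_ _ ◁ (α_ _ _ _).inv ≫ (α_ _ _ _).inv ≫ (α_ (𝟙_ _) up down).inv ▷ up)]
      simp only [whiskerLeft_sub, Preadditive.comp_sub, Preadditive.sub_comp, Category.assoc,
        MonoidalPreadditive.whiskerLeft_zero, Limits.comp_zero, Limits.zero_comp]
      exact (neg_sub_neg _ _).symm.trans h1
    · intro i _
      refine Finset.sum_eq_zero fun j _ => Finset.sum_eq_zero fun n _ => ?_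
      rw [ccwR_of_lt hk h _ (by omega), if_neg (by omega), bubbleLeft_eq, bubbleLeft_id]
      simp
  alt_of_nonpos _ N hN := by
    refine whiskerLeft_unit_injective ?_
    have h1 := congrArg Quiver.Hom.unop
      (h.altL_sub_altR_eq (N := N) (by omega) (Opposite.op (𝟙_ _)))
    rw [unop_sub, right_altL, right_altR, unop_sum] at h1
    simp only [unop_sum, unop_comp, right_ccwZ_U, right_dn_U, right_xp, right_cp_U] at h1
    dsimp [rightAction, tensorRight] at h1
    rw [← cancel_epi ((α_ _ _ _).hom ▷ up ≫ (α_ _ _ _).hom ≫ 𝟙_ _ ◁ (α_ up down up).hom),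
      ← cancel_mono (𝟙_ _ ◁ (α_ _ _ _).inv ≫ (α_ _ _ _).inv ≫ (α_ (𝟙_ _) up down).inv ▷ up)]
    simp only [whiskerLeft_sub, whiskerLeft_sum, Preadditive.comp_sub, Preadditive.sub_comp,
      Preadditive.comp_sum, Preadditive.sum_comp, Category.assoc]
    -- The cup and cap indices are interchanged by the reversal of arrows.
    rw [Finset.sum_comm]
    refine (neg_sub_neg _ _).symm.trans (h1.trans (Finset.sum_congr rfl fun i _ =>
      Finset.sum_congr rfl fun j _ => Finset.sum_congr rfl fun n _ => ?_))
    simp only [Preadditive.comp_neg, Preadditive.neg_comp, neg_neg]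
    rw [show (-(j : ℤ) - i - n - 3) = -i - j - n - 3 by ring,
      show xPow n ⊗ₘ (dDot' d' i ≫ cDot j) = (up ◁ dDot' d' i ≫ (ρ_ up).hom) ≫
        xPow n ≫ (ρ_ up).inv ≫ up ◁ cDot j by
      rw [MonoidalCategory.tensorHom_def', whiskerLeft_comp, Category.assoc, whisker_exchange]
      monoidal,
      bubbleRight_comp, ← bubbleRight_id_comp, bubbleRight_id]
    monoidal
  tInv_eq := by
    refine whiskerLeft_unit_injective ?_
    rw [← cancel_epi (α_ _ _ _).hom, ← cancel_mono (α_ _ _ _).inv, Category.assoc, Category.assoc,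
      ← neg_inj]
    exact (unop_rightT (Opposite.op (𝟙_ _))).symm.trans
      ((congrArg Quiver.Hom.unop (h.T_eq _)).trans (right_tp c' d' _))
  cupInv_eq r := ⟨0, 0, by rw [cupInv, dif_neg (by omega)]; simp⟩
  capInv_eq r := by
    by_cases hr : r < (-k).toNat
    · refine ⟨(-k).toNat - r, fun i => -bubR (r + 1 + i), ?_⟩
      refine whiskerLeft_unit_injective ?_
      have h1 := congrArg Quiver.Hom.unop (h.E_eq r hr (Opposite.op (𝟙_ _)))
      rw [unop_neg, unop_sum] at h1
      simp only [unop_comp, right_al, right_cp] at h1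
      rw [← cancel_epi (α_ _ _ _).hom, ← cancel_mono (ρ_ _).hom, Category.assoc, Category.assoc]
      simp only [whiskerLeft_sum, Preadditive.comp_sum, Preadditive.sum_comp]
      refine (unop_rightE r (Opposite.op (𝟙_ _))).symm.trans (h1.trans
        ((Finset.sum_neg_distrib _).symm.trans (Finset.sum_congr rfl fun i _ => ?_)))
      dsimp [rightAction, tensorRight]
      simp only [Preadditive.neg_comp, Preadditive.comp_neg, whiskerLeft_neg]
      refine congrArg _ ((neg_neg _).trans ?_)
      monoidal
    · exact ⟨0, 0, by rw [capInv, dif_neg hr]; simp⟩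

/-- The candidate for the leftward cup for `k ≤ 0`. -/
def rightCup : 𝟙_ (Heis R k) ⟶ up ⊗ down := cDot (-k).toNat ≫ tInv

/-- The candidate for the leftward cap for `k ≤ 0`. -/
def rightCap : (down ⊗ up : Heis R k) ⟶ 𝟙_ (Heis R k) :=
  if k = 0 then tInv ≫ d else capInv ((-k).toNat - 1)

theorem relations_rightCup (hk : k ≤ 0) :
    Relations (rightCup (R := R) (k := k)) rightCap (cwR rightCup) (ccwR rightCap) := by
  refine relations_right hk (right_isLeftward hk ?_ ?_ rfl)
  · rw [rightCap]
    split_ifs with h0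
    · have h := t_tInv (R := R) (k := k)
      rw [show k.toNat = 0 by omega, Finset.range_zero, Finset.sum_empty, add_zero] at h
      rw [← Category.assoc, h, Category.id_comp]
    · rw [t_capInv (by omega)]
  · intro r hr
    rw [rightCap, if_neg (by omega), cDot_capInv hr (by omega)]
    by_cases h : r + 1 = (-k).toNat
    · rw [if_pos h, if_pos (by omega)]
    · rw [if_neg h, if_neg (by omega)]

/-- Uniqueness for the reversed action, in which the roles of `c'` and `d'` are exchanged. -/
theorem eq_rightCup (hk : k ≤ 0) {c' : 𝟙_ (Heis R k) ⟶ up ⊗ down}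
    {d' : (down ⊗ up : Heis R k) ⟶ 𝟙_ (Heis R k)} (ht : t ≫ t' c' d' = 𝟙 _)
    (hL : curlLeft d' 0 = if k = 0 then 𝟙 _ else 0)
    (hc : ∀ r < (-k).toNat, c ≫ dDot' d' r = if r + 1 = (-k).toNat then 𝟙 _ else 0) :
    c' = rightCup ∧ d' = rightCap := by
  have h : (rightInversion hk).IsLeftward (rightPair c' d') := by
    refine HeckeAction.Inversion.isLeftward_of_relations _ _ (fun Z => ?_) (fun Z => ?_)
      fun r hr Z => ?_
    · refine Quiver.Hom.unop_inj ?_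
      rw [unop_comp, right_t, right_tp]
      dsimp [rightAction, tensorRight]
      rw [Preadditive.neg_comp, Preadditive.comp_neg, neg_neg]
      simp only [Category.assoc, Iso.inv_hom_id_assoc, ← whiskerLeft_comp_assoc, ht]
      simp
    · refine Quiver.Hom.unop_inj ?_
      rw [right_curlR_zero, hL]
      by_cases h0 : k = 0
      · rw [if_pos h0, if_pos (by omega)]; simp; rfl
      · rw [if_neg h0, if_neg (by omega)]; simp; rfl
    · refine Quiver.Hom.unop_inj ?_
      rw [right_cw, hc r hr]
      split_ifs
      · simp
      · simp
  constructor
  · refine whiskerLeft_unit_injective ?_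
    rw [← cancel_epi (ρ_ _).inv, ← cancel_mono (α_ _ _ _).inv, Category.assoc, Category.assoc,
      ← neg_inj]
    refine (congrArg Quiver.Hom.unop (h.q_eq (Opposite.op (𝟙_ _)))).trans ?_
    rw [unop_comp, right_dn, rightInversion, unop_rightT]
    dsimp [rightAction, rightCup, tensorRight]
    rw [Preadditive.comp_neg]
    simp
  · refine whiskerLeft_unit_injective ?_
    rw [← cancel_epi (α_ _ _ _).hom, ← cancel_mono (ρ_ _).hom, Category.assoc, Category.assoc,
      ← neg_inj]
    refine (congrArg Quiver.Hom.unop (h.p_eq (Opposite.op (𝟙_ _)))).trans ?_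
    dsimp [rightCap, HeckeAction.Inversion.cupCap]
    by_cases h0 : k = 0
    · rw [if_pos h0, if_pos (by omega), unop_comp, rightInversion, unop_rightT]
      dsimp [rightAction, tensorRight]
      rw [Preadditive.neg_comp]
      simp
    · rw [if_neg h0, if_neg (by omega)]
      rfl

end Heis
end Heisenberg

/-! ### Determinantal bubbles, and existence and uniqueness of the leftward cup and cap. -/

namespace Heisenberg

/-- The coefficients of the inverse of a power series with constant term `1` are Toeplitz
determinants. -/
theorem eq_det_of_conv {S : Type*} [CommRing S] (f g : ℤ → S) (hf : f 0 = 1)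
    (hf' : ∀ n < 0, f n = 0) (hg' : ∀ n < 0, g n = 0)
    (h : ∀ m : ℕ, ∑ p ∈ Finset.HasAntidiagonal.antidiagonal m, f p.1 * g p.2 =
      if m = 0 then 1 else 0) (n : ℕ) :
    g n = Matrix.det (Matrix.of fun i j : Fin n => -f ((i : ℤ) - j + 1)) := by
  -- The Toeplitz matrices of two inverse series are inverse to each other. As `T` is unitriangular,
  -- its inverse is its adjugate, and `g n`, the lower left entry, is a signed minor.
  let T : Matrix (Fin (n + 1)) (Fin (n + 1)) S := Matrix.of fun i j => f ((i : ℤ) - j)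
  let G : Matrix (Fin (n + 1)) (Fin (n + 1)) S := Matrix.of fun i j => g ((i : ℤ) - j)
  have hTG : T * G = 1 := by
    ext i j
    rw [Matrix.mul_apply, Matrix.one_apply]
    simp only [T, G, Matrix.of_apply]
    rw [Fin.sum_univ_eq_sum_range (fun l : ℕ => f ((i : ℤ) - l) * g ((l : ℤ) - j)) (n + 1),
      -- Outside `j ≤ l ≤ i` one factor has a negative index and vanishes.
      ← Finset.sum_subset (s₁ := Finset.Ico (j : ℕ) (i + 1))]
    · rcases le_or_gt (j : ℕ) i with hij | hij
      · obtain ⟨m, hm⟩ := Nat.exists_eq_add_of_le hij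
        have h1 := h m
        rw [← Finset.Nat.sum_antidiagonal_swap,
          Finset.Nat.sum_antidiagonal_eq_sum_range_succ_mk] at h1
        rw [Finset.sum_Ico_eq_sum_range, show (i : ℕ) + 1 - j = m.succ by omega]
        refine Eq.trans (Finset.sum_congr rfl fun l hl => ?_) (h1.trans ?_)
        · have := Finset.mem_range.1 hl
          simp only [Prod.swap_prod_mk, hm]
          congr 2
          · push_cast
            omega
          · push_cast
            ring
        · simp only [Fin.ext_iff]
          by_cases hm0 : m = 0
          · rw [if_pos hm0, if_pos (by omega)]
          · rw [if_neg hm0, if_neg (by omega)]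
      · rw [Finset.Ico_eq_empty (by omega), Finset.sum_empty, if_neg]
        intro hij'
        rw [hij'] at hij
        exact lt_irrefl _ hij
    · intro l hl
      have := Finset.mem_Ico.1 hl
      exact Finset.mem_range.2 (by omega)
    · intro l _ hl
      rw [Finset.mem_Ico] at hl
      rcases lt_or_ge l (j : ℕ) with h1 | h1
      · rw [hg' _ (by omega), mul_zero]
      · rw [hf' _ (by omega), zero_mul]
  have hdet : T.det = 1 := by
    rw [Matrix.det_of_isLowerTriangular]
    · simp [T, hf]
    · intro i j hij
      have hij : i < j := hij
      exact hf' _ (by have := Fin.lt_def.1 hij; omega)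
  have hadj : T.adjugate = G := by
    rw [← Matrix.mul_one T.adjugate, ← hTG, ← Matrix.mul_assoc, Matrix.adjugate_mul, hdet,
      one_smul, Matrix.one_mul]
  have hG : g n = G (Fin.last n) 0 := by simp [G]
  rw [hG, ← hadj, Matrix.adjugate_fin_succ_eq_det_submatrix]
  -- Deleting the first row and last column shifts the index by one. The cofactor sign `(-1)ⁿ` is
  -- absorbed by negating all `n` rows.
  have hneg : (Matrix.of fun i j : Fin n => -f ((i : ℤ) - j + 1)) =
      -(T.submatrix (Fin.succAbove 0) (Fin.succAbove (Fin.last n))) := by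
    ext i j
    simp only [T, Matrix.of_apply, Matrix.neg_apply, Matrix.submatrix_apply, Fin.zero_succAbove,
      Fin.succAbove_last, Fin.val_succ, Fin.val_castSucc]
    congr 2
    push_cast
    ring
  rw [hneg, Matrix.det_neg]
  simp

namespace Heis

variable {R : Type u} [CommRing R] {k : ℤ}

section

variable {c' : 𝟙_ (Heis R k) ⟶ up ⊗ down} {d' : (down ⊗ up : Heis R k) ⟶ 𝟙_ (Heis R k)}
  {a b : ℤ → End (𝟙_ (Heis R k))}

theorem Relations.sum_mul (h : Relations c' d' a b) (m : ℕ) :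
    ∑ p ∈ Finset.HasAntidiagonal.antidiagonal m, a (p.1 + k - 1) * b (p.2 - k - 1) =
      if m = 0 then -1 else 0 := by
  refine (Finset.sum_congr rfl fun p _ => mul_comm _ _).trans ((h.grassmannian m).trans ?_)
  split_ifs <;> rfl

/-- After shifting the indices, the Grassmannian relation says that `-a` and `b` are inverse series
with constant term `1`, so `eq_det_of_conv` applies. -/
theorem Relations.eq_ccw (h : Relations c' d' a b) (n : ℤ) : ccw c' d' n = b n := by
  rw [ccw]
  split_ifs with h0 h1
  · obtain ⟨m, rfl⟩ := Int.eq_ofNat_of_zero_le h0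
    exact (h.b_natCast m).symm
  · rw [h.b_of_lt n (by omega), if_neg (by omega)]
  · have h2 := eq_det_of_conv (fun m => -a (m + k - 1)) (fun m => b (m - k - 1)) ?_ ?_ ?_ ?_
      (n + k + 1).toNat
    · simp only [Int.toNat_of_nonneg (not_lt.1 h1), neg_neg] at h2
      rw [show n + k + 1 - k - 1 = n by ring] at h2
      rw [h2]
      congr 2
      ext i j
      have := i.2
      have := j.2
      -- As `n < 0`, the matrix has size `n + k + 1 ≤ k`, so `i - j + k` is positive and `toNat`
      -- loses nothing.
      rw [show (i : ℤ) - j + 1 + k - 1 = (((i : ℤ) - j + k).toNat : ℤ) by omega]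
      exact (h.a_natCast _).symm
    · rw [h.a_of_lt _ (by omega), if_pos (by omega)]
      exact neg_neg _
    · intro m hm
      rw [h.a_of_lt _ (by omega), if_neg (by omega)]
      exact neg_zero
    · intro m hm
      rw [h.b_of_lt _ (by omega), if_neg (by omega)]
    · intro m
      simp only [neg_mul, Finset.sum_neg_distrib]
      rw [h.sum_mul]
      split_ifs <;> simp

theorem Relations.eq_cw (h : Relations c' d' a b) (n : ℤ) : cw c' d' n = a n := by
  rw [cw]
  split_ifs with h0 h1
  · obtain ⟨m, rfl⟩ := Int.eq_ofNat_of_zero_le h0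
    exact (h.a_natCast m).symm
  · rw [h.a_of_lt n (by omega), if_neg (by omega)]
  · have h2 := eq_det_of_conv (fun m => b (m - k - 1)) (fun m => -a (m + k - 1)) ?_ ?_ ?_ ?_
      (n - k + 1).toNat
    · simp only [Int.toNat_of_nonneg (not_lt.1 h1)] at h2
      rw [show n - k + 1 + k - 1 = n by ring] at h2
      rw [← neg_neg (a n), h2]
      congr 3
      ext i j
      have := i.2
      have := j.2
      rw [show (i : ℤ) - j + 1 - k - 1 = (((i : ℤ) - j - k).toNat : ℤ) by omega]
      exact congrArg _ (h.b_natCast _).symm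
    · rw [h.b_of_lt _ (by omega), if_pos (by omega)]
      rfl
    · intro m hm
      rw [h.b_of_lt _ (by omega), if_neg (by omega)]
    · intro m hm
      rw [h.a_of_lt _ (by omega), if_neg (by omega)]
      exact neg_zero
    · intro m
      rw [← Finset.Nat.sum_antidiagonal_swap]
      simp only [Prod.fst_swap, Prod.snd_swap, mul_comm (b _), neg_mul, Finset.sum_neg_distrib]
      rw [h.sum_mul]
      split_ifs <;> simp

/-- The bubble sequences depended on the sign of `k` through the inverse; now they are the intrinsic
ones, and both signs are treated alike. -/
theorem Relations.self (h : Relations c' d' a b) : Relations c' d' (cw c' d') (ccw c' d') := by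
  rw [show cw c' d' = a from funext h.eq_cw, show ccw c' d' = b from funext h.eq_ccw]
  exact h

end

theorem bubbleLeft_zero {X Y : Heis R k} (f : X ⟶ Y) :
    bubbleLeft (0 : 𝟙_ (Heis R k) ⟶ 𝟙_ (Heis R k)) f = 0 := by
  rw [bubbleLeft_eq, bubbleLeft_id]
  simp

theorem bubbleRight_zero {X Y : Heis R k} (f : X ⟶ Y) :
    bubbleRight f (0 : 𝟙_ (Heis R k) ⟶ 𝟙_ (Heis R k)) = 0 := by
  rw [bubbleRight_eq, bubbleRight_id]
  simp

theorem bubbleLeft_one (X : Heis R k) :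
    bubbleLeft (𝟙 (𝟙_ (Heis R k))) (𝟙 X) = 𝟙 X := by
  rw [bubbleLeft_id]
  simp

theorem bubbleRight_neg_one (X : Heis R k) :
    bubbleRight (𝟙 X) (-𝟙 (𝟙_ (Heis R k))) = -𝟙 X := by
  rw [bubbleRight_id, whiskerLeft_neg]
  simp

theorem bubbleLeft_comp_unit {X Y : Heis R k} (B : 𝟙_ (Heis R k) ⟶ 𝟙_ (Heis R k))
    (f : X ⟶ 𝟙_ (Heis R k)) (g : 𝟙_ (Heis R k) ⟶ Y) : bubbleLeft B (f ≫ g) = f ≫ B ≫ g := by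
  rw [bubbleLeft_comp, ← bubbleLeft_id_comp, bubbleLeft_id, bubble_unit]

theorem bubbleRight_comp_unit {X Y : Heis R k} (B : 𝟙_ (Heis R k) ⟶ 𝟙_ (Heis R k))
    (f : X ⟶ 𝟙_ (Heis R k)) (g : 𝟙_ (Heis R k) ⟶ Y) : bubbleRight (f ≫ g) B = f ≫ B ≫ g := by
  rw [bubbleRight_comp, ← bubbleRight_id_comp, bubbleRight_id, bubble_unit']

/-- A finite support inside a square turns the unrestricted sums of the statement into the bounded
ones of `Relations`. -/
theorem finsum_prod_eq {M : Type*} [AddCommMonoid M] (F : ℕ × ℕ → M) (N : ℕ)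
    (h : ∀ p, N ≤ p.1 + p.2 → F p = 0) :
    ∑ᶠ p, F p = ∑ i ∈ Finset.range N, ∑ j ∈ Finset.range N, F (i, j) := by
  rw [← Finset.sum_product', finsum_eq_sum_of_support_subset]
  intro p hp
  rw [Finset.coe_product, Set.mem_prod, Finset.mem_coe, Finset.mem_coe, Finset.mem_range,
    Finset.mem_range]
  by_contra hc
  exact hp (h p (by omega))

theorem finsum_prod_prod_eq {M : Type*} [AddCommMonoid M] (F : ℕ × ℕ × ℕ → M) (N : ℕ)
    (h : ∀ p, N ≤ p.1 + p.2.1 + p.2.2 → F p = 0) :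
    ∑ᶠ p, F p = ∑ i ∈ Finset.range N, ∑ j ∈ Finset.range N, ∑ n ∈ Finset.range N, F (i, j, n) := by
  simp only [← Finset.sum_product']
  rw [finsum_eq_sum_of_support_subset]
  intro p hp
  rw [Finset.coe_product, Set.mem_prod, Finset.coe_product, Set.mem_prod, Finset.mem_coe,
    Finset.mem_coe, Finset.mem_coe, Finset.mem_range, Finset.mem_range, Finset.mem_range]
  by_contra hc
  exact hp (h p (by omega))

theorem finsum_nat_eq {M : Type*} [AddCommMonoid M] (F : ℕ → M) (N : ℕ)
    (h : ∀ n, N ≤ n → F n = 0) : ∑ᶠ n, F n = ∑ i ∈ Finset.range N, F i := by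
  rw [finsum_eq_sum_of_support_subset]
  intro n hn
  rw [Finset.mem_coe, Finset.mem_range]
  by_contra hc
  exact hn (h n (by omega))

section

variable {c' : 𝟙_ (Heis R k) ⟶ up ⊗ down} {d' : (down ⊗ up : Heis R k) ⟶ 𝟙_ (Heis R k)}

theorem Relations.cw_eq_zero (h : Relations c' d' (cw c' d') (ccw c' d')) {n : ℤ}
    (hn : n < k - 1) : cw c' d' n = 0 :=
  (h.a_of_lt n (by omega)).trans (if_neg (by omega))

theorem Relations.ccw_eq_zero (h : Relations c' d' (cw c' d') (ccw c' d')) {n : ℤ}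
    (hn : n < -k - 1) : ccw c' d' n = 0 :=
  (h.b_of_lt n (by omega)).trans (if_neg (by omega))

theorem Relations.isLeftwardCupCap (h : Relations c' d' (cw c' d') (ccw c' d')) :
    IsLeftwardCupCap c' d' where
  t_comp_t' := by
    rw [h.t_t' k.natAbs le_rfl, finsum_prod_eq _ k.natAbs]
    · simp only [bubbleRight_comp_unit]
    · intro p hp
      rw [h.ccw_eq_zero (by omega)]
      exact bubbleRight_zero _
  t'_comp_t := by
    rw [h.t'_t k.natAbs le_rfl, finsum_prod_eq _ k.natAbs]
    · simp only [bubbleLeft_comp_unit]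
    · intro p hp
      rw [h.cw_eq_zero (by omega)]
      exact bubbleLeft_zero _
  curlRight_zero hk := by
    -- Only the bubble with `-1` dots can be nonzero, and it is `-1` exactly for `k = 0`.
    rw [h.curlRight_eq 0 (k.natAbs + 1) (by omega), Finset.sum_eq_single 0]
    · have h1 := h.a_of_lt (-1) (by omega)
      rw [show ((0 : ℕ) : ℤ) - (0 : ℕ) - 1 = -1 by simp, h1, xPow_zero]
      by_cases h0 : k = 0
      · rw [if_pos (by omega), if_pos h0, bubbleRight_neg_one, neg_neg]
      · rw [if_neg (by omega), if_neg h0, bubbleRight_zero]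
        exact neg_zero
    · intro m _ hm
      rw [h.cw_eq_zero (by omega)]
      exact bubbleRight_zero _
    · simp
  cw_eq r _ hr := (h.a_of_lt r hr).trans (by split_ifs <;> rfl)
  curlLeft_zero hk := by
    rw [h.curlLeft_eq 0 (k.natAbs + 1) (by omega), Finset.sum_eq_single 0]
    · have h1 := h.b_of_lt (-1) (by omega)
      rw [show ((0 : ℕ) : ℤ) - (0 : ℕ) - 1 = -1 by simp, h1, xPow_zero]
      by_cases h0 : k = 0
      · rw [if_pos (by omega), if_pos h0, bubbleLeft_one]
      · rw [if_neg (by omega), if_neg h0, bubbleLeft_zero]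
    · intro m _ hm
      rw [h.ccw_eq_zero (by omega)]
      exact bubbleLeft_zero _
    · simp
  ccw_eq r _ hr := (h.b_of_lt r hr).trans (by split_ifs <;> rfl)

theorem IsLeftwardCupCap.eq_leftCup (h : IsLeftwardCupCap c' d') (hk : 0 ≤ k) :
    c' = leftCup ∧ d' = leftCap := by
  refine Heis.eq_leftCup hk ?_ (h.curlRight_zero hk) fun r hr => ?_
  · rw [h.t'_comp_t, finsum_eq_zero_of_forall_eq_zero, add_zero]
    intro p
    -- For `k ≥ 0` and at most `-2` dots the bubble vanishes by definition, being a determinant of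
    -- negative size; no relation is needed.
    rw [cw, if_neg (by omega), if_pos (by omega)]
    exact bubbleLeft_zero _
  · have h1 := h.cw_eq r (by omega) (by omega)
    rw [cw, if_pos (by omega)] at h1
    refine h1.trans ?_
    by_cases h2 : r + 1 = k.toNat
    · rw [if_pos h2, if_pos (by omega)]; rfl
    · rw [if_neg h2, if_neg (by omega)]

theorem IsLeftwardCupCap.eq_rightCup (h : IsLeftwardCupCap c' d') (hk : k ≤ 0) :
    c' = rightCup ∧ d' = rightCap := by
  refine Heis.eq_rightCup hk ?_ (h.curlLeft_zero hk) fun r hr => ?_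
  · rw [h.t_comp_t', finsum_eq_zero_of_forall_eq_zero, add_zero]
    intro p
    rw [ccw, if_neg (by omega), if_pos (by omega)]
    exact bubbleRight_zero _
  · have h1 := h.ccw_eq r (by omega) (by omega)
    rw [ccw, if_pos (by omega)] at h1
    refine h1.trans ?_
    by_cases h2 : r + 1 = (-k).toNat
    · rw [if_pos h2, if_pos (by omega)]; rfl
    · rw [if_neg h2, if_neg (by omega)]

/-- By uniqueness the given pair is the constructed one, for which all relations are known. -/
theorem IsLeftwardCupCap.relations (h : IsLeftwardCupCap c' d') :
    Relations c' d' (cw c' d') (ccw c' d') := by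
  rcases le_total 0 k with hk | hk
  · obtain ⟨rfl, rfl⟩ := h.eq_leftCup hk
    exact (relations_leftCup hk).self
  · obtain ⟨rfl, rfl⟩ := h.eq_rightCup hk
    exact (relations_rightCup hk).self

end

theorem existsUnique_isLeftwardCupCap :
    ∃! p : (𝟙_ (Heis R k) ⟶ up ⊗ down) × ((down ⊗ up : Heis R k) ⟶ 𝟙_ (Heis R k)),
      IsLeftwardCupCap p.1 p.2 := by
  rcases le_total 0 k with hk | hk
  · exact ⟨(leftCup, leftCap), (relations_leftCup hk).self.isLeftwardCupCap,
      fun p hp => Prod.ext (hp.eq_leftCup hk).1 (hp.eq_leftCup hk).2⟩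
  · exact ⟨(rightCup, rightCap), (relations_rightCup hk).self.isLeftwardCupCap,
      fun p hp => Prod.ext (hp.eq_rightCup hk).1 (hp.eq_rightCup hk).2⟩

section

variable {c' : 𝟙_ (Heis R k) ⟶ up ⊗ down} {d' : (down ⊗ up : Heis R k) ⟶ 𝟙_ (Heis R k)}

theorem Relations.grassmannian_cw (h : Relations c' d' (cw c' d') (ccw c' d')) (m : ℕ) :
    ∑ p ∈ Finset.HasAntidiagonal.antidiagonal m,
      bubbleLeft (cw c' d' (p.1 + k - 1)) (ccw c' d' (p.2 - k - 1)) =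
        if m = 0 then -𝟙 (𝟙_ (Heis R k)) else 0 := by
  rw [← h.grassmannian m]
  refine Finset.sum_congr rfl fun p _ => ?_
  rw [← bubbleLeft_id_comp, bubbleLeft_id, bubble_unit]

theorem Relations.curlLeft_eq_finsum (h : Relations c' d' (cw c' d') (ccw c' d')) (r : ℕ) :
    curlLeft d' r = ∑ᶠ n : ℕ, bubbleLeft (ccw c' d' (r - n - 1)) (xPow n) := by
  rw [h.curlLeft_eq r (r + k.natAbs + 1) (by omega), finsum_nat_eq]
  intro n hn
  rw [h.ccw_eq_zero (by omega)]
  exact bubbleLeft_zero _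

theorem Relations.curlRight_eq_finsum (h : Relations c' d' (cw c' d') (ccw c' d')) (r : ℕ) :
    curlRight c' r = -∑ᶠ n : ℕ, bubbleRight (xPow n) (cw c' d' (r - n - 1)) := by
  rw [h.curlRight_eq r (r + k.natAbs + 1) (by omega), finsum_nat_eq]
  intro n hn
  rw [h.cw_eq_zero (by omega)]
  exact bubbleRight_zero _

theorem Relations.slide_ccw (h : Relations c' d' (cw c' d') (ccw c' d')) (r : ℤ) :
    bubbleRight (𝟙 up) (ccw c' d' r) = bubbleLeft (ccw c' d' r) (𝟙 up) -
      ∑ᶠ n : ℕ, (n + 1) • bubbleLeft (ccw c' d' (r - n - 2)) (xPow n) := by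
  rw [h.slide_b r ((r + k.natAbs).toNat + 1) (by omega), finsum_nat_eq]
  intro n hn
  rw [h.ccw_eq_zero (by omega)]
  exact (congrArg _ (bubbleLeft_zero _)).trans (smul_zero _)

theorem Relations.slide_cw (h : Relations c' d' (cw c' d') (ccw c' d')) (r : ℤ) :
    bubbleLeft (cw c' d' r) (𝟙 up) = bubbleRight (𝟙 up) (cw c' d' r) -
      ∑ᶠ n : ℕ, (n + 1) • bubbleRight (xPow n) (cw c' d' (r - n - 2)) := by
  rw [h.slide_a r ((r + k.natAbs).toNat + 1) (by omega), finsum_nat_eq]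
  intro n hn
  rw [h.cw_eq_zero (by omega)]
  exact (congrArg _ (bubbleRight_zero _)).trans (smul_zero _)

theorem Relations.altLeft_sub_of_nonneg (h : Relations c' d' (cw c' d') (ccw c' d'))
    (hk : 0 ≤ k) : altLeft c' d' - altRight c' d' =
      ∑ᶠ q : ℕ × ℕ × ℕ, bubbleLeft (ccw c' d' (-q.1 - q.2.1 - q.2.2 - 3))
        (𝟙 _ ⊗≫ ((dDot q.2.1 ≫ cDot' c' q.1) ⊗ₘ xPow q.2.2) ⊗≫ 𝟙 _) := by
  rw [h.alt_of_nonneg hk k.natAbs le_rfl, finsum_prod_prod_eq]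
  intro p hp
  rw [h.ccw_eq_zero (by omega)]
  exact bubbleLeft_zero _

theorem Relations.altLeft_sub_of_nonpos (h : Relations c' d' (cw c' d') (ccw c' d'))
    (hk : k ≤ 0) : altLeft c' d' - altRight c' d' =
      ∑ᶠ q : ℕ × ℕ × ℕ, bubbleRight (xPow q.2.2 ⊗ₘ (dDot' d' q.2.1 ≫ cDot q.1))
        (cw c' d' (-q.1 - q.2.1 - q.2.2 - 3)) := by
  rw [h.alt_of_nonpos hk k.natAbs le_rfl, finsum_prod_prod_eq]
  intro p hp
  rw [h.cw_eq_zero (by omega)]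
  exact bubbleRight_zero _

theorem Relations.altLeft_sub_eq_zero (h : Relations c' d' (cw c' d') (ccw c' d'))
    (hk : -1 ≤ k) (hk' : k ≤ 1) : altLeft c' d' - altRight c' d' = 0 := by
  rcases le_total 0 k with h0 | h0
  · rw [h.altLeft_sub_of_nonneg h0, finsum_eq_zero_of_forall_eq_zero]
    intro p
    -- At most `-3` dots is below the threshold `-k - 1` because `k ≤ 1`.
    rw [h.ccw_eq_zero (by omega)]
    exact bubbleLeft_zero _
  · rw [h.altLeft_sub_of_nonpos h0, finsum_eq_zero_of_forall_eq_zero]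
    intro p
    rw [h.cw_eq_zero (by omega)]
    exact bubbleRight_zero _

end

end Heis
end Heisenberg

/-! ### Duals, mates and nested cups and caps. -/

namespace Heisenberg

section Duality

universe v w

variable {C : Type w} [Category.{v} C] [MonoidalCategory C]

/-- The morphisms `η` and `ε` exhibit `X'` as a right dual of `X`. -/
structure IsDual {X X' : C} (η : 𝟙_ C ⟶ X ⊗ X') (ε : X' ⊗ X ⟶ 𝟙_ C) : Prop where
  coev_ev : X' ◁ η ≫ (α_ _ _ _).inv ≫ ε ▷ X' = (ρ_ X').hom ≫ (λ_ X').inv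
  ev_coev : η ▷ X ≫ (α_ _ _ _).hom ≫ X ◁ ε = (λ_ X).hom ≫ (ρ_ X).inv

/-- The exact pairing given by a pair of morphisms satisfying the zigzag identities. -/
@[reducible] def IsDual.exactPairing {X X' : C} {η : 𝟙_ C ⟶ X ⊗ X'} {ε : X' ⊗ X ⟶ 𝟙_ C}
    (h : IsDual η ε) : ExactPairing X X' :=
  ⟨η, ε, h.coev_ev, h.ev_coev⟩

/-- The cup nesting one cup inside another one. -/
def tensCup {A A' W W' : C} (outer : 𝟙_ C ⟶ A ⊗ A') (inner : 𝟙_ C ⟶ W ⊗ W') :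
    𝟙_ C ⟶ (A ⊗ W) ⊗ (W' ⊗ A') :=
  outer ≫ A ◁ ((λ_ A').inv ≫ inner ▷ A' ≫ (α_ W W' A').hom) ≫ (α_ A W (W' ⊗ A')).inv

/-- The cap nesting one cap inside another one. -/
def tensCap {A A' W W' : C} (inner : A' ⊗ A ⟶ 𝟙_ C) (outer : W' ⊗ W ⟶ 𝟙_ C) :
    (W' ⊗ A') ⊗ (A ⊗ W) ⟶ 𝟙_ C :=
  (α_ W' A' (A ⊗ W)).hom ≫ W' ◁ ((α_ A' A W).inv ≫ inner ▷ W ≫ (λ_ W).hom) ≫ outer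

theorem IsDual.tensor {A A' W W' : C} {η : 𝟙_ C ⟶ A ⊗ A'} {ε : A' ⊗ A ⟶ 𝟙_ C}
    {η' : 𝟙_ C ⟶ W ⊗ W'} {ε' : W' ⊗ W ⟶ 𝟙_ C} (h : IsDual η ε) (h' : IsDual η' ε') :
    IsDual (tensCup η η') (tensCap ε ε') := by
  let := h.exactPairing
  let := h'.exactPairing
  have hη : tensCup η η' = (ExactPairing.tensor (X₁ := A) (X₂ := W)).coevaluation' := by
    change _ = η ⊗≫ (A ◁ η') ▷ A' ⊗≫ 𝟙 _
    rw [tensCup]; monoidal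
  have hε : tensCap ε ε' = (ExactPairing.tensor (X₁ := A) (X₂ := W)).evaluation' := by
    change _ = 𝟙 _ ⊗≫ W' ◁ (ε ▷ W) ⊗≫ ε'
    rw [tensCap]; monoidal
  rw [hη, hε]
  exact ⟨ExactPairing.coevaluation_evaluation', ExactPairing.evaluation_coevaluation'⟩

theorem IsDual.unit : IsDual (λ_ (𝟙_ C)).inv (λ_ (𝟙_ C)).hom where
  coev_ev := by monoidal
  ev_coev := by monoidal

theorem IsDual.of_eq_right {X X' X'' : C} {η : 𝟙_ C ⟶ X ⊗ X'} {ε : X' ⊗ X ⟶ 𝟙_ C}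
    (h : IsDual η ε) (e : X'' = X') :
    IsDual (η ≫ X ◁ eqToHom e.symm) (eqToHom e ▷ X ≫ ε) := by
  subst e; simpa using h

theorem IsDual.of_eq_left {X X' X'' : C} {η : 𝟙_ C ⟶ X ⊗ X'} {ε : X' ⊗ X ⟶ 𝟙_ C}
    (h : IsDual η ε) (e : X'' = X) :
    IsDual (η ≫ eqToHom e.symm ▷ X') (X' ◁ eqToHom e ≫ ε) := by
  subst e; simpa using h

/-- The morphisms `f` and `g` are mates under two pairings. -/
def IsMate {A A' B B' : C} (ε : A ⊗ B ⟶ 𝟙_ C) (ε' : A' ⊗ B' ⟶ 𝟙_ C)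
    (g : A ⟶ A') (f : B' ⟶ B) : Prop :=
  A ◁ f ≫ ε = g ▷ B' ≫ ε'

theorem IsMate.id {A B : C} (ε : A ⊗ B ⟶ 𝟙_ C) : IsMate ε ε (𝟙 A) (𝟙 B) := by
  simp [IsMate]

theorem IsMate.comp {A A' A'' B B' B'' : C} {ε : A ⊗ B ⟶ 𝟙_ C} {ε' : A' ⊗ B' ⟶ 𝟙_ C}
    {ε'' : A'' ⊗ B'' ⟶ 𝟙_ C} {g : A ⟶ A'} {f : B' ⟶ B} {g' : A' ⟶ A''} {f' : B'' ⟶ B'}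
    (h : IsMate ε ε' g f) (h' : IsMate ε' ε'' g' f') : IsMate ε ε'' (g ≫ g') (f' ≫ f) := by
  simp only [IsMate] at *
  rw [comp_whiskerRight, Category.assoc, ← h', ← whisker_exchange_assoc, ← h,
    MonoidalCategory.whiskerLeft_comp, Category.assoc]

/-- Inside the nested caps the inner morphism is moved across first, then the outer one; interchange
does the rest. -/
theorem IsMate.tensor {A A' B B' V V' W W' : C} {ε : A ⊗ B ⟶ 𝟙_ C} {ε' : A' ⊗ B' ⟶ 𝟙_ C}
    {δ : V ⊗ W ⟶ 𝟙_ C} {δ' : V' ⊗ W' ⟶ 𝟙_ C} {g : A ⟶ A'} {f : B' ⟶ B} {g' : V ⟶ V'}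
    {f' : W' ⟶ W} (h : IsMate ε ε' g f) (h' : IsMate δ δ' g' f') :
    IsMate (tensCap ε δ) (tensCap ε' δ') (g' ⊗ₘ g) (f ⊗ₘ f') := by
  simp only [IsMate, tensCap] at *
  rw [MonoidalCategory.tensorHom_def f f', MonoidalCategory.tensorHom_def' g' g]
  have e := congrArg (fun p => (α_ V A (B' ⊗ W')).hom ≫
    V ◁ ((α_ A B' W').inv ≫ (A ◁ f) ▷ W' ≫ p ≫ (λ_ W).hom) ≫ δ) (whisker_exchange ε f')
  have e₁ := congrArg₂ (fun p q => (α_ V A (B' ⊗ W')).hom ≫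
    V ◁ ((α_ A B' W').inv ≫ p ▷ W' ≫ (λ_ W').hom) ≫ q) h h'
  have e₂ := congrArg (fun p => (V ◁ g) ▷ (B' ⊗ W') ≫ (α_ V A' (B' ⊗ W')).hom ≫ p ≫ δ')
    (whisker_exchange g' ((α_ A' B' W').inv ≫ ε' ▷ W' ≫ (λ_ W').hom))
  refine Eq.trans ?_ (e.trans ?_)
  · monoidal
  refine Eq.trans ?_ (e₁.trans ?_)
  · monoidal
  refine Eq.trans ?_ (e₂.trans ?_)
  · monoidal
  · monoidal

theorem IsMate.of_eq_left {A A' B B' V V' : C} {ε : A ⊗ B ⟶ 𝟙_ C} {ε' : A' ⊗ B' ⟶ 𝟙_ C}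
    {g : A ⟶ A'} {f : B' ⟶ B} (h : IsMate ε ε' g f) (e : V = A) (e' : V' = A') :
    IsMate (eqToHom e ▷ B ≫ ε) (eqToHom e' ▷ B' ≫ ε')
      (eqToHom e ≫ g ≫ eqToHom e'.symm) f := by
  subst e e'; simpa using h

theorem IsMate.of_eq_right {A A' B B' V V' : C} {ε : A ⊗ B ⟶ 𝟙_ C} {ε' : A' ⊗ B' ⟶ 𝟙_ C}
    {g : A ⟶ A'} {f : B' ⟶ B} (h : IsMate ε ε' g f) (e : V = B) (e' : V' = B') :
    IsMate (A ◁ eqToHom e ≫ ε) (A' ◁ eqToHom e' ≫ ε')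
      g (eqToHom e' ≫ f ≫ eqToHom e.symm) := by
  subst e e'; simpa using h

theorem IsMate.rightMate {X X' Y Y' : C} {η : 𝟙_ C ⟶ X ⊗ X'} {ε : X' ⊗ X ⟶ 𝟙_ C}
    (h : IsDual η ε) (δ : Y' ⊗ Y ⟶ 𝟙_ C) (f : X ⟶ Y) :
    IsMate δ ε ((ρ_ _).inv ≫ _ ◁ η ≫ _ ◁ f ▷ _ ≫ (α_ _ _ _).inv ≫ δ ▷ _ ≫ (λ_ _).hom) f := by
  have e := congrArg (fun p => Y' ◁ (λ_ X).inv ≫ Y' ◁ p ≫ Y' ◁ (ρ_ X).hom ≫ Y' ◁ f ≫ δ) h.ev_coev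
  have e₁ := congrArg (fun p => Y' ◁ ((λ_ X).inv ≫ η ▷ X ≫ (α_ X X' X).hom ≫ p ≫ (ρ_ Y).hom) ≫ δ)
    (whisker_exchange f ε)
  have e₂ := congrArg (fun p => Y' ◁ ((λ_ X).inv ≫ η ▷ X ≫ (α_ X X' X).hom ≫ f ▷ (X' ⊗ X)) ≫
    (α_ Y' Y (X' ⊗ X)).inv ≫ p ≫ (λ_ _).hom) (whisker_exchange δ ε)
  refine Eq.trans ?_ (e.symm.trans (Eq.trans ?_ (e₁.trans (Eq.trans ?_ (e₂.trans ?_)))))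
  all_goals monoidal

/-- A zigzag recovers `g` from the pairing it induces, so mates are unique. Two composites are
proved equal by exhibiting one morphism that is a mate in both senses. -/
theorem IsMate.eq_rightMate {X X' Y Y' : C} {η : 𝟙_ C ⟶ X ⊗ X'} {ε : X' ⊗ X ⟶ 𝟙_ C}
    (h : IsDual η ε) {δ : Y' ⊗ Y ⟶ 𝟙_ C} {f : X ⟶ Y} {g : Y' ⟶ X'} (hg : IsMate δ ε g f) :
    g = (ρ_ _).inv ≫ _ ◁ η ≫ _ ◁ f ▷ _ ≫ (α_ _ _ _).inv ≫ δ ▷ _ ≫ (λ_ _).hom := by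
  have e₁ := congrArg (fun p => (ρ_ _).inv ≫ _ ◁ η ≫ (α_ _ _ _).inv ≫ p ▷ _ ≫ (λ_ _).hom) hg
  have e₂ := congrArg (fun p => (ρ_ _).inv ≫ g ▷ _ ≫ p ≫ (λ_ _).hom) h.coev_ev
  refine (Eq.trans ?_ e₂.symm).trans (Eq.trans ?_ e₁.symm |>.trans ?_)
  · monoidal
  · rw [comp_whiskerRight, Category.assoc, Category.assoc, ← whisker_exchange_assoc]
    monoidal
  · monoidal

theorem IsMate.leftMate {X X' Y Y' : C} {η : 𝟙_ C ⟶ X' ⊗ X} {ε : X ⊗ X' ⟶ 𝟙_ C}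
    (h : IsDual η ε) (δ : Y ⊗ Y' ⟶ 𝟙_ C) (f : X ⟶ Y) :
    IsMate ε δ f ((λ_ _).inv ≫ η ▷ _ ≫ (_ ◁ f) ▷ _ ≫ (α_ _ _ _).hom ≫ _ ◁ δ ≫ (ρ_ _).hom) := by
  have e := congrArg (fun p => (ρ_ X).inv ▷ Y' ≫ p ▷ Y' ≫ (λ_ X).hom ▷ Y' ≫ f ▷ Y' ≫ δ) h.coev_ev
  have e₁ := congrArg (fun p => ((ρ_ X).inv ≫ X ◁ η ≫ (α_ X X' X).inv ≫ p ≫ (λ_ Y).hom) ▷ Y' ≫ δ)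
    (whisker_exchange ε f)
  have e₂ := congrArg (fun p => ((ρ_ X).inv ≫ X ◁ η ≫ (α_ X X' X).inv ≫ (X ⊗ X') ◁ f) ▷ Y' ≫
    (α_ (X ⊗ X') Y Y').hom ≫ p ≫ (λ_ _).hom) (whisker_exchange ε δ)
  refine Eq.symm (Eq.trans ?_ (e.symm.trans (Eq.trans ?_
    (e₁.symm.trans (Eq.trans ?_ (e₂.symm.trans ?_))))))
  all_goals monoidal

theorem IsMate.eq_leftMate {X X' Y Y' : C} {η : 𝟙_ C ⟶ X' ⊗ X} {ε : X ⊗ X' ⟶ 𝟙_ C}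
    (h : IsDual η ε) {δ : Y ⊗ Y' ⟶ 𝟙_ C} {f : X ⟶ Y} {g : Y' ⟶ X'} (hg : IsMate ε δ f g) :
    g = (λ_ _).inv ≫ η ▷ _ ≫ (_ ◁ f) ▷ _ ≫ (α_ _ _ _).hom ≫ _ ◁ δ ≫ (ρ_ _).hom := by
  have e₁ := congrArg (fun p => (λ_ _).inv ≫ η ▷ _ ≫ (α_ _ _ _).hom ≫ _ ◁ p ≫ (ρ_ _).hom) hg
  have e₂ := congrArg (fun p => (λ_ _).inv ≫ _ ◁ g ≫ p ≫ (ρ_ _).hom) h.ev_coev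
  refine (Eq.trans ?_ e₂.symm).trans (Eq.trans ?_ e₁ |>.trans ?_)
  · monoidal
  · have e := congrArg (fun p => (λ_ _).inv ≫ p ≫ (α_ _ _ _).hom ≫ _ ◁ ε ≫ (ρ_ _).hom)
      (whisker_exchange η g)
    refine Eq.trans ?_ (e.trans ?_)
    all_goals monoidal
  · monoidal

/-- A cup set against two nested caps straightens by a zigzag to the outer cap. Hence the mate of a
cup is a cap, and conversely. -/
theorem IsDual.isMate_coev {X X' W : C} {η : 𝟙_ C ⟶ X ⊗ X'} {ε : X' ⊗ X ⟶ 𝟙_ C}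
    (h : IsDual η ε) (δ : W ⊗ X' ⟶ 𝟙_ C) : IsMate (tensCap ε δ) (λ_ (𝟙_ C)).hom δ η := by
  have e := congrArg (fun p => (α_ _ _ _).hom ≫ W ◁ p ≫ W ◁ (λ_ _).hom ≫ δ) h.coev_ev
  simp only [IsMate, tensCap]
  refine Eq.trans ?_ (e.trans ?_)
  all_goals monoidal

theorem IsDual.coev_isMate {X X' W : C} {η : 𝟙_ C ⟶ X ⊗ X'} {ε : X' ⊗ X ⟶ 𝟙_ C}
    (h : IsDual η ε) (δ : X ⊗ W ⟶ 𝟙_ C) : IsMate (λ_ (𝟙_ C)).hom (tensCap ε δ) η δ := by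
  have e := congrArg (fun p => (α_ _ _ _).inv ≫ p ▷ W ≫ (ρ_ _).hom ▷ W ≫ δ) h.ev_coev
  simp only [IsMate, tensCap]
  refine Eq.symm (Eq.trans ?_ (e.trans ?_))
  all_goals monoidal

theorem IsMate.unit (f : 𝟙_ C ⟶ 𝟙_ C) : IsMate (λ_ (𝟙_ C)).hom (λ_ (𝟙_ C)).hom f f := by
  rw [IsMate, leftUnitor_naturality, unitors_equal, rightUnitor_naturality]

theorem IsMate.add [Preadditive C] [MonoidalPreadditive C] {A A' B B' : C} {ε : A ⊗ B ⟶ 𝟙_ C}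
    {ε' : A' ⊗ B' ⟶ 𝟙_ C} {g g' : A ⟶ A'} {f f' : B' ⟶ B}
    (h : IsMate ε ε' g f) (h' : IsMate ε ε' g' f') : IsMate ε ε' (g + g') (f + f') := by
  simp only [IsMate, MonoidalPreadditive.whiskerLeft_add, MonoidalPreadditive.add_whiskerRight,
    Preadditive.add_comp] at *
  rw [h, h']

theorem IsMate.smul {R : Type*} [Semiring R] [Preadditive C] [Linear R C] [MonoidalPreadditive C]
    [MonoidalLinear R C] {A A' B B' : C} {ε : A ⊗ B ⟶ 𝟙_ C}
    {ε' : A' ⊗ B' ⟶ 𝟙_ C} {g : A ⟶ A'} {f : B' ⟶ B} (r : R)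
    (h : IsMate ε ε' g f) : IsMate ε ε' (r • g) (r • f) := by
  simp only [IsMate, MonoidalLinear.whiskerLeft_smul, MonoidalLinear.smul_whiskerRight,
    Linear.smul_comp] at *
  rw [h]

theorem tensCap_assoc {A A' B B' D D' : C} (p : A' ⊗ A ⟶ 𝟙_ C) (q : B' ⊗ B ⟶ 𝟙_ C)
    (r : D' ⊗ D ⟶ 𝟙_ C) : tensCap (tensCap p q) r =
      (α_ D' B' A').inv ▷ _ ≫ _ ◁ (α_ A B D).hom ≫ tensCap p (tensCap q r) := by
  simp only [tensCap]; monoidal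

theorem tensCap_leftUnitor {A A' : C} (p : A' ⊗ A ⟶ 𝟙_ C) :
    tensCap p (λ_ (𝟙_ C)).hom = (λ_ A').hom ▷ _ ≫ _ ◁ (ρ_ A).hom ≫ p := by
  simp only [tensCap]; monoidal

theorem leftUnitor_tensCap {A A' : C} (p : A' ⊗ A ⟶ 𝟙_ C) :
    tensCap (λ_ (𝟙_ C)).hom p = (ρ_ A').hom ▷ _ ≫ _ ◁ (λ_ A).hom ≫ p := by
  simp only [tensCap]; monoidal

theorem tensCap_whiskerRight_comp {A A' W W' W'' : C} (p : A' ⊗ A ⟶ 𝟙_ C) (q : W' ⊗ W ⟶ 𝟙_ C)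
    (f : W'' ⟶ W') : tensCap p (f ▷ W ≫ q) = f ▷ A' ▷ (A ⊗ W) ≫ tensCap p q := by
  have e := congrArg (fun r => (α_ _ _ _).hom ≫ r ≫ q)
    (whisker_exchange f ((α_ A' A W).inv ≫ p ▷ W ≫ (λ_ W).hom))
  simp only [tensCap]
  refine Eq.trans ?_ (e.trans ?_)
  all_goals monoidal

theorem whiskerRight_comp_tensCap {A A' A'' W W' : C} (p : A' ⊗ A ⟶ 𝟙_ C) (q : W' ⊗ W ⟶ 𝟙_ C)
    (f : A'' ⟶ A') : tensCap (f ▷ A ≫ p) q = (W' ◁ f) ▷ (A ⊗ W) ≫ tensCap p q := by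
  simp only [tensCap]; monoidal

theorem tensCap_whiskerLeft_comp {A A' W W' W'' : C} (p : A' ⊗ A ⟶ 𝟙_ C) (q : W' ⊗ W ⟶ 𝟙_ C)
    (f : W'' ⟶ W) : tensCap p (W' ◁ f ≫ q) = (W' ⊗ A') ◁ A ◁ f ≫ tensCap p q := by
  have e := congrArg (fun r => (α_ _ _ _).hom ≫ W' ◁ ((α_ A' A W'').inv ≫ r ≫ (λ_ _).hom) ≫ q)
    (whisker_exchange p f)
  simp only [tensCap]
  refine Eq.trans ?_ (e.symm.trans ?_)
  all_goals monoidal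

theorem whiskerLeft_comp_tensCap {A A' A'' W W' : C} (p : A' ⊗ A ⟶ 𝟙_ C) (q : W' ⊗ W ⟶ 𝟙_ C)
    (f : A'' ⟶ A) : tensCap (A' ◁ f ≫ p) q = (W' ⊗ A') ◁ f ▷ W ≫ tensCap p q := by
  simp only [tensCap]; monoidal

end Duality

namespace Heis

variable {R : Type u} [CommRing R] {k : ℤ}

theorem rot_cons (a : Arrow) (w : Word) :
    (rot ⟨a :: w⟩ : Heis R k) = rot ⟨w⟩ ⊗ single a.flip :=
  congrArg Heis.mk (by simp [single, rot])

theorem rot_tensor (X Y : Heis R k) : rot (X ⊗ Y) = rot Y ⊗ rot X :=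
  congrArg Heis.mk (by simp [rot, tensorObj])

variable (c' : 𝟙_ (Heis R k) ⟶ up ⊗ down) (d' : (down ⊗ up : Heis R k) ⟶ 𝟙_ (Heis R k))

theorem associator_hom_eq (X Y Z : Heis R k) :
    (α_ X Y Z).hom = eqToHom (tensor_assoc_eq X Y Z) := rfl

theorem associator_inv_eq (X Y Z : Heis R k) :
    (α_ X Y Z).inv = eqToHom (tensor_assoc_eq X Y Z).symm := rfl

theorem capsRot_cons (a : Arrow) (w : Word) : capsRot d' (a :: w) =
    eqToHom (rot_cons a w) ▷ (single a ⊗ ⟨w⟩) ≫ tensCap (capGenRot d' a) (capsRot d' w) := by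
  have h : tensCap (capGenRot d' a) (capsRot d' w) =
      (α_ _ _ _).hom ≫ rot ⟨w⟩ ◁ (α_ _ _ _).inv ≫ (rot ⟨w⟩ ◁ capGenRot d' a ▷ ⟨w⟩ ⊗≫ capsRot d' w) := by
    rw [tensCap]; monoidal
  rw [h, capsRot, associator_hom_eq, associator_inv_eq, eqToHom_whiskerRight, whiskerLeft_eqToHom,
    eqToHom_trans_assoc, eqToHom_trans_assoc]
  rfl

theorem caps_cons (a : Arrow) (w : Word) : caps d' (a :: w) =
    (single a ⊗ ⟨w⟩) ◁ eqToHom (rot_cons a w) ≫ tensCap (caps d' w) (capGen d' a) := by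
  have h : tensCap (caps d' w) (capGen d' a) =
      (α_ _ _ _).hom ≫ single a ◁ (α_ _ _ _).inv ≫
        (single a ◁ caps d' w ▷ single a.flip ⊗≫ capGen d' a) := by
    rw [tensCap]; monoidal
  rw [h, caps, associator_hom_eq, associator_inv_eq, whiskerLeft_eqToHom, whiskerLeft_eqToHom,
    eqToHom_trans_assoc, eqToHom_trans_assoc]
  rfl

theorem cups_cons (a : Arrow) (w : Word) : cups c' (a :: w) =
    tensCup (cupGen c' a) (cups c' w) ≫ (single a ⊗ ⟨w⟩) ◁ eqToHom (rot_cons a w).symm := by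
  have h : tensCup (cupGen c' a) (cups c' w) = (cupGen c' a ⊗≫ single a ◁ cups c' w ▷ single a.flip) ≫
      single a ◁ (α_ _ _ _).hom ≫ (α_ _ _ _).inv := by
    rw [tensCup]; monoidal
  rw [h, cups, associator_hom_eq, associator_inv_eq, whiskerLeft_eqToHom, whiskerLeft_eqToHom]
  simp only [Category.assoc, eqToHom_trans, monoidalComp]
  rfl

theorem cupsRot_cons (a : Arrow) (w : Word) : cupsRot c' (a :: w) =
    tensCup (cupsRot c' w) (cupGenRot c' a) ≫ eqToHom (rot_cons a w).symm ▷ (single a ⊗ ⟨w⟩) := by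
  have h : tensCup (cupsRot c' w) (cupGenRot c' a) =
      (cupsRot c' w ⊗≫ rot ⟨w⟩ ◁ cupGenRot c' a ▷ ⟨w⟩) ≫
      rot ⟨w⟩ ◁ (α_ _ _ _).hom ≫ (α_ _ _ _).inv := by
    rw [tensCup]; monoidal
  rw [h, cupsRot, associator_hom_eq, associator_inv_eq, eqToHom_whiskerRight, whiskerLeft_eqToHom]
  simp only [Category.assoc, eqToHom_trans, monoidalComp]
  rfl

theorem capsRot_single (a : Arrow) : capsRot d' [a] = capGenRot d' a := by
  rw [capsRot_cons]
  refine (congrArg (_ ≫ ·) (tensCap_leftUnitor (capGenRot d' a))).trans ?_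
  change eqToHom rfl ▷ _ ≫ eqToHom rfl ▷ _ ≫ _ ◁ eqToHom rfl ≫ _ = _
  simp only [eqToHom_refl, id_whiskerRight, whiskerLeft_id, Category.id_comp]
  exact Category.id_comp _

theorem caps_single (a : Arrow) : caps d' [a] = capGen d' a := by
  rw [caps_cons]
  refine (congrArg (_ ≫ ·) (leftUnitor_tensCap (capGen d' a))).trans ?_
  change _ ◁ eqToHom rfl ≫ eqToHom rfl ▷ _ ≫ _ ◁ eqToHom rfl ≫ _ = _
  simp only [eqToHom_refl, id_whiskerRight, whiskerLeft_id, Category.id_comp]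
  exact Category.id_comp _

/-- The nested caps of a concatenation are the nest of the two families, by associativity of
nesting. This makes mates compatible with tensor products; the remaining factors are identities
along equalities of words. -/
theorem capsRot_append (w v : Word) : capsRot d' (w ++ v) =
    eqToHom (rot_tensor ⟨w⟩ ⟨v⟩) ▷ (⟨w⟩ ⊗ ⟨v⟩) ≫ tensCap (capsRot d' w) (capsRot d' v) := by
  induction w with
  | nil =>
    rw [show capsRot d' [] = (λ_ _).hom from rfl]
    refine Eq.symm ((congrArg (_ ≫ ·) (leftUnitor_tensCap (capsRot d' v))).trans ?_)
    change eqToHom (rot_tensor (𝟙_ _) ⟨v⟩) ▷ (𝟙_ _ ⊗ ⟨v⟩) ≫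
      eqToHom (show rot ⟨v⟩ ⊗ rot (𝟙_ _) = rot ⟨v⟩ from tensor_unit_eq _) ▷ (𝟙_ _ ⊗ ⟨v⟩) ≫
      rot ⟨v⟩ ◁ eqToHom (unit_tensor_eq ⟨v⟩) ≫ capsRot d' v = _
    simp only [eqToHom_whiskerRight, whiskerLeft_eqToHom, eqToHom_trans_assoc]
    exact Category.id_comp (X := rot ⟨v⟩ ⊗ ⟨v⟩) (capsRot d' v)
  | cons a w ih =>
    have e : rot (single a ⊗ ⟨w⟩ ⊗ ⟨v⟩ : Heis R k) = rot (⟨w⟩ ⊗ ⟨v⟩) ⊗ single a.flip :=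
      rot_cons a (w ++ v)
    have e' : rot ((single a ⊗ ⟨w⟩) ⊗ ⟨v⟩ : Heis R k) = rot ⟨v⟩ ⊗ rot (single a ⊗ ⟨w⟩) :=
      rot_tensor ⟨a :: w⟩ ⟨v⟩
    have e'' : rot (single a ⊗ ⟨w⟩ : Heis R k) = rot ⟨w⟩ ⊗ single a.flip := rot_cons a w
    have h₁ : eqToHom e ▷ _ ≫ tensCap (capGenRot d' a)
        (eqToHom (rot_tensor ⟨w⟩ ⟨v⟩) ▷ _ ≫ tensCap (capsRot d' w) (capsRot d' v)) =
        eqToHom (by rw [e, rot_tensor]) ≫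
          tensCap (capGenRot d' a) (tensCap (capsRot d' w) (capsRot d' v)) := by
      rw [tensCap_whiskerRight_comp]
      simp only [eqToHom_whiskerRight, eqToHom_trans_assoc]
    have h₂ : eqToHom e' ▷ _ ≫ tensCap (eqToHom e'' ▷ _ ≫ tensCap (capGenRot d' a) (capsRot d' w))
        (capsRot d' v) = eqToHom (by rw [e']; simp only [e'', tensor_assoc_eq]) ≫
          tensCap (capGenRot d' a) (tensCap (capsRot d' w) (capsRot d' v)) := by
      rw [whiskerRight_comp_tensCap, tensCap_assoc, associator_hom_eq, associator_inv_eq]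
      simp only [eqToHom_whiskerRight, whiskerLeft_eqToHom, eqToHom_trans_assoc]
    refine (capsRot_cons d' a (w ++ v)).trans ?_
    refine (congrArg (fun p : rot (⟨w⟩ ⊗ ⟨v⟩ : Heis R k) ⊗ (⟨w⟩ ⊗ ⟨v⟩) ⟶ 𝟙_ (Heis R k) =>
      eqToHom e ▷ (single a ⊗ ⟨w⟩ ⊗ ⟨v⟩) ≫ tensCap (capGenRot d' a) p) ih).trans (h₁.trans ?_)
    refine h₂.symm.trans ?_
    exact congrArg (fun p : rot (single a ⊗ ⟨w⟩ : Heis R k) ⊗ (single a ⊗ ⟨w⟩) ⟶ 𝟙_ (Heis R k) =>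
      eqToHom e' ▷ _ ≫ tensCap p (capsRot d' v)) (capsRot_cons d' a w).symm

theorem caps_append (w v : Word) : caps d' (w ++ v) =
    (⟨w⟩ ⊗ ⟨v⟩) ◁ eqToHom (rot_tensor ⟨w⟩ ⟨v⟩) ≫ tensCap (caps d' v) (caps d' w) := by
  induction w with
  | nil =>
    rw [show caps d' [] = (λ_ _).hom from rfl]
    refine Eq.symm ((congrArg (_ ≫ ·) (tensCap_leftUnitor (caps d' v))).trans ?_)
    change (𝟙_ _ ⊗ ⟨v⟩) ◁ eqToHom (rot_tensor (𝟙_ _) ⟨v⟩) ≫ eqToHom (unit_tensor_eq ⟨v⟩) ▷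
      (rot ⟨v⟩ ⊗ rot (𝟙_ _)) ≫
      ⟨v⟩ ◁ eqToHom (show rot ⟨v⟩ ⊗ rot (𝟙_ _) = rot ⟨v⟩ from tensor_unit_eq _) ≫ caps d' v = _
    simp only [eqToHom_whiskerRight, whiskerLeft_eqToHom, eqToHom_trans_assoc]
    exact Category.id_comp (X := ⟨v⟩ ⊗ rot ⟨v⟩) (caps d' v)
  | cons a w ih =>
    have e : rot (single a ⊗ ⟨w⟩ ⊗ ⟨v⟩ : Heis R k) = rot (⟨w⟩ ⊗ ⟨v⟩) ⊗ single a.flip :=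
      rot_cons a (w ++ v)
    have e' : rot ((single a ⊗ ⟨w⟩) ⊗ ⟨v⟩ : Heis R k) = rot ⟨v⟩ ⊗ rot (single a ⊗ ⟨w⟩) :=
      rot_tensor ⟨a :: w⟩ ⟨v⟩
    have e'' : rot (single a ⊗ ⟨w⟩ : Heis R k) = rot ⟨w⟩ ⊗ single a.flip := rot_cons a w
    have h₁ : _ ◁ eqToHom e ≫ tensCap
        (_ ◁ eqToHom (rot_tensor ⟨w⟩ ⟨v⟩) ≫ tensCap (caps d' v) (caps d' w)) (capGen d' a) =
        eqToHom (by simp only [e, rot_tensor, tensor_assoc_eq]) ≫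
          tensCap (caps d' v) (tensCap (caps d' w) (capGen d' a)) := by
      rw [whiskerLeft_comp_tensCap, tensCap_assoc, associator_hom_eq, associator_inv_eq]
      simp only [eqToHom_whiskerRight, whiskerLeft_eqToHom, eqToHom_trans_assoc]
    have h₂ : _ ◁ eqToHom e' ≫ tensCap (caps d' v)
        (_ ◁ eqToHom e'' ≫ tensCap (caps d' w) (capGen d' a)) =
        eqToHom (by rw [e', e'']) ≫
          tensCap (caps d' v) (tensCap (caps d' w) (capGen d' a)) := by
      rw [tensCap_whiskerLeft_comp]
      simp only [whiskerLeft_eqToHom, eqToHom_trans_assoc]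
    have h₀ := congrArg (fun p : (⟨w⟩ ⊗ ⟨v⟩) ⊗ rot (⟨w⟩ ⊗ ⟨v⟩ : Heis R k) ⟶ 𝟙_ (Heis R k) =>
      (single a ⊗ ⟨w⟩ ⊗ ⟨v⟩) ◁ eqToHom e ≫ tensCap p (capGen d' a)) ih
    have h₃ := congrArg (fun p : (single a ⊗ ⟨w⟩) ⊗ rot (single a ⊗ ⟨w⟩ : Heis R k) ⟶ 𝟙_ (Heis R k) =>
      ((single a ⊗ ⟨w⟩) ⊗ ⟨v⟩) ◁ eqToHom e' ≫ tensCap (caps d' v) p) (caps_cons d' a w).symm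
    have h₄ : caps d' (a :: w ++ v) = (single a ⊗ ⟨w⟩ ⊗ ⟨v⟩) ◁ eqToHom e ≫ tensCap (A' := ⟨w⟩ ⊗ ⟨v⟩)
      (A := rot (⟨w⟩ ⊗ ⟨v⟩ : Heis R k)) (caps d' (w ++ v)) (capGen d' a) := caps_cons d' a (w ++ v)
    refine h₄.trans ?_
    refine h₀.trans ?_
    refine h₁.trans ?_
    refine h₂.symm.trans ?_
    exact h₃

theorem capsRot_pair (a b : Arrow) :
    capsRot d' [a, b] = tensCap (capGenRot d' a) (capGenRot d' b) := by
  refine (capsRot_append d' [a] [b]).trans ?_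
  rw [capsRot_single, capsRot_single]
  change 𝟙 _ ▷ _ ≫ _ = _
  rw [id_whiskerRight]
  exact Category.id_comp _

theorem caps_pair (a b : Arrow) :
    caps d' [a, b] = tensCap (capGen d' b) (capGen d' a) := by
  refine (caps_append d' [a] [b]).trans ?_
  rw [caps_single, caps_single]
  change _ ◁ 𝟙 _ ≫ _ = _
  rw [whiskerLeft_id]
  exact Category.id_comp _

/-- The two mates of `f`, with respect to the nested cups and caps, exist and are equal. -/
def HasMate {X Y : Heis R k} (f : X ⟶ Y) : Prop :=
  ∃ g : rot Y ⟶ rot X, IsMate (B := Y) (B' := X) (capsRot d' Y.word) (capsRot d' X.word) g f ∧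
    IsMate (A := X) (A' := Y) (caps d' X.word) (caps d' Y.word) f g

variable {c' d'}

theorem HasMate.id (X : Heis R k) : HasMate d' (𝟙 X) := ⟨𝟙 _, .id _, .id _⟩

theorem HasMate.of_eq {X Y : Heis R k} (e : X = Y) : HasMate d' (eqToHom e) := by
  subst e; exact HasMate.id X

theorem HasMate.associator_hom (X Y Z : Heis R k) : HasMate d' (α_ X Y Z).hom :=
  .of_eq (tensor_assoc_eq X Y Z)

theorem HasMate.associator_inv (X Y Z : Heis R k) : HasMate d' (α_ X Y Z).inv :=
  .of_eq (tensor_assoc_eq X Y Z).symm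

theorem HasMate.leftUnitor_hom (X : Heis R k) : HasMate d' (λ_ X).hom := .of_eq (unit_tensor_eq X)

theorem HasMate.rightUnitor_inv (X : Heis R k) : HasMate d' (ρ_ X).inv :=
  .of_eq (tensor_unit_eq X).symm

theorem HasMate.comp {X Y Z : Heis R k} {f : X ⟶ Y} {g : Y ⟶ Z} (hf : HasMate d' f)
    (hg : HasMate d' g) : HasMate d' (f ≫ g) := by
  obtain ⟨f', h₁, h₂⟩ := hf
  obtain ⟨g', h₃, h₄⟩ := hg
  exact ⟨g' ≫ f', h₃.comp h₁, h₂.comp h₄⟩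

theorem HasMate.add {X Y : Heis R k} {f g : X ⟶ Y} (hf : HasMate d' f) (hg : HasMate d' g) :
    HasMate d' (f + g) := by
  obtain ⟨f', h₁, h₂⟩ := hf
  obtain ⟨g', h₃, h₄⟩ := hg
  exact ⟨f' + g', h₁.add h₃, h₂.add h₄⟩

theorem HasMate.smul {X Y : Heis R k} {f : X ⟶ Y} (r : R) (hf : HasMate d' f) :
    HasMate d' (r • f) := by
  obtain ⟨f', h₁, h₂⟩ := hf
  exact ⟨r • f', h₁.smul r, h₂.smul r⟩

theorem HasMate.zero (X Y : Heis R k) : HasMate d' (0 : X ⟶ Y) :=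
  ⟨0, by simp [IsMate], by simp [IsMate]⟩

theorem HasMate.sum {X Y : Heis R k} {ι : Type*} (s : Finset ι) {f : ι → (X ⟶ Y)}
    (hf : ∀ i, HasMate d' (f i)) : HasMate d' (∑ i ∈ s, f i) := by
  classical
  induction s using Finset.induction_on with
  | empty => exact HasMate.zero X Y
  | insert i s hi ih => rw [Finset.sum_insert hi]; exact (hf i).add ih

theorem HasMate.tensor {X X' Y Y' : Heis R k} {f : X ⟶ Y} {g : X' ⟶ Y'} (hf : HasMate d' f)
    (hg : HasMate d' g) : HasMate d' (f ⊗ₘ g) := by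
  obtain ⟨f', h₁, h₂⟩ := hf
  obtain ⟨g', h₃, h₄⟩ := hg
  refine ⟨eqToHom (rot_tensor Y Y') ≫ (g' ⊗ₘ f') ≫ eqToHom (rot_tensor X X').symm, ?_, ?_⟩
  · have := (h₁.tensor h₃).of_eq_left (rot_tensor Y Y') (rot_tensor X X')
    have e := capsRot_append d' X.word X'.word
    have e' := capsRot_append d' Y.word Y'.word
    change IsMate (capsRot d' (Y.word ++ Y'.word)) (capsRot d' (X.word ++ X'.word)) _ _
    rw [e, e']
    exact this
  · have := (h₄.tensor h₂).of_eq_right (rot_tensor X X') (rot_tensor Y Y')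
    have e := caps_append d' X.word X'.word
    have e' := caps_append d' Y.word Y'.word
    change IsMate (caps d' (X.word ++ X'.word)) (caps d' (Y.word ++ Y'.word)) _ _
    rw [e, e']
    exact this

theorem HasMate.whiskerLeft (X : Heis R k) {Y Z : Heis R k} {f : Y ⟶ Z} (hf : HasMate d' f) :
    HasMate d' (X ◁ f) := (HasMate.id X).tensor hf

theorem HasMate.whiskerRight {Y Z : Heis R k} {f : Y ⟶ Z} (hf : HasMate d' f) (X : Heis R k) :
    HasMate d' (f ▷ X) := hf.tensor (HasMate.id X)

theorem HasMate.unit (f : 𝟙_ (Heis R k) ⟶ 𝟙_ (Heis R k)) : HasMate d' f :=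
  ⟨f, .unit f, .unit f⟩

end Heis

end Heisenberg

/-! ### Every morphism has equal mates: rigidity and pivotality. -/

namespace Heisenberg

namespace Heis

variable {R : Type u} [CommRing R] {k : ℤ}

variable {c' : 𝟙_ (Heis R k) ⟶ up ⊗ down} {d' : (down ⊗ up : Heis R k) ⟶ 𝟙_ (Heis R k)}

theorem isDual_c_d : IsDual (c : 𝟙_ (Heis R k) ⟶ _) d := ⟨zigzag_up, zigzag_down⟩

/-- Rotating the rightward cup by a half turn in either direction gives the leftward cap `d'`, in
one direction by the first right zigzag and in the other by the second. -/
theorem hasMate_c : HasMate d' (c : 𝟙_ (Heis R k) ⟶ down ⊗ up) := by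
  refine ⟨d', ?_, ?_⟩
  · change IsMate (capsRot d' [Arrow.down, Arrow.up]) _ _ _
    rw [capsRot_pair]
    exact isDual_c_d.isMate_coev d'
  · change IsMate _ (caps d' [Arrow.down, Arrow.up]) _ _
    rw [caps_pair]
    exact isDual_c_d.coev_isMate d'

theorem hasMate_d' : HasMate d' d' := by
  refine ⟨(c : 𝟙_ (Heis R k) ⟶ _), ?_, ?_⟩
  · change IsMate _ (capsRot d' [Arrow.down, Arrow.up]) _ _
    rw [capsRot_pair]
    exact isDual_c_d.coev_isMate d'
  · change IsMate (caps d' [Arrow.down, Arrow.up]) _ _ _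
    rw [caps_pair]
    exact isDual_c_d.isMate_coev d'

namespace Relations

variable {a b : ℤ → (𝟙_ (Heis R k) ⟶ 𝟙_ (Heis R k))} (h : Relations c' d' a b)
include h

theorem isDual : IsDual c' d' := ⟨h.zigzag_down', h.zigzag_up'⟩

theorem isDual_gen (e : Arrow) : IsDual (cupGen c' e) (capGenRot d' e) :=
  match e with
  | Arrow.up => h.isDual
  | Arrow.down => isDual_c_d

theorem isDual_genRot (e : Arrow) : IsDual (cupGenRot c' e) (capGen d' e) :=
  match e with
  | Arrow.up => isDual_c_d
  | Arrow.down => h.isDual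

theorem isDual_cups (w : Word) : IsDual (cups c' w) (capsRot d' w) := by
  induction w with
  | nil => exact IsDual.unit
  | cons e w ih =>
    rw [cups_cons, capsRot_cons]
    exact ((h.isDual_gen e).tensor ih).of_eq_right (rot_cons e w)

theorem isDual_cupsRot (w : Word) : IsDual (cupsRot c' w) (caps d' w) := by
  induction w with
  | nil => exact IsDual.unit
  | cons e w ih =>
    rw [cupsRot_cons, caps_cons]
    exact (ih.tensor (h.isDual_genRot e)).of_eq_left (rot_cons e w)

/-- One mate of the dot uses `c', d'` and the other `c, d`; they agree by cyclicity. -/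
theorem hasMate_x : HasMate d' (x : (up : Heis R k) ⟶ up) := by
  refine ⟨(xRight : (down : Heis R k) ⟶ down), ?_, ?_⟩
  · have e : xLeft c' d' = (ρ_ _).inv ≫ _ ◁ c' ≫ _ ◁ x ▷ _ ≫ (α_ _ _ _).inv ≫ d' ▷ _ ≫
        (λ_ _).hom := by
      rw [xLeft]; monoidal
    change IsMate (capsRot d' [Arrow.up]) (capsRot d' [Arrow.up]) _ _
    rw [capsRot_single, h.xRight_eq, e]
    exact IsMate.rightMate h.isDual d' x
  · have e : (xRight : (down : Heis R k) ⟶ down) = (λ_ _).inv ≫ c ▷ _ ≫ (_ ◁ x) ▷ _ ≫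
        (α_ _ _ _).hom ≫ _ ◁ d ≫ (ρ_ _).hom := by
      rw [xRight]; monoidal
    change IsMate (caps d' [Arrow.up]) (caps d' [Arrow.up]) _ _
    rw [caps_single, e]
    exact IsMate.leftMate isDual_c_d d x

theorem hasMate_s : HasMate d' (s : (up ⊗ up : Heis R k) ⟶ up ⊗ up) := by
  refine ⟨(sRight : (down ⊗ down : Heis R k) ⟶ down ⊗ down), ?_, ?_⟩
  · have e : sLeft c' d' = (ρ_ _).inv ≫ _ ◁ tensCup c' c' ≫ _ ◁ s ▷ _ ≫ (α_ _ _ _).inv ≫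
        tensCap d' d' ▷ _ ≫ (λ_ _).hom := by
      rw [sLeft, tensCap, tensCup]; monoidal
    change IsMate (capsRot d' [Arrow.up, Arrow.up]) (capsRot d' [Arrow.up, Arrow.up]) _ _
    rw [capsRot_pair, h.sRight_eq, e]
    exact IsMate.rightMate (h.isDual.tensor h.isDual) (tensCap d' d') s
  · have e : (sRight : (down ⊗ down : Heis R k) ⟶ down ⊗ down) = (λ_ _).inv ≫ tensCup c c ▷ _ ≫
        (_ ◁ s) ▷ _ ≫ (α_ _ _ _).hom ≫ _ ◁ tensCap d d ≫ (ρ_ _).hom := by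
      rw [sRight, tensCap, tensCup]; monoidal
    change IsMate (caps d' [Arrow.up, Arrow.up]) (caps d' [Arrow.up, Arrow.up]) _ _
    rw [caps_pair, e]
    exact IsMate.leftMate (isDual_c_d.tensor isDual_c_d) (tensCap d d) s

theorem hasMate_c' : HasMate d' c' := by
  refine ⟨(d : (up ⊗ down : Heis R k) ⟶ _), ?_, ?_⟩
  · change IsMate (capsRot d' [Arrow.up, Arrow.down]) _ _ _
    rw [capsRot_pair]
    exact h.isDual.isMate_coev d
  · change IsMate _ (caps d' [Arrow.up, Arrow.down]) _ _
    rw [caps_pair]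
    exact h.isDual.coev_isMate d

theorem hasMate_d : HasMate d' (d : (up ⊗ down : Heis R k) ⟶ _) := by
  refine ⟨c', ?_, ?_⟩
  · change IsMate _ (capsRot d' [Arrow.up, Arrow.down]) _ _
    rw [capsRot_pair]
    exact h.isDual.coev_isMate d
  · change IsMate (caps d' [Arrow.up, Arrow.down]) _ _ _
    rw [caps_pair]
    exact h.isDual.isMate_coev d

theorem hasMate_xPow (n : ℕ) : HasMate d' (xPow n : (up : Heis R k) ⟶ up) := by
  induction n with
  | zero => exact HasMate.id _
  | succ n ih => rw [xPow_succ]; exact ih.comp h.hasMate_x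

/-- The adjoined inverse equals `t'`, a composite of morphisms already treated. `cupInv` and
`capInv` are handled likewise, with endomorphisms of the unit as coefficients. -/
theorem hasMate_tInv : HasMate d' (tInv : (down ⊗ up : Heis R k) ⟶ up ⊗ down) := by
  have e : t' c' d' = (ρ_ _).inv ≫ (down ⊗ up) ◁ c' ≫ (α_ down up (up ⊗ down)).hom ≫
      down ◁ (α_ up up down).inv ≫ down ◁ s ▷ down ≫ down ◁ (α_ up up down).hom ≫
      (α_ down up (up ⊗ down)).inv ≫ d' ▷ (up ⊗ down) ≫ (λ_ _).hom := by
    rw [t']; monoidal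
  rw [h.tInv_eq, e]
  exact (HasMate.rightUnitor_inv _).comp <| (h.hasMate_c'.whiskerLeft _).comp <|
    (HasMate.associator_hom _ _ _).comp <| ((HasMate.associator_inv _ _ _).whiskerLeft _).comp <|
    ((h.hasMate_s.whiskerRight _).whiskerLeft _).comp <|
    ((HasMate.associator_hom _ _ _).whiskerLeft _).comp <|
    (HasMate.associator_inv _ _ _).comp <| (hasMate_d'.whiskerRight _).comp
    (HasMate.leftUnitor_hom _)

theorem hasMate_cupInv (r : ℕ) : HasMate d' (cupInv r : 𝟙_ (Heis R k) ⟶ _) := by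
  obtain ⟨N, f, e⟩ := h.cupInv_eq r
  rw [e]
  exact HasMate.sum _ fun i =>
    (HasMate.unit _).comp (h.hasMate_c'.comp ((h.hasMate_xPow i).whiskerRight _))

theorem hasMate_capInv (r : ℕ) : HasMate d' (capInv r : _ ⟶ 𝟙_ (Heis R k)) := by
  obtain ⟨N, f, e⟩ := h.capInv_eq r
  rw [e]
  exact HasMate.sum _ fun i =>
    (((h.hasMate_xPow i).whiskerLeft _).comp hasMate_d').comp (HasMate.unit _)

/-- The property passes through every constructor of `Diag`, so it holds for all morphisms once it
holds for the generators. -/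
theorem hasMate_mk' {w v : Word} (f : Diag R k w v) : HasMate d' (mk' f) := by
  induction f with
  | gen g =>
    cases g with
    | x => exact h.hasMate_x
    | s => exact h.hasMate_s
    | c => exact hasMate_c
    | d => exact h.hasMate_d
    | tInv => exact h.hasMate_tInv
    | cupInv r =>
      have := h.hasMate_cupInv r
      rwa [cupInv, dif_pos r.2] at this
    | capInv r =>
      have := h.hasMate_capInv r
      rwa [capInv, dif_pos r.2] at this
  | ident w => exact HasMate.id _
  | comp f g hf hg => exact hf.comp hg
  | tensor f g hf hg => exact hf.tensor hg
  | zero w v => exact HasMate.zero _ _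
  | add f g hf hg => exact hf.add hg
  | smul r f hf => exact hf.smul r

theorem hasMate {X Y : Heis R k} (f : X ⟶ Y) : HasMate d' f := by
  obtain ⟨f⟩ := f
  exact h.hasMate_mk' f

theorem isStrictlyPivotal : IsStrictlyPivotal c' d' := by
  refine ⟨fun X => (h.isDual_cups X.word).exactPairing,
    fun X => (h.isDual_cupsRot X.word).exactPairing, fun X => ⟨rfl, rfl⟩, fun X => ⟨rfl, rfl⟩, ?_⟩
  intro X Y f
  obtain ⟨g, h₁, h₂⟩ := h.hasMate f
  exact (h₁.eq_rightMate (h.isDual_cups X.word)).symm.trans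
    (h₂.eq_leftMate (h.isDual_cupsRot X.word))

/-- The left and right dual of `X` is `rot X`. -/
@[reducible] def rigidCategory : RigidCategory (Heis R k) where
  toRightRigidCategory :=
    @RightRigidCategory.mk _ _ _ fun X => @HasRightDual.mk _ _ _ X (rot X)
      (h.isDual_cups X.word).exactPairing
  toLeftRigidCategory :=
    @LeftRigidCategory.mk _ _ _ fun X => @HasLeftDual.mk _ _ _ X (rot X)
      (h.isDual_cupsRot X.word).exactPairing

theorem zigzag_up'_eq_id : 𝟙 _ ⊗≫ c' ▷ up ⊗≫ up ◁ d' ⊗≫ 𝟙 _ = 𝟙 (up : Heis R k) := by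
  have e := congrArg (fun p => (λ_ _).inv ≫ p ≫ (ρ_ _).hom) h.zigzag_up'
  refine Eq.trans ?_ (e.trans ?_)
  all_goals monoidal

theorem zigzag_down'_eq_id : 𝟙 _ ⊗≫ down ◁ c' ⊗≫ d' ▷ down ⊗≫ 𝟙 _ = 𝟙 (down : Heis R k) := by
  have e := congrArg (fun p => (ρ_ _).inv ≫ p ≫ (λ_ _).hom) h.zigzag_down'
  refine Eq.trans ?_ (e.trans ?_)
  all_goals monoidal

end Relations

end Heis

end Heisenberg

open Heisenberg Heisenberg.Heis in
theorem theorem2 {R : Type u} [CommRing R] (k : ℤ) :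
    -- the leftward cup and cap exist and are unique
    (∃! p : (𝟙_ (Heis R k) ⟶ up ⊗ down) × ((down ⊗ up : Heis R k) ⟶ 𝟙_ (Heis R k)),
      IsLeftwardCupCap p.1 p.2) ∧
    ∀ (c' : 𝟙_ (Heis R k) ⟶ up ⊗ down) (d' : (down ⊗ up : Heis R k) ⟶ 𝟙_ (Heis R k)),
      IsLeftwardCupCap c' d' →
      -- (i) infinite Grassmannian relations
      ((∀ r : ℤ, r < k → cw c' d' r = if r = k - 1 then -1 else 0) ∧
        (∀ r : ℤ, r < -k → ccw c' d' r = if r = -k - 1 then 1 else 0) ∧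
        (∀ m : ℕ, ∑ p ∈ Finset.HasAntidiagonal.antidiagonal m,
          bubbleLeft (cw c' d' (p.1 + k - 1)) (ccw c' d' (p.2 - k - 1)) =
            if m = 0 then -𝟙 (𝟙_ (Heis R k)) else 0)) ∧
      -- (ii) left adjunction, and hence rigidity
      ((𝟙 _ ⊗≫ c' ▷ up ⊗≫ up ◁ d' ⊗≫ 𝟙 _ = 𝟙 (up : Heis R k) ∧
        𝟙 _ ⊗≫ down ◁ c' ⊗≫ d' ▷ down ⊗≫ 𝟙 _ = 𝟙 (down : Heis R k)) ∧
        Nonempty (RigidCategory (Heis R k))) ∧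
      -- (iii) cyclicity, and hence strict pivotality
      (((xRight : (down : Heis R k) ⟶ down) = xLeft c' d' ∧
        (sRight : (down ⊗ down : Heis R k) ⟶ down ⊗ down) = sLeft c' d') ∧
        IsStrictlyPivotal c' d') ∧
      -- (iv) curl relations
      (∀ r : ℕ,
        curlLeft d' r = ∑ᶠ n : ℕ, bubbleLeft (ccw c' d' (r - n - 1)) (xPow n) ∧
        curlRight c' r = -∑ᶠ n : ℕ, bubbleRight (xPow n) (cw c' d' (r - n - 1))) ∧
      -- (v) bubble slides
      (∀ r : ℤ,
        bubbleRight (𝟙 up) (ccw c' d' r) = bubbleLeft (ccw c' d' r) (𝟙 up) -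
          ∑ᶠ n : ℕ, (n + 1) • bubbleLeft (ccw c' d' (r - n - 2)) (xPow n) ∧
        bubbleLeft (cw c' d' r) (𝟙 up) = bubbleRight (𝟙 up) (cw c' d' r) -
          ∑ᶠ n : ℕ, (n + 1) • bubbleRight (xPow n) (cw c' d' (r - n - 2))) ∧
      -- (vi) alternating braid relation
      ((2 ≤ k → altLeft c' d' - altRight c' d' =
          ∑ᶠ q : ℕ × ℕ × ℕ, bubbleLeft (ccw c' d' (-q.1 - q.2.1 - q.2.2 - 3))
            (𝟙 _ ⊗≫ ((dDot q.2.1 ≫ cDot' c' q.1) ⊗ₘ xPow q.2.2) ⊗≫ 𝟙 _)) ∧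
        (-1 ≤ k → k ≤ 1 → altLeft c' d' - altRight c' d' = 0) ∧
        (k ≤ -2 → altLeft c' d' - altRight c' d' =
          ∑ᶠ q : ℕ × ℕ × ℕ,
            bubbleRight (xPow q.2.2 ⊗ₘ (dDot' d' q.2.1 ≫ cDot q.1))
              (cw c' d' (-q.1 - q.2.1 - q.2.2 - 3)))) := by
  refine ⟨existsUnique_isLeftwardCupCap, fun c' d' h => ?_⟩
  have hr := h.relations
  refine ⟨⟨fun r hk => (hr.a_of_lt r hk).trans (by split_ifs <;> rfl),
    fun r hk => (hr.b_of_lt r hk).trans (by split_ifs <;> rfl), hr.grassmannian_cw⟩,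
    ⟨⟨hr.zigzag_up'_eq_id, hr.zigzag_down'_eq_id⟩, ⟨hr.rigidCategory⟩⟩,
    ⟨⟨hr.xRight_eq, hr.sRight_eq⟩, hr.isStrictlyPivotal⟩,
    fun r => ⟨hr.curlLeft_eq_finsum r, hr.curlRight_eq_finsum r⟩,
    fun r => ⟨hr.slide_ccw r, hr.slide_cw r⟩,
    fun hk => hr.altLeft_sub_of_nonneg (by omega), fun hk hk' => hr.altLeft_sub_eq_zero hk hk',
    fun hk => hr.altLeft_sub_of_nonpos (by omega)⟩
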